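/- **Theorem 2.6 (Approximation result for reconstructions).** Let $d\in\{1,2,3\}$, $c>0$, and write $S^{d-1}\subset\mathbb R^d$ for the unit sphere; powers of complex numbers are taken with the principal branch. Let $\hat u_0:\mathbb R^d\to\mathbb C$ be continuous with compact support, and let $b:\mathbb R\to\mathbb R$ be (Lebesgue) measurable. Let $\rho>0$ and let $W_\rho\in C^{d-1}(\mathbb R;\mathbb R)$ satisfy $W_\rho(\xi)=0$ for $\xi\le 0$, $W_\rho(\xi)=|\xi|^{(d-1)/2}$ for $\xi\ge\rho$, and $0\le W_\rho(\xi)\le|\xi|^{(d-1)/2}$ for $\xi\ge 0$. For $\xi,z\in\mathbb R$, $q\in S^{d-1}$, $\tau>0$, $t>0$, $\varepsilon>0$, $x,k\in\mathbb R^d$ (with $x\neq0$ in the definition of $\mathcal S$) define $$(\mathcal R\hat u_0)(\xi,q)=\Big(\frac{|\xi|}{2\pi i}\Big)^{(d-1)/2}\mathbf 1_{\{\xi>0\}}\,\hat u_0(|\xi|q),\qquad (\mathcal R_\rho\hat u_0)(\xi,q)=\Big(\frac{1}{2\pi i}\Big)^{(d-1)/2}W_\rho(\xi)\,\hat u_0(|\xi|q),$$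 $$(J_b\hat V_0)(\xi,q,\tau)=e^{-ib(\xi)\tau}\hat V_0(\xi,q),\qquad (\mathcal F_1^{-1}\hat V)(z,q,\tau)=\frac1{2\pi}\int_{\mathbb R}e^{iz\xi}\hat V(\xi,q,\tau)\,d\xi,$$ $$(\mathcal S V)(x,t)=\frac{1}{(ct)^{(d-1)/2}}\mathbf 1_{\{|x|<2ct\}}V\Big(|x|-ct,\frac{x}{|x|},\varepsilon^2t\Big),\qquad (\mathcal F_du)(k)=\int_{\mathbb R^d}u(x)e^{-ik\cdot x}\,dx,$$ and set $\hat{\mathcal Q}_b=\mathcal F_d\circ\mathcal S\circ\mathcal F_1^{-1}\circ J_b\circ\mathcal R$ and $\hat{\mathcal Q}_b^\rho=\mathcal F_d\circ\mathcal S\circ\mathcal F_1^{-1}\circ J_b\circ\mathcal R_\rho$ (these depend on $\varepsilon$ through $\mathcal S$). Let $\hat V^\rho=J_b\mathcal R_\rho\hat u_0$ and $V^\rho=\mathcal F_1^{-1}\hat V^\rho$, and assume: (i) there are $C,\alpha>0$ such that $|V^\rho(z,q,\tau)|\le C(1+|z|)^{-d-\alpha}$ for all $\tau>0$, $q\in S^{d-1}$,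 $z\in\mathbb R$; (ii) for every $\tau>0$ the function $(\xi,q)\mapsto\hat V^\rho(\xi,q,\tau)$ is of class $C^{d-1}(\mathbb R\times S^{d-1};\mathbb C)$. Then for every $\tau>0$ and every $k\in\mathbb R^d$ with $|k|>\rho$, $$(\hat{\mathcal Q}_b^\rho\hat u_0)(k,\tau/\varepsilon^2)\,e^{ic|k|\tau/\varepsilon^2}\to e^{-ib(|k|)\tau}\hat u_0(k)\qquad\text{as }\varepsilon\to0^+.$$ Moreover, for every $\tau>0$, as functions of $k\in\mathbb R^d$, $$(\hat{\mathcal Q}_b\hat u_0)(k,\tau/\varepsilon^2)\,e^{ic|k|\tau/\varepsilon^2}\rightharpoonup e^{-ib(|k|)\tau}\hat u_0(k)\qquad\text{weakly in }L^2(\mathbb R^d)\text{ as }\varepsilon\to0^+.$$ -/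

import Mathlib

open Filter Topology MeasureTheory
open scoped Manifold ContDiff RealInnerProductSpace

noncomputable section

namespace ShellReconstruction

/-- Euclidean space `ℝ^d`. -/
abbrev Space (d : ℕ) : Type := EuclideanSpace ℝ (Fin d)

/-- The unit sphere `S^{d-1} ⊂ ℝ^d`. -/
abbrev Sphere (d : ℕ) : Type := Metric.sphere (0 : Space d) 1

/-- For `d ≥ 1` Mathlib's manifold structure on the unit sphere of `ℝ^d` has dimension `d - 1`. -/
instance finrankSpaceFact (d : ℕ) [NeZero d] :
    Fact (Module.finrank ℝ (Space d) = (d - 1) + 1) :=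
  ⟨by rw [finrank_euclideanSpace_fin]; have := NeZero.ne d; omega⟩

/-- The `d`-dimensional Fourier transform `(F_d u)(k) = ∫ u(x) e^{-i k·x} dx`. -/
def fourierSpace {d : ℕ} (u : Space d → ℂ) (k : Space d) : ℂ :=
  ∫ x : Space d, u x * Complex.exp (-Complex.I * (⟪k, x⟫ : ℝ))

/-- The inverse Fourier transform `F_1^{-1}` in the first variable of a profile evolution,
`V(z,q,τ) = (2π)^{-1} ∫ e^{i z ξ} V̂(ξ,q,τ) dξ`. -/
def fourierInvProfile {d : ℕ} (Vhat : ℝ → Sphere d → ℝ → ℂ) (z : ℝ) (q : Sphere d) (τ : ℝ) : ℂ :=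
  (1 / (2 * Real.pi) : ℂ) * ∫ ξ : ℝ, Complex.exp (Complex.I * (z * ξ)) * Vhat ξ q τ

/-- The operator `R`: `(R û)(ξ,q) = (|ξ| / (2πi))^{(d-1)/2} 1_{ξ > 0} û(|ξ| q)`
(principal branch of the power). -/
def restriction {d : ℕ} (uhat : Space d → ℂ) (ξ : ℝ) (q : Sphere d) : ℂ :=
  ((|ξ| : ℝ) / (2 * Real.pi * Complex.I) : ℂ) ^ (((d : ℂ) - 1) / 2)
    * (if 0 < ξ then 1 else 0) * uhat (|ξ| • (q : Space d))

/-- The admissible regularizations `W_ρ` of `ξ ↦ |ξ|^{(d-1)/2} 1_{ξ > 0}`. -/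
structure IsRegularizedWeight (d : ℕ) (ρ : ℝ) (W : ℝ → ℝ) : Prop where
  contDiff : ContDiff ℝ ((d - 1 : ℕ) : WithTop ℕ∞) W
  eq_zero : ∀ ξ : ℝ, ξ ≤ 0 → W ξ = 0
  eq_weight : ∀ ξ : ℝ, ρ ≤ ξ → W ξ = |ξ| ^ (((d : ℝ) - 1) / 2)
  nonneg : ∀ ξ : ℝ, 0 ≤ ξ → 0 ≤ W ξ
  le_weight : ∀ ξ : ℝ, 0 ≤ ξ → W ξ ≤ |ξ| ^ (((d : ℝ) - 1) / 2)

/-- The regularized operator `R_ρ` determined by the weight `W = W_ρ`: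
`(R_ρ û)(ξ,q) = (1 / (2πi))^{(d-1)/2} W_ρ(ξ) û(|ξ| q)`. -/
def restrictionReg {d : ℕ} (W : ℝ → ℝ) (uhat : Space d → ℂ) (ξ : ℝ) (q : Sphere d) : ℂ :=
  (1 / (2 * Real.pi * Complex.I) : ℂ) ^ (((d : ℂ) - 1) / 2) * W ξ * uhat (|ξ| • (q : Space d))

/-- The operator `J_b`: `(J_b V̂₀)(ξ,q,τ) = e^{-i b(ξ) τ} V̂₀(ξ,q)`. -/
def evolution {d : ℕ} (b : ℝ → ℝ) (Vhat₀ : ℝ → Sphere d → ℂ) (ξ : ℝ) (q : Sphere d) (τ : ℝ) : ℂ :=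
  Complex.exp (-Complex.I * b ξ * τ) * Vhat₀ ξ q

/-- The direction `x / |x|` of a nonzero vector, as a point of the sphere. -/
def direction {d : ℕ} (x : Space d) (hx : x ≠ 0) : Sphere d :=
  ⟨‖x‖⁻¹ • x, by simp [norm_smul, norm_ne_zero_iff.mpr hx]⟩

open Classical in
/-- The shell operator `S` with parameters `c, ε`:
`(S V)(x,t) = (c t)^{-(d-1)/2} 1_{|x| < 2ct} V(|x| - ct, x/|x|, ε² t)`. At the single point
`x = 0`, where the direction `x / |x|` does not exist, the value is set to `0`. -/
def shell {d : ℕ} (c ε : ℝ) (V : ℝ → Sphere d → ℝ → ℂ) (x : Space d) (t : ℝ) : ℂ :=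
  if hx : x ≠ 0 then
    (1 / ((c * t) ^ (((d : ℝ) - 1) / 2) : ℝ) : ℂ) * (if ‖x‖ < 2 * c * t then 1 else 0)
      * V (‖x‖ - c * t) (direction x hx) (ε ^ 2 * t)
  else 0

/-- The reconstruction operator `Q_b = S ∘ F_1^{-1} ∘ J_b ∘ R`. -/
def reconstruction {d : ℕ} (c ε : ℝ) (b : ℝ → ℝ) (uhat : Space d → ℂ) :
    Space d → ℝ → ℂ :=
  shell c ε (fourierInvProfile (evolution b (restriction uhat)))

/-- The regularized reconstruction operator `Q_b^ρ = S ∘ F_1^{-1} ∘ J_b ∘ R_ρ`. -/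
def reconstructionReg {d : ℕ} (c ε : ℝ) (b W : ℝ → ℝ) (uhat : Space d → ℂ) :
    Space d → ℝ → ℂ :=
  shell c ε (fourierInvProfile (evolution b (restrictionReg W uhat)))

/-- The reconstruction in Fourier space, `Q̂_b = F_d ∘ Q_b`. -/
def reconstructionHat {d : ℕ} (c ε : ℝ) (b : ℝ → ℝ) (uhat : Space d → ℂ)
    (k : Space d) (t : ℝ) : ℂ :=
  fourierSpace (fun x => reconstruction c ε b uhat x t) k

/-- The regularized reconstruction in Fourier space, `Q̂_b^ρ = F_d ∘ Q_b^ρ`. -/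
def reconstructionRegHat {d : ℕ} (c ε : ℝ) (b W : ℝ → ℝ) (uhat : Space d → ℂ)
    (k : Space d) (t : ℝ) : ℂ :=
  fourierSpace (fun x => reconstructionReg c ε b W uhat x t) k

/-- The decay and smoothness condition on a profile evolution `V = F_1^{-1} V̂`, expressed through
its Fourier transform `V̂ = F_1 V` in the first variable:
* `|V(z,q,τ)| ≤ C (1+|z|)^{-d-α}` for some `C, α > 0`, for all `z, q` and all `τ > 0`;
* for every `τ > 0`, `(ξ,q) ↦ V̂(ξ,q,τ)` is of class `C^{d-1}` on the manifold `ℝ × S^{d-1}`. -/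
structure DecayAndSmoothness {d : ℕ} [NeZero d] (Vhat : ℝ → Sphere d → ℝ → ℂ) : Prop where
  decay : ∃ C : ℝ, ∃ α : ℝ, 0 < C ∧ 0 < α ∧
    ∀ τ : ℝ, 0 < τ → ∀ (q : Sphere d) (z : ℝ),
      ‖fourierInvProfile Vhat z q τ‖ ≤ C * (1 + |z|) ^ (-(d : ℝ) - α)
  smooth : ∀ τ : ℝ, 0 < τ →
    ContMDiff (𝓘(ℝ, ℝ).prod (𝓡 (d - 1))) 𝓘(ℝ, ℂ) ((d - 1 : ℕ) : WithTop ℕ∞)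
      (fun p : ℝ × Sphere d => Vhat p.1 p.2 τ)

/-- Weak convergence `F_ε ⇀ G` in `L²(ℝ^d; ℂ)` as `ε → 0`, `ε > 0`; all the functions involved
are required to be elements of `L²`. -/
def TendstoWeaklyL2 {d : ℕ} (F : ℝ → Space d → ℂ) (G : Space d → ℂ) : Prop :=
  (∀ ε : ℝ, 0 < ε → MemLp (F ε) 2 volume) ∧ MemLp G 2 volume ∧
    ∀ g : Space d → ℂ, MemLp g 2 volume →
      Tendsto (fun ε : ℝ => ∫ k, F ε k * (starRingEnd ℂ) (g k)) (𝓝[>] 0)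
        (𝓝 (∫ k, G k * (starRingEnd ℂ) (g k)))

end ShellReconstruction

end

open Filter Topology MeasureTheory
open scoped Manifold ContDiff RealInnerProductSpace

noncomputable section

/-! Put `N = c τ / ε²`. At time `τ / ε²` the reconstruction is a shell of radius `N` with amplitude
`N^{-(d-1)/2}` and profile `V`, so the theorem concerns `N → ∞`. In polar coordinates with `z = |x|
- N`, its Fourier transform is the integral over the sphere of `e^{-iN k·q}` times `∫ w(z) V(z,q)
e^{-iz k·q} dz`, where `w(z) = N^{(d-1)/2} (1 + z/N)^{d-1}` for `|z| < N` and `w(z) = 0` otherwise.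
This weight is `N^{(d-1)/2}`, plus `2z` when `d = 3`, plus a remainder that tends to zero under an
integrable bound.

By Fourier inversion the leading weight turns the inner integral into `V̂(k·q, q)`. With `e =
k/|k|`, the factor `e^{iN|k|}` changes the plane wave into `e^{iN|k|(1 - e·q)}`, whose stationary
points are `e` and `-e`; the latter is silent because `V̂` vanishes for `ξ ≤ 0`. Stationary phase
(`stationaryPhase`) yields `(2πi/|k|)^{(d-1)/2} V̂(|k|, e)`, and the normalisation of the
restriction operators undoes exactly this constant. The term `2z` disappears by the Riemann–Lebesgue
lemma on `S²`. The outcome is `tendsto_fourierSpace_shellProfile`, which gives the pointwise limit.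

For the weak limit, `e^{-ib(|k|)τ}` is absorbed into the datum, which is then only bounded,
measurable and of bounded support. Plancherel in `z` and in `x`, together with the cutoff `|x| <
2N`, bounds the reconstruction operators on `L²` uniformly in `N`
(`IsBoundedDatum.lintegral_profileHat_sq_le`). For test functions cut off near the origin the
spectral profile is smooth and its transform decays, so the pointwise limit holds for all `k ≠ 0`;
an `L²` bound and almost everywhere convergence imply weak convergence
(`tendsto_integral_mul_conj_zero`). Such functions are dense in `L²`, and the uniform bound carries
the limit over to the given datum. -/

namespace ShellReconstruction

/-! ### Plancherel and inversion for the angular-frequency Fourier transforms. -/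

open FourierTransform in
/-- On `L¹ ∩ L²` the Fourier integral agrees with the Fourier transform on `L²`. -/
theorem coeFn_fourier_toLp {E : Type*} [NormedAddCommGroup E] [InnerProductSpace ℝ E]
    [FiniteDimensional ℝ E] [MeasurableSpace E] [BorelSpace E] {f : E → ℂ}
    (h1 : Integrable f) (h2 : MemLp f 2) :
    (𝓕 (h2.toLp f) : Lp (α := E) ℂ 2) =ᵐ[volume] 𝓕 f := by
  have hcont : Continuous (𝓕 f) :=
    VectorFourier.fourierIntegral_continuous Real.continuous_fourierChar
      (by exact continuous_inner) h1
  -- Both sides are locally integrable, so testing against smooth compactly supported functions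
  -- suffices. There the `L²` transform is the distributional one, and the transform can be moved
  -- from the test function onto `f`.
  refine ae_eq_of_integral_contDiff_smul_eq ?_ hcont.locallyIntegrable ?_
  · exact (Lp.memLp (𝓕 (h2.toLp f))).locallyIntegrable (by norm_num)
  intro g hg hgs
  let φ : SchwartzMap E ℂ := HasCompactSupport.toSchwartzMap (f := fun x => (g x : ℂ))
    (hgs.comp_left (g := fun x : ℝ => (x : ℂ)) (by simp)) (Complex.ofRealCLM.contDiff.comp hg)
  have key := congrArg (fun T : TemperedDistribution E ℂ => T φ)
    (Lp.fourier_toTemperedDistribution_eq (h2.toLp f))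
  simp only [TemperedDistribution.fourier_apply, Lp.toTemperedDistribution_apply] at key
  have hφ : ∀ x, φ x = (g x : ℂ) := fun x => rfl
  have e1 : ∫ x, (𝓕 φ) x • (h2.toLp f) x = ∫ x, (𝓕 (φ : E → ℂ)) x • f x := by
    apply integral_congr_ae
    filter_upwards [h2.coeFn_toLp] with x hx
    rw [hx]; rfl
  have e2 : ∫ x, (𝓕 (φ : E → ℂ)) x • f x = ∫ x, φ x • 𝓕 f x := by
    simpa using! (VectorFourier.integral_fourierIntegral_smul_eq_flip (L := innerₗ E)
      Real.continuous_fourierChar continuous_inner φ.integrable h1)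
  rw [e1, e2] at key
  simp only [hφ] at key
  simpa using! key.symm

open FourierTransform in
/-- Plancherel's theorem for the Fourier integral on `L¹ ∩ L²`. -/
theorem eLpNorm_fourier_eq {E : Type*} [NormedAddCommGroup E] [InnerProductSpace ℝ E]
    [FiniteDimensional ℝ E] [MeasurableSpace E] [BorelSpace E] {f : E → ℂ}
    (h1 : Integrable f) (h2 : MemLp f 2) :
    eLpNorm (𝓕 f) 2 = eLpNorm f 2 := by
  rw [← eLpNorm_congr_ae (coeFn_fourier_toLp h1 h2), ← Lp.enorm_def, ← eLpNorm_congr_ae h2.coeFn_toLp,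
    ← Lp.enorm_def, ← ofReal_norm, ← ofReal_norm, Lp.norm_fourier_eq]

theorem eLpNorm_two_sq {α : Type*} [MeasurableSpace α] {μ : Measure α} (f : α → ℂ) :
    eLpNorm f 2 μ ^ 2 = ∫⁻ x, ‖f x‖ₑ ^ 2 ∂μ := by
  have := eLpNorm_nnreal_pow_eq_lintegral (μ := μ) (f := f) (p := 2) (by norm_num)
  simpa using this

open FourierTransform in
theorem lintegral_fourier_sq_eq {E : Type*} [NormedAddCommGroup E] [InnerProductSpace ℝ E]
    [FiniteDimensional ℝ E] [MeasurableSpace E] [BorelSpace E] {f : E → ℂ}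
    (h1 : Integrable f) (h2 : MemLp f 2) :
    ∫⁻ x, ‖𝓕 f x‖ₑ ^ 2 = ∫⁻ x, ‖f x‖ₑ ^ 2 := by
  rw [← eLpNorm_two_sq, ← eLpNorm_two_sq, eLpNorm_fourier_eq h1 h2]

open FourierTransform in
theorem fourierSpace_eq {d : ℕ} (u : Space d → ℂ) (k : Space d) :
    fourierSpace u k = 𝓕 u ((2 * Real.pi)⁻¹ • k) := by
  rw [fourierSpace, Real.fourier_eq']
  refine integral_congr_ae (Eventually.of_forall fun x => ?_)
  have hp : (Real.pi : ℝ) ≠ 0 := Real.pi_ne_zero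
  have : -2 * Real.pi * ⟪x, (2 * Real.pi)⁻¹ • k⟫ = -⟪k, x⟫ := by
    rw [real_inner_smul_right, real_inner_comm]; field_simp
  simp only [this, smul_eq_mul]
  rw [mul_comm]; congr 2; push_cast; ring

theorem lintegral_comp_smul_volume {E : Type*} [NormedAddCommGroup E] [InnerProductSpace ℝ E]
    [FiniteDimensional ℝ E] [MeasurableSpace E] [BorelSpace E] (f : E → ENNReal) {r : ℝ}
    (hr : r ≠ 0) :
    ∫⁻ x, f (r • x) = ENNReal.ofReal |(r ^ Module.finrank ℝ E)⁻¹| * ∫⁻ x, f x := by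
  rw [← (measurableEmbedding_const_smul₀ hr).lintegral_map f, Measure.map_addHaar_smul _ hr,
    lintegral_smul_measure, smul_eq_mul]

/-- The constant is the Jacobian of the rescaling `k ↦ k / (2π)` that leads to the unitary
normalisation. -/
theorem lintegral_fourierSpace_sq {d : ℕ} {u : Space d → ℂ}
    (h1 : Integrable u) (h2 : MemLp u 2) :
    ∫⁻ k, ‖fourierSpace u k‖ₑ ^ 2 = ENNReal.ofReal ((2 * Real.pi) ^ d) * ∫⁻ x, ‖u x‖ₑ ^ 2 := by
  simp_rw [fourierSpace_eq]
  have := lintegral_comp_smul_volume (fun k : Space d => ‖FourierTransform.fourier u k‖ₑ ^ 2)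
    (r := (2 * Real.pi)⁻¹) (by positivity)
  rw [this, lintegral_fourier_sq_eq h1 h2]
  congr 2
  simp [abs_of_pos Real.pi_pos]
  rw [← mul_inv_rev, inv_pow, inv_inv]

theorem continuous_fourierSpace {d : ℕ} {u : Space d → ℂ} (h1 : Integrable u) :
    Continuous (fourierSpace u) := by
  have : fourierSpace u = fun k => FourierTransform.fourier u ((2 * Real.pi)⁻¹ • k) :=
    funext (fourierSpace_eq u)
  rw [this]
  have hcont : Continuous (FourierTransform.fourier u) :=
    VectorFourier.fourierIntegral_continuous Real.continuous_fourierChar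
      (by exact continuous_inner) h1
  exact hcont.comp (continuous_const_smul _)

/-- The one-dimensional inverse Fourier transform with angular frequency. -/
def fourierInvLine (w : ℝ → ℂ) (z : ℝ) : ℂ :=
  (1 / (2 * Real.pi) : ℂ) * ∫ ξ : ℝ, Complex.exp (Complex.I * (z * ξ)) * w ξ

theorem fourierInvProfile_eq {d : ℕ} (v : ℝ → Sphere d → ℝ → ℂ) (z : ℝ) (q : Sphere d) (τ : ℝ) :
    fourierInvProfile v z q τ = fourierInvLine (fun ξ => v ξ q τ) z := rfl

open FourierTransform in
theorem fourierInvLine_eq (w : ℝ → ℂ) (z : ℝ) :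
    fourierInvLine w z = (1 / (2 * Real.pi) : ℂ) * 𝓕 w (-(2 * Real.pi)⁻¹ * z) := by
  rw [fourierInvLine, Real.fourier_real_eq_integral_exp_smul]
  congr 1
  refine integral_congr_ae (Eventually.of_forall fun x => ?_)
  have hp : (Real.pi : ℝ) ≠ 0 := Real.pi_ne_zero
  have : -2 * Real.pi * x * (-(2 * Real.pi)⁻¹ * z) = z * x := by field_simp
  simp only [this, smul_eq_mul]
  congr 2; push_cast; ring

theorem lintegral_fourierInvLine_sq {w : ℝ → ℂ} (h1 : Integrable w) (h2 : MemLp w 2) :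
    ∫⁻ z, ‖fourierInvLine w z‖ₑ ^ 2 = ENNReal.ofReal (1 / (2 * Real.pi)) * ∫⁻ ξ, ‖w ξ‖ₑ ^ 2 := by
  have hp := Real.pi_pos
  have e : ∀ z, ‖fourierInvLine w z‖ₑ ^ 2 = ENNReal.ofReal ((1 / (2 * Real.pi)) ^ 2) *
      ‖FourierTransform.fourier w ((-(2 * Real.pi)⁻¹) • z)‖ₑ ^ 2 := by
    intro z
    rw [fourierInvLine_eq, enorm_mul, mul_pow, smul_eq_mul, ENNReal.ofReal_pow (by positivity)]
    congr 2
    rw [← ofReal_norm]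
    congr 1
    simp [abs_of_pos hp]
  simp_rw [e]
  have := lintegral_comp_smul_volume (fun k : ℝ => ‖FourierTransform.fourier w k‖ₑ ^ 2)
    (r := -(2 * Real.pi)⁻¹) (by simp [hp.ne'])
  rw [lintegral_const_mul' _ _ ENNReal.ofReal_ne_top, this, lintegral_fourier_sq_eq h1 h2, ← mul_assoc,
    ← ENNReal.ofReal_mul (by positivity)]
  congr 2
  simp [abs_of_pos hp]
  field_simp

/-- Fourier inversion on the line with angular frequency. -/
theorem integral_fourierInvLine_mul_exp {w : ℝ → ℂ} (hc : Continuous w) (h1 : Integrable w)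
    (h2 : Integrable (fourierInvLine w)) (ξ : ℝ) :
    ∫ z : ℝ, fourierInvLine w z * Complex.exp (-Complex.I * (z * ξ)) = w ξ := by
  have hp := Real.pi_pos
  -- Inversion requires an integrable transform; `fourierInvLine w` is the same function up to a
  -- reflection, a dilation and a constant.
  have hF : Integrable (FourierTransform.fourier w) := by
    have h3 := (h2.const_mul (2 * Real.pi : ℂ)).comp_mul_left' (R := -(2 * Real.pi))
      (by simp [hp.ne'])
    refine h3.congr (Eventually.of_forall fun z => ?_)
    simp only [fourierInvLine_eq]
    have : -(2 * Real.pi)⁻¹ * (-(2 * Real.pi) * z) = z := by field_simp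
    rw [this]
    have : (Real.pi : ℂ) ≠ 0 := by exact_mod_cast hp.ne'
    field_simp
  have h := congrFun (hc.fourierInv_fourier_eq h1 hF) ξ
  rw [Real.fourierInv_eq'] at h
  rw [← h]
  have := Measure.integral_comp_mul_left
    (fun v : ℝ => Complex.exp ((↑(2 * Real.pi * ⟪v, ξ⟫) * Complex.I)) • FourierTransform.fourier w v)
    (-(2 * Real.pi)⁻¹)
  have e : ∀ z : ℝ, fourierInvLine w z * Complex.exp (-Complex.I * (z * ξ)) =
     (1 / (2 * Real.pi) : ℂ) * (Complex.exp ((↑(2 * Real.pi * ⟪-(2 * Real.pi)⁻¹ * z, ξ⟫) * Complex.I)) •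
      FourierTransform.fourier w (-(2 * Real.pi)⁻¹ * z)) := by
    intro z
    rw [fourierInvLine_eq, smul_eq_mul]
    have : 2 * Real.pi * ⟪-(2 * Real.pi)⁻¹ * z, ξ⟫ = - (z * ξ) := by
      simp only [RCLike.inner_apply, conj_trivial]; field_simp
    rw [this, mul_assoc]
    congr 1
    rw [mul_comm]
    congr 2; push_cast; ring
  simp_rw [e]
  rw [integral_const_mul, this]
  generalize ∫ v : ℝ, Complex.exp ((↑(2 * Real.pi * ⟪v, ξ⟫) * Complex.I)) •
    FourierTransform.fourier w v = J
  simp only [inv_neg, inv_inv, abs_neg, abs_mul, abs_of_pos hp, abs_two, Complex.real_smul]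
  have : (Real.pi : ℂ) ≠ 0 := by exact_mod_cast hp.ne'
  push_cast
  field_simp

/-! ### Polar coordinates and explicit surface integrals on `S⁰`, `S¹` and `S²`. -/

/-- Surface measure on the unit sphere. -/
abbrev surface (d : ℕ) : Measure (Sphere d) := (volume : Measure (Space d)).toSphere

theorem lintegral_volumeIoiPow (n : ℕ) (f : ℝ → ENNReal) :
    ∫⁻ r : Set.Ioi (0 : ℝ), f r ∂(Measure.volumeIoiPow n) =
      ∫⁻ r in Set.Ioi (0 : ℝ), ENNReal.ofReal (r ^ n) * f r := by
  rw [Measure.volumeIoiPow, lintegral_withDensity_eq_lintegral_mul_non_measurable]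
  · exact lintegral_subtype_comap measurableSet_Ioi (fun r : ℝ => ENNReal.ofReal (r ^ n) * f r)
  · exact ((measurable_subtype_coe.pow_const _)).ennreal_ofReal
  · exact Eventually.of_forall fun _ => ENNReal.ofReal_lt_top

theorem integral_volumeIoiPow (n : ℕ) (f : ℝ → ℂ) :
    ∫ r : Set.Ioi (0 : ℝ), f r ∂(Measure.volumeIoiPow n) =
      ∫ r in Set.Ioi (0 : ℝ), ((r ^ n : ℝ) : ℂ) * f r := by
  simp only [Measure.volumeIoiPow, ENNReal.ofReal]
  rw [integral_withDensity_eq_integral_smul,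
    integral_subtype_comap measurableSet_Ioi fun a ↦ Real.toNNReal (a ^ n) • f a,
    setIntegral_congr_fun measurableSet_Ioi fun x hx ↦ ?_]
  · simp only [NNReal.smul_def]
    rw [Real.coe_toNNReal _ (pow_nonneg hx.out.le _), Complex.real_smul]
  · exact (measurable_subtype_coe.pow_const _).real_toNNReal

/-- Polar coordinates for lower integrals. -/
theorem lintegral_polar {d : ℕ} [NeZero d] {F : Space d → ENNReal} (hF : Measurable F) :
    ∫⁻ x, F x = ∫⁻ q : Sphere d, (∫⁻ r in Set.Ioi (0 : ℝ),
      ENNReal.ofReal (r ^ (d - 1)) * F (r • (q : Space d))) ∂(surface d) := by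
  have h1 : ∫⁻ x, F x = ∫⁻ x : ({(0)}ᶜ : Set (Space d)), F x
      ∂((volume : Measure (Space d)).comap Subtype.val) := by
    rw [lintegral_subtype_comap (measurableSet_singleton _).compl, restrict_compl_singleton]
  have h2 := (volume : Measure (Space d)).measurePreserving_homeomorphUnitSphereProd.symm
    (homeomorphUnitSphereProd (Space d)).toMeasurableEquiv
  rw [h1, ← h2.lintegral_comp (by fun_prop), lintegral_prod _ (by fun_prop)]
  refine lintegral_congr fun q => ?_
  rw [finrank_euclideanSpace_fin, ← lintegral_volumeIoiPow (d - 1) fun r => F (r • (q : Space d))]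
  rfl

/-- Polar coordinates for Bochner integrals. -/
theorem integral_polar {d : ℕ} [NeZero d] {F : Space d → ℂ} (hF : Integrable F) :
    ∫ x, F x = ∫ q : Sphere d, (∫ r in Set.Ioi (0 : ℝ),
      ((r ^ (d - 1) : ℝ) : ℂ) * F (r • (q : Space d))) ∂(surface d) := by
  have h1 : ∫ x, F x = ∫ x : ({(0)}ᶜ : Set (Space d)), F x
      ∂((volume : Measure (Space d)).comap Subtype.val) := by
    rw [integral_subtype_comap (measurableSet_singleton _).compl, restrict_compl_singleton]
  have h2 := (volume : Measure (Space d)).measurePreserving_homeomorphUnitSphereProd.symm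
    (homeomorphUnitSphereProd (Space d)).toMeasurableEquiv
  have h3 : Integrable (fun x : ({(0)}ᶜ : Set (Space d)) => F x)
      ((volume : Measure (Space d)).comap Subtype.val) := by
    have := (integrableOn_iff_comap_subtypeVal (f := F) (μ := volume)
      (measurableSet_singleton (0 : Space d)).compl).1 hF.integrableOn
    exact this
  have h4 := (h2.integrable_comp_emb (MeasurableEquiv.measurableEmbedding _)).2 h3
  rw [h1, ← h2.integral_comp (MeasurableEquiv.measurableEmbedding _)]
  refine (integral_prod _ h4).trans ?_
  refine integral_congr_ae (Eventually.of_forall fun q => ?_)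
  simp only []
  rw [finrank_euclideanSpace_fin, ← integral_volumeIoiPow (d - 1) fun r => F (r • (q : Space d))]
  rfl

theorem direction_smul {d : ℕ} {r : ℝ} (hr : 0 < r) (q : Sphere d) (h : r • (q : Space d) ≠ 0) :
    direction (r • (q : Space d)) h = q := by
  apply Subtype.ext
  simp only [direction, norm_smul, norm_eq_of_mem_sphere, mul_one, Real.norm_eq_abs, abs_of_pos hr,
    smul_smul]
  rw [inv_mul_cancel₀ hr.ne', one_smul]

open Classical in
/-- The degree-zero homogeneous extension of a function on the sphere, set to `0` at the origin. -/
def radialExtension {d : ℕ} {β : Type*} [Zero β] (f : Sphere d → β) (x : Space d) : β :=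
  if hx : x ≠ 0 then f (direction x hx) else 0

theorem smul_sphere_ne_zero {d : ℕ} {r : ℝ} (hr : 0 < r) (q : Sphere d) : r • (q : Space d) ≠ 0 := by
  have : ‖(q : Space d)‖ = 1 := norm_eq_of_mem_sphere q
  exact smul_ne_zero hr.ne' (fun h => by simp [h] at this)

theorem radialExtension_smul {d : ℕ} {β : Type*} [Zero β] (f : Sphere d → β) {r : ℝ} (hr : 0 < r)
    (q : Sphere d) : radialExtension f (r • (q : Space d)) = f q := by
  have hne := smul_sphere_ne_zero hr q
  rw [radialExtension, dif_pos hne, direction_smul hr]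

/-- The parameter is carried along because a shell evaluates its profile at `|x| - N` and `x/|x|`
simultaneously. -/
theorem measurable_radialExtension_prod {d : ℕ} {β : Type*} [MeasurableSpace β] {f : β → Sphere d → ℂ}
    (hf : Measurable (Function.uncurry f)) :
    Measurable (fun p : β × Space d => radialExtension (f p.1) p.2) := by
  classical
  have hs : MeasurableSet {p : β × Space d | p.2 ≠ 0} :=
    measurable_snd (measurableSet_singleton (0 : Space d)).compl
  refine Measurable.dite (s := {p : β × Space d | p.2 ≠ 0})
    (f := fun p => f p.1.1 (direction p.1.2 p.2)) (g := fun _ => 0) ?_ measurable_const hs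
  refine hf.comp (Measurable.prodMk (measurable_fst.comp measurable_subtype_coe) ?_)
  refine Measurable.subtype_mk ?_
  exact ((measurable_snd.comp measurable_subtype_coe).norm.inv).smul
    (measurable_snd.comp measurable_subtype_coe)

theorem measurable_radialExtension {d : ℕ} {f : Sphere d → ℂ} (hf : Measurable f) :
    Measurable (radialExtension f) :=
  (measurable_radialExtension_prod (β := Unit) (f := fun _ => f) (hf.comp measurable_snd)).comp
    (measurable_const (a := ()) |>.prodMk measurable_id)

theorem norm_radialExtension_le {d : ℕ} {f : Sphere d → ℂ} {C : ℝ} (hC : 0 ≤ C)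
    (hf : ∀ q, ‖f q‖ ≤ C) (x : Space d) : ‖radialExtension f x‖ ≤ C := by
  unfold radialExtension
  split_ifs
  · exact hf _
  · simpa using hC

/-- The surface integral as a volume integral over the unit ball. -/
theorem integral_surface_eq {d : ℕ} [NeZero d] {f : Sphere d → ℂ} (hf : Continuous f) :
    ∫ x in Metric.ball (0 : Space d) 1, radialExtension f x = (d : ℂ)⁻¹ * ∫ q, f q ∂(surface d) := by
  have hd := NeZero.ne d
  obtain ⟨C, hC⟩ := (isCompact_univ.bddAbove_image (f := fun q => ‖f q‖) (by fun_prop) :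
    BddAbove ((fun q => ‖f q‖) '' Set.univ))
  have hC' : ∀ q, ‖f q‖ ≤ max C 0 := fun q =>
    le_max_of_le_left (hC (Set.mem_image_of_mem _ (Set.mem_univ q)))
  have hint : IntegrableOn (radialExtension f) (Metric.ball (0 : Space d) 1) :=
    Measure.integrableOn_of_bounded (μ := volume) (M := max C 0) measure_ball_lt_top.ne
      (measurable_radialExtension hf.measurable).aestronglyMeasurable
      (Eventually.of_forall fun x => norm_radialExtension_le (le_max_right _ _) hC' x)
  rw [← integral_indicator measurableSet_ball,
    integral_polar (hint.integrable_indicator measurableSet_ball), ← integral_const_mul]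
  refine integral_congr_ae (Eventually.of_forall fun q => ?_)
  have e : ∀ r ∈ Set.Ioi (0 : ℝ), ((r ^ (d - 1) : ℝ) : ℂ) *
      (Metric.ball (0 : Space d) 1).indicator (radialExtension f) (r • (q : Space d)) =
      (Set.Ioo (0 : ℝ) 1).indicator (fun r => ((r ^ (d - 1) : ℝ) : ℂ) * f q) r := by
    intro r hr
    have hr' : 0 < r := hr
    by_cases h : r < 1
    · rw [Set.indicator_of_mem (by simp [norm_smul, abs_of_pos hr', h]),
        Set.indicator_of_mem (by simp [hr', h]), radialExtension_smul f hr']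
    · rw [Set.indicator_of_notMem (by simpa [norm_smul, abs_of_pos hr'] using h),
        Set.indicator_of_notMem (by simp [h]), mul_zero]
  simp only []
  rw [setIntegral_congr_fun measurableSet_Ioi e, setIntegral_indicator measurableSet_Ioo,
    Set.inter_eq_right.2 Set.Ioo_subset_Ioi_self, integral_mul_const,
    ← integral_Ioc_eq_integral_Ioo, ← intervalIntegral.integral_of_le zero_le_one]
  -- The remaining radial factor is `∫₀¹ r^{d-1} dr = 1/d`.
  congr 1
  rw [intervalIntegral.integral_ofReal, integral_pow]
  have : (d : ℂ) ≠ 0 := by exact_mod_cast hd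
  obtain ⟨n, rfl⟩ := Nat.exists_eq_succ_of_ne_zero hd
  simp

/-- An orthonormal basis whose first vector is a prescribed unit vector. -/
theorem exists_orthonormalBasis_zero {d : ℕ} [NeZero d] (e : Sphere d) :
    ∃ b : OrthonormalBasis (Fin d) ℝ (Space d), b 0 = e := by
  have h : Orthonormal ℝ (({0} : Set (Fin d)).domRestrict fun _ => (e : Space d)) := by
    constructor
    · intro i; exact norm_eq_of_mem_sphere e
    · intro i j hij; exact absurd (Subsingleton.elim i j) hij
  obtain ⟨b, hb⟩ := h.exists_orthonormalBasis_extension_of_card_eq (by simp)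
  exact ⟨b, hb 0 rfl⟩

/-- The integrand used to express surface integrals as volume integrals. -/
def ballExtension {d : ℕ} (f : Sphere d → ℂ) : Space d → ℂ :=
  (Metric.ball (0 : Space d) 1).indicator (radialExtension f)

theorem ballExtension_smul {d : ℕ} (f : Sphere d → ℂ) {r : ℝ} (hr : 0 < r) (q : Sphere d) :
    ballExtension f (r • (q : Space d)) = (Set.Ioo (0 : ℝ) 1).indicator 1 r * f q := by
  unfold ballExtension
  by_cases h : r < 1
  · rw [Set.indicator_of_mem (by simp [norm_smul, abs_of_pos hr, h]),
      Set.indicator_of_mem (by simp [hr, h]), radialExtension_smul f hr, Pi.one_apply, one_mul]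
  · rw [Set.indicator_of_notMem (by simpa [norm_smul, abs_of_pos hr] using h),
      Set.indicator_of_notMem (by simp [h]), zero_mul]

theorem integral_ballExtension {d : ℕ} [NeZero d] {f : Sphere d → ℂ} (hf : Continuous f) :
    ∫ x, ballExtension f x = (d : ℂ)⁻¹ * ∫ q, f q ∂(surface d) := by
  rw [← integral_surface_eq hf, ← integral_indicator measurableSet_ball]
  rfl

theorem measurable_ballExtension {d : ℕ} {f : Sphere d → ℂ} (hf : Continuous f) :
    Measurable (ballExtension f) :=
  (measurable_radialExtension hf.measurable).indicator measurableSet_ball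

theorem exists_norm_le_of_continuous {d : ℕ} {f : Sphere d → ℂ} (hf : Continuous f) :
    ∃ C, 0 ≤ C ∧ ∀ q, ‖f q‖ ≤ C := by
  obtain ⟨C, hC⟩ := (isCompact_univ.bddAbove_image (f := fun q => ‖f q‖) (by fun_prop) :
    BddAbove ((fun q => ‖f q‖) '' Set.univ))
  exact ⟨max C 0, le_max_right _ _, fun q =>
    le_max_of_le_left (hC (Set.mem_image_of_mem _ (Set.mem_univ q)))⟩

theorem integrable_ballExtension {d : ℕ} {f : Sphere d → ℂ} (hf : Continuous f) :
    Integrable (ballExtension f) := by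
  obtain ⟨C, hC0, hC⟩ := exists_norm_le_of_continuous hf
  have hint : IntegrableOn (radialExtension f) (Metric.ball (0 : Space d) 1) :=
    Measure.integrableOn_of_bounded (μ := volume) (M := C) measure_ball_lt_top.ne
      (measurable_radialExtension hf.measurable).aestronglyMeasurable
      (Eventually.of_forall fun x => norm_radialExtension_le hC0 hC x)
  exact hint.integrable_indicator measurableSet_ball

/-- The surface integral over the two-point sphere `S⁰`. -/
theorem integral_surface_one {f : Sphere 1 → ℂ} (hf : Continuous f) (e : Sphere 1) :
    ∫ q, f q ∂(surface 1) = f e + f (-e) := by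
  obtain ⟨b, hb⟩ := exists_orthonormalBasis_zero e
  -- The line through `e` is all of `Space 1`; its two half-lines carry `f e` and `f (-e)`, each
  -- with radial mass one.
  have hmp : MeasurePreserving (fun t : ℝ => t • (e : Space 1)) := by
    have := b.measurePreserving_repr_symm.comp ((PiLp.volume_preserving_toLp (Fin 1)).comp
      (volume_preserving_funUnique (Fin 1) ℝ).symm)
    have hfun : (fun t : ℝ => t • (e : Space 1)) = b.repr.symm ∘ (WithLp.toLp 2 ∘
        (MeasurableEquiv.funUnique (Fin 1) ℝ).symm) := by
      ext1 t
      rw [Function.comp_apply, Function.comp_apply, ← b.sum_repr_symm, ← hb]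
      simp
    rw [hfun]
    exact this
  have hemb : MeasurableEmbedding (fun t : ℝ => t • (e : Space 1)) := by
    refine Continuous.measurableEmbedding (by fun_prop) fun s t hst => ?_
    have h1 : ‖(e : Space 1)‖ = 1 := norm_eq_of_mem_sphere e
    exact smul_left_injective ℝ (fun h => by simp [h] at h1 : (e : Space 1) ≠ 0) hst
  have h := integral_ballExtension hf
  rw [Nat.cast_one, inv_one, one_mul] at h
  have hi : Integrable (fun t : ℝ => ballExtension f (t • (e : Space 1))) :=
    (hmp.integrable_comp_emb hemb).2 (integrable_ballExtension hf)
  have one : ∀ (c : ℂ), ∫ x : ℝ in Set.Ioi 0, (Set.Ioo (0 : ℝ) 1).indicator 1 x * c = c := by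
    intro c
    rw [integral_mul_const]
    have : ∫ x : ℝ in Set.Ioi 0, (Set.Ioo (0 : ℝ) 1).indicator (1 : ℝ → ℂ) x = 1 := by
      rw [setIntegral_indicator measurableSet_Ioo, Set.inter_eq_right.2 Set.Ioo_subset_Ioi_self]
      simp
    rw [this, one_mul]
  rw [← h, ← hmp.integral_comp hemb, ← integral_add_compl measurableSet_Ioi hi (s := Set.Ioi 0),
    Set.compl_Ioi]
  congr 1
  · rw [setIntegral_congr_fun measurableSet_Ioi
      (fun r (hr : 0 < r) => ballExtension_smul f hr e), one]
  · have := integral_comp_neg_Ioi (0 : ℝ) (fun t : ℝ => ballExtension f (t • (e : Space 1)))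
    rw [neg_zero] at this
    rw [← this, setIntegral_congr_fun (g := fun r => (Set.Ioo (0 : ℝ) 1).indicator 1 r * f (-e))
      measurableSet_Ioi, one]
    intro r hr
    simp only []
    rw [← ballExtension_smul f hr, neg_smul]
    simp

/-- The point of the unit circle at angle `θ` in an orthonormal frame. -/
def circlePoint (b : OrthonormalBasis (Fin 2) ℝ (Space 2)) (θ : ℝ) : Sphere 2 :=
  ⟨Real.cos θ • b 0 + Real.sin θ • b 1, by
    have : ‖Real.cos θ • b 0 + Real.sin θ • b 1‖ ^ 2 = 1 := by
      rw [norm_add_sq_real]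
      simp [norm_smul, inner_smul_left, inner_smul_right,
        b.inner_eq_zero (show (0 : Fin 2) ≠ 1 by decide)]
    rw [mem_sphere_zero_iff_norm]
    exact (pow_eq_one_iff_of_nonneg (norm_nonneg _) two_ne_zero).1 this⟩

/-- The integral over the unit disc is read in plane polar coordinates; the radial integral `1/2`
cancels the factor `1/d`. -/
theorem integral_surface_two {f : Sphere 2 → ℂ} (hf : Continuous f)
    (b : OrthonormalBasis (Fin 2) ℝ (Space 2)) :
    ∫ q, f q ∂(surface 2) = ∫ θ in (-Real.pi)..Real.pi, f (circlePoint b θ) := by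
  set e : ℝ × ℝ ≃ᵐ Space 2 := (MeasurableEquiv.finTwoArrow.symm.trans
    (MeasurableEquiv.toLp 2 (Fin 2 → ℝ))).trans b.measurableEquiv.symm
  have he : ∀ p : ℝ × ℝ, e p = p.1 • b 0 + p.2 • b 1 := by
    intro p
    have : e p = b.repr.symm (WithLp.toLp 2 (MeasurableEquiv.finTwoArrow.symm p)) := rfl
    rw [this, ← b.sum_repr_symm]
    simp
  have hmp : MeasurePreserving e :=
    b.measurePreserving_repr_symm.comp ((PiLp.volume_preserving_toLp (Fin 2)).comp
      (volume_preserving_finTwoArrow ℝ).symm)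
  have h := integral_ballExtension hf
  rw [← hmp.integral_comp e.measurableEmbedding, ← integral_comp_polarCoord_symm, polarCoord_target,
    setIntegral_congr_fun (g := fun p => ((Set.Ioo (0 : ℝ) 1).indicator 1 p.1 * (p.1 : ℂ)) *
      f (circlePoint b p.2)) (measurableSet_Ioi.prod measurableSet_Ioo)] at h
  · rw [Measure.volume_eq_prod, setIntegral_prod_mul (fun x : ℝ => (Set.Ioo (0 : ℝ) 1).indicator 1 x * (x : ℂ))
      (fun θ => f (circlePoint b θ))] at h
    have h2 : ∫ x : ℝ in Set.Ioi 0, (Set.Ioo (0 : ℝ) 1).indicator (1 : ℝ → ℂ) x * (x : ℂ) = 1 / 2 := by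
      have : ∀ x : ℝ, (Set.Ioo (0 : ℝ) 1).indicator (1 : ℝ → ℂ) x * (x : ℂ) =
          (Set.Ioo (0 : ℝ) 1).indicator (fun x : ℝ => (x : ℂ)) x := by
        intro x; by_cases hx : x ∈ Set.Ioo (0 : ℝ) 1 <;> simp [hx]
      simp_rw [this]
      rw [setIntegral_indicator measurableSet_Ioo, Set.inter_eq_right.2 Set.Ioo_subset_Ioi_self,
        ← integral_Ioc_eq_integral_Ioo, ← intervalIntegral.integral_of_le zero_le_one,
        intervalIntegral.integral_ofReal, integral_id]
      norm_num
    rw [h2] at h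
    rw [intervalIntegral.integral_of_le (by linarith [Real.pi_pos]), integral_Ioc_eq_integral_Ioo]
    push_cast at h
    linear_combination -2 * h
  · rintro ⟨r, θ⟩ ⟨hr, -⟩
    have hr' : 0 < r := hr
    have : e (polarCoord.symm (r, θ)) = r • (circlePoint b θ : Space 2) := by
      rw [he]; simp [circlePoint, smul_smul]
    simp only [this, ballExtension_smul f hr', Complex.real_smul]
    ring

/-- The point of the unit sphere with polar angle `θ` and azimuth `φ` in an orthonormal frame. -/
def spherePoint (b : OrthonormalBasis (Fin 3) ℝ (Space 3)) (θ φ : ℝ) : Sphere 3 :=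
  ⟨Real.cos θ • b 0 + Real.sin θ • (Real.cos φ • b 1 + Real.sin φ • b 2), by
    have h2 : ‖Real.cos φ • b 1 + Real.sin φ • b 2‖ ^ 2 = 1 := by
      rw [norm_add_sq_real]
      simp [norm_smul, inner_smul_left, inner_smul_right,
        b.inner_eq_zero (show (1 : Fin 3) ≠ 2 by decide)]
    have h3 : ‖Real.cos θ • b 0 + Real.sin θ • (Real.cos φ • b 1 + Real.sin φ • b 2)‖ ^ 2 = 1 := by
      rw [norm_add_sq_real, norm_smul (Real.sin θ), mul_pow, h2]
      simp [norm_smul, inner_smul_left, inner_smul_right, inner_add_right,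
        b.inner_eq_zero (show (0 : Fin 3) ≠ 2 by decide),
        b.inner_eq_zero (show (0 : Fin 3) ≠ 1 by decide)]
    rw [mem_sphere_zero_iff_norm]
    exact (pow_eq_one_iff_of_nonneg (norm_nonneg _) two_ne_zero).1 h3⟩

theorem continuous_spherePoint (b : OrthonormalBasis (Fin 3) ℝ (Space 3)) :
    Continuous (fun p : ℝ × ℝ => spherePoint b p.1 p.2) := by
  unfold spherePoint
  fun_prop

/-- Spherical coordinates arise from plane polar coordinates used twice: first for the two
coordinates orthogonal to `b 0`, then for the height and the distance from the axis. The Jacobians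
multiply to `r² sin θ`, and `∫₀¹ r² dr = 1/3` cancels `1/d`. -/
theorem integral_surface_three {f : Sphere 3 → ℂ} (hf : Continuous f)
    (b : OrthonormalBasis (Fin 3) ℝ (Space 3)) :
    ∫ q, f q ∂(surface 3) = ∫ φ in (-Real.pi)..Real.pi, ∫ θ in (0)..Real.pi,
      (Real.sin θ : ℂ) * f (spherePoint b θ φ) := by
  obtain ⟨C, hC0, hC⟩ := exists_norm_le_of_continuous hf
  set e : ℝ × (ℝ × ℝ) ≃ᵐ Space 3 := (((MeasurableEquiv.refl ℝ).prodCongr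
    MeasurableEquiv.finTwoArrow.symm).trans ((MeasurableEquiv.piFinSuccAbove (fun _ => ℝ) 0).symm.trans
    (MeasurableEquiv.toLp 2 (Fin 3 → ℝ)))).trans b.measurableEquiv.symm
  have he : ∀ p : ℝ × (ℝ × ℝ), e p = p.1 • b 0 + (p.2.1 • b 1 + p.2.2 • b 2) := by
    intro p
    have : e p = b.repr.symm (WithLp.toLp 2 ((MeasurableEquiv.piFinSuccAbove (fun _ => ℝ) 0).symm
      (p.1, MeasurableEquiv.finTwoArrow.symm p.2))) := rfl
    rw [this, ← b.sum_repr_symm, Fin.sum_univ_three, ← add_assoc]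
    rfl
  have hmp : MeasurePreserving e :=
    b.measurePreserving_repr_symm.comp ((PiLp.volume_preserving_toLp (Fin 3)).comp
      ((volume_preserving_piFinSuccAbove (fun _ : Fin 3 => ℝ) 0).symm.comp
        ((MeasurePreserving.id volume).prod (volume_preserving_finTwoArrow ℝ).symm)))
  set G : ℝ × (ℝ × ℝ) → ℂ := fun p => ballExtension f (e p)
  have hGm : Measurable G := (measurable_ballExtension hf).comp e.measurable
  have hG : Integrable G := (hmp.integrable_comp_emb e.measurableEmbedding).2 (integrable_ballExtension hf)
  -- The integrand after the first polar change, with the distance from the axis as Jacobian,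
  -- extended by zero so that later integrals run over full spaces.
  set H : ℝ × (ℝ × ℝ) → ℂ := (Set.univ ×ˢ polarCoord.target).indicator
    fun p => (p.2.1 : ℂ) * G (p.1, polarCoord.symm p.2)
  have hs : MeasurableSet ((Set.univ : Set ℝ) ×ˢ polarCoord.target) :=
    MeasurableSet.univ.prod polarCoord.open_target.measurableSet
  have hHm : Measurable H := by
    refine Measurable.indicator ?_ hs
    have : Measurable (polarCoord.symm : ℝ × ℝ → ℝ × ℝ) := continuous_polarCoord_symm.measurable
    fun_prop
  have heq : ∀ (r θ φ : ℝ), e (r * Real.cos θ, polarCoord.symm (r * Real.sin θ, φ)) =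
      r • (spherePoint b θ φ : Space 3) := by
    intro r θ φ
    rw [he]
    simp [spherePoint, smul_smul, mul_assoc]
  have hnorm : ∀ p : ℝ × (ℝ × ℝ), ‖e p‖ ^ 2 = p.1 ^ 2 + (p.2.1 ^ 2 + p.2.2 ^ 2) := by
    intro p
    have : e p = b.repr.symm (WithLp.toLp 2 ((MeasurableEquiv.piFinSuccAbove (fun _ => ℝ) 0).symm
      (p.1, MeasurableEquiv.finTwoArrow.symm p.2))) := rfl
    rw [this, LinearIsometryEquiv.norm_map, EuclideanSpace.norm_sq_eq, Fin.sum_univ_three, ← add_assoc]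
    simp only [Real.norm_eq_abs, sq_abs]
    rfl
  have hGb : ∀ p, ‖G p‖ ≤ C := by
    intro p
    refine (norm_indicator_le_norm_self _ _).trans (norm_radialExtension_le hC0 hC _)
  -- Integrability licenses the Fubini step that makes `φ` the outermost variable; `H` is bounded
  -- and lives in a compact box.
  have hHint : Integrable H := by
    have hsupp : ∀ p, p ∉ Set.Icc (-1 : ℝ) 1 ×ˢ (Set.Icc (0 : ℝ) 1 ×ˢ Set.Icc (-Real.pi) Real.pi) →
        H p = 0 := by
      rintro ⟨a, s, φ⟩ hp
      by_contra hne
      have h1 : (a, s, φ) ∈ (Set.univ : Set ℝ) ×ˢ polarCoord.target := Set.mem_of_indicator_ne_zero hne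
      have h2 := h1.2
      simp only [polarCoord_target, Set.mem_prod, Set.mem_Ioi, Set.mem_Ioo] at h2
      simp only [H, Set.indicator_of_mem h1, G] at hne
      have h3 := Set.mem_of_indicator_ne_zero (right_ne_zero_of_mul hne)
      rw [mem_ball_zero_iff] at h3
      have h4 := hnorm (a, polarCoord.symm (s, φ))
      have h5 : ‖e (a, polarCoord.symm (s, φ))‖ ^ 2 ≤ 1 := by
        nlinarith [norm_nonneg (e (a, polarCoord.symm (s, φ)))]
      have h6 : (s * Real.cos φ) ^ 2 + (s * Real.sin φ) ^ 2 = s ^ 2 := by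
        nlinarith [Real.sin_sq_add_cos_sq φ]
      simp only [polarCoord_symm_apply] at h4 h5
      rw [h4, h6] at h5
      refine hp ⟨⟨?_, ?_⟩, ⟨h2.1.le, ?_⟩, h2.2.1.le, h2.2.2.le⟩ <;> simp only <;> nlinarith [sq_nonneg a, sq_nonneg s]
    have hK : IsCompact (Set.Icc (-1 : ℝ) 1 ×ˢ (Set.Icc (0 : ℝ) 1 ×ˢ Set.Icc (-Real.pi) Real.pi)) :=
      isCompact_Icc.prod (isCompact_Icc.prod isCompact_Icc)
    refine (integrableOn_iff_integrable_of_support_subset (s := Set.Icc (-1 : ℝ) 1 ×ˢ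
      (Set.Icc (0 : ℝ) 1 ×ˢ Set.Icc (-Real.pi) Real.pi)) ?_).1 ?_
    · intro p hp; by_contra hn; exact hp (hsupp p hn)
    refine Measure.integrableOn_of_bounded (M := C) hK.measure_lt_top.ne hHm.aestronglyMeasurable ?_
    filter_upwards [ae_restrict_mem hK.measurableSet] with p hp
    refine (norm_indicator_le_norm_self _ _).trans ?_
    rw [norm_mul, Complex.norm_real, Real.norm_eq_abs, abs_of_nonneg hp.2.1.1]
    calc p.2.1 * ‖G (p.1, polarCoord.symm p.2)‖ ≤ 1 * C :=
          mul_le_mul hp.2.1.2 (hGb _) (norm_nonneg _) zero_le_one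
      _ = C := one_mul C
  have h := integral_ballExtension hf
  have h1 : ∫ x, ballExtension f x = ∫ p, H p := by
    rw [← hmp.integral_comp e.measurableEmbedding, Measure.volume_eq_prod, integral_prod _ hG,
      integral_prod _ hHint]
    refine integral_congr_ae (Eventually.of_forall fun a => ?_)
    simp only []
    rw [← integral_comp_polarCoord_symm, ← integral_indicator polarCoord.open_target.measurableSet]
    refine integral_congr_ae (Eventually.of_forall fun p => ?_)
    by_cases hp : p ∈ polarCoord.target
    · have : (a, p) ∈ (Set.univ : Set ℝ) ×ˢ polarCoord.target := ⟨trivial, hp⟩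
      simp only [H]
      rw [Set.indicator_of_mem hp, Set.indicator_of_mem this, Complex.real_smul]
    · have : (a, p) ∉ (Set.univ : Set ℝ) ×ˢ polarCoord.target := fun h => hp h.2
      simp only [H]
      rw [Set.indicator_of_notMem hp, Set.indicator_of_notMem this]
  have hassoc := volume_preserving_prodAssoc (α₁ := ℝ) (β₁ := ℝ) (γ₁ := ℝ)
  have hH2 := (hassoc.integrable_comp_emb (MeasurableEquiv.measurableEmbedding _)).2 hHint
  have h2 : ∫ p, H p = ∫ φ : ℝ, ∫ p : ℝ × ℝ, H (p.1, p.2, φ) := by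
    rw [← hassoc.integral_comp (MeasurableEquiv.measurableEmbedding _)]
    exact integral_prod_symm _ hH2
  have h3 : ∀ φ : ℝ, ∫ p : ℝ × ℝ, H (p.1, p.2, φ) = (Set.Ioo (-Real.pi) Real.pi).indicator
      (fun φ => (1 / 3 : ℂ) * ∫ θ in (0)..Real.pi, (Real.sin θ : ℂ) * f (spherePoint b θ φ)) φ := by
    intro φ
    by_cases hφ : φ ∈ Set.Ioo (-Real.pi) Real.pi
    · rw [Set.indicator_of_mem hφ, ← integral_comp_polarCoord_symm, polarCoord_target,
        setIntegral_congr_fun (g := fun p => ((Set.Ioo (0 : ℝ) 1).indicator 1 p.1 * (p.1 : ℂ) ^ 2) *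
          (Set.Ioo 0 Real.pi).indicator (fun θ => (Real.sin θ : ℂ) * f (spherePoint b θ φ)) p.2)
          (measurableSet_Ioi.prod measurableSet_Ioo)]
      · rw [Measure.volume_eq_prod, setIntegral_prod_mul
          (fun x : ℝ => (Set.Ioo (0 : ℝ) 1).indicator 1 x * (x : ℂ) ^ 2)
          ((Set.Ioo 0 Real.pi).indicator (fun θ => (Real.sin θ : ℂ) * f (spherePoint b θ φ)))]
        have h2 : ∫ x : ℝ in Set.Ioi 0, (Set.Ioo (0 : ℝ) 1).indicator (1 : ℝ → ℂ) x * (x : ℂ) ^ 2 = 1 / 3 := by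
          have : ∀ x : ℝ, (Set.Ioo (0 : ℝ) 1).indicator (1 : ℝ → ℂ) x * (x : ℂ) ^ 2 =
              (Set.Ioo (0 : ℝ) 1).indicator (fun x : ℝ => ((x ^ 2 : ℝ) : ℂ)) x := by
            intro x; by_cases hx : x ∈ Set.Ioo (0 : ℝ) 1 <;> simp [hx]
          simp_rw [this]
          rw [setIntegral_indicator measurableSet_Ioo, Set.inter_eq_right.2 Set.Ioo_subset_Ioi_self,
            ← integral_Ioc_eq_integral_Ioo, ← intervalIntegral.integral_of_le zero_le_one,
            intervalIntegral.integral_ofReal, integral_pow]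
          norm_num
        rw [h2, setIntegral_indicator measurableSet_Ioo, Set.inter_eq_right.2
          (Set.Ioo_subset_Ioo_left (by linarith [Real.pi_pos])),
          intervalIntegral.integral_of_le Real.pi_pos.le, integral_Ioc_eq_integral_Ioo]
      · rintro ⟨r, θ⟩ ⟨hr, hθ⟩
        have hr' : 0 < r := hr
        simp only [polarCoord_symm_apply, Complex.real_smul, H]
        by_cases hθ0 : θ ∈ Set.Ioo 0 Real.pi
        · have hs := Real.sin_pos_of_mem_Ioo hθ0
          have : (r * Real.cos θ, r * Real.sin θ, φ) ∈ (Set.univ : Set ℝ) ×ˢ polarCoord.target := by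
            rw [polarCoord_target]
            exact ⟨trivial, mul_pos hr' hs, hφ⟩
          rw [Set.indicator_of_mem this, Set.indicator_of_mem hθ0]
          have h7 := heq r θ φ
          simp only [polarCoord_symm_apply] at h7
          simp only [G]
          rw [h7, ballExtension_smul f hr']
          push_cast
          ring
        -- The second polar angle runs over `(-π, π)`, but the half with `sin θ ≤ 0` corresponds to
        -- a nonpositive distance from the axis, where `H` vanishes.
        · have hs : Real.sin θ ≤ 0 := by
            refine Real.sin_nonpos_of_nonpos_of_neg_pi_le ?_ hθ.1.le
            by_contra hn
            exact hθ0 ⟨not_le.1 hn, hθ.2⟩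
          have : (r * Real.cos θ, r * Real.sin θ, φ) ∉ (Set.univ : Set ℝ) ×ˢ polarCoord.target := by
            rw [polarCoord_target]
            rintro ⟨-, h1, -⟩
            have h1' : 0 < r * Real.sin θ := h1
            nlinarith
          rw [Set.indicator_of_notMem this, Set.indicator_of_notMem hθ0]
          ring
    · rw [Set.indicator_of_notMem hφ]
      refine integral_eq_zero_of_ae (Eventually.of_forall fun p => ?_)
      refine Set.indicator_of_notMem ?_ _
      rw [polarCoord_target]
      exact fun h => hφ h.2.2
  simp_rw [h3] at h2
  rw [integral_indicator measurableSet_Ioo, integral_const_mul] at h2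
  rw [h1, h2] at h
  rw [intervalIntegral.integral_of_le (a := -Real.pi) (by linarith [Real.pi_pos]), integral_Ioc_eq_integral_Ioo]
  rw [Nat.cast_ofNat] at h
  linear_combination -3 * h

/-! ### One-variable oscillatory integrals: Riemann–Lebesgue and integration by parts. -/

theorem norm_exp_I_mul_ofReal_eq_one (x : ℝ) : ‖Complex.exp (Complex.I * (x : ℂ))‖ = 1 := by
  rw [mul_comm]; exact Complex.norm_exp_ofReal_mul_I x

/-- The Riemann–Lebesgue lemma with angular frequency. -/
theorem tendsto_integral_exp_mul_atTop (h : ℝ → ℂ) :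
    Tendsto (fun l : ℝ => ∫ s : ℝ, Complex.exp (Complex.I * ((-(l * s) : ℝ) : ℂ)) * h s) atTop (𝓝 0) := by
  have h1 := (Real.tendsto_integral_exp_smul_cocompact h).comp
    ((tendsto_id.atTop_div_const (r := 2 * Real.pi) (by positivity)).mono_right
      atTop_le_cocompact)
  refine h1.congr fun l => ?_
  refine integral_congr_ae (Eventually.of_forall fun s => ?_)
  simp only [id, Circle.smul_def, Real.fourierChar_apply, smul_eq_mul]
  congr 2
  have : Real.pi ≠ 0 := Real.pi_ne_zero
  rw [mul_comm Complex.I]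
  congr 2
  field_simp

/-- The Riemann–Lebesgue lemma with phase `cos`. -/
theorem tendsto_integral_exp_one_sub_cos {g : ℝ → ℂ} :
    Tendsto (fun l : ℝ => ∫ θ in (0)..Real.pi,
      Complex.exp (Complex.I * ((l * (1 - Real.cos θ) : ℝ) : ℂ)) * g θ) atTop (𝓝 0) := by
  -- In the variable `s = cos θ` the phase is linear; the Jacobian `sin θ = √(1 - s²)` is divided
  -- out of the amplitude.
  set h : ℝ → ℂ := (Real.cos '' Set.Ioo 0 Real.pi).indicator
    fun s => g (Real.arccos s) / (√(1 - s ^ 2) : ℂ)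
  have hinj : Set.InjOn Real.cos (Set.Ioo 0 Real.pi) :=
    Real.injOn_cos.mono Set.Ioo_subset_Icc_self
  have hmeas : MeasurableSet (Real.cos '' Set.Ioo 0 Real.pi) :=
    measurableSet_Ioo.image_of_continuousOn_injOn Real.continuous_cos.continuousOn hinj
  have key : ∀ l : ℝ, ∫ θ in (0)..Real.pi, Complex.exp (Complex.I * ((l * (1 - Real.cos θ) : ℝ) : ℂ)) * g θ
      = Complex.exp (Complex.I * (l : ℂ)) *
        ∫ s : ℝ, Complex.exp (Complex.I * ((-(l * s) : ℝ) : ℂ)) * h s := by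
    intro l
    have e1 : ∀ s : ℝ, Complex.exp (Complex.I * ((-(l * s) : ℝ) : ℂ)) * h s =
        (Real.cos '' Set.Ioo 0 Real.pi).indicator
          (fun s => Complex.exp (Complex.I * ((-(l * s) : ℝ) : ℂ)) *
            (g (Real.arccos s) / (√(1 - s ^ 2) : ℂ))) s := by
      intro s
      by_cases hs : s ∈ Real.cos '' Set.Ioo 0 Real.pi
      · simp only [h, Set.indicator_of_mem hs]
      · simp only [h, Set.indicator_of_notMem hs, mul_zero]
    simp_rw [e1]
    rw [integral_indicator hmeas, integral_image_eq_integral_abs_deriv_smul measurableSet_Ioo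
      (fun x _ => (Real.hasDerivAt_cos x).hasDerivWithinAt) hinj, ← integral_const_mul,
      intervalIntegral.integral_of_le Real.pi_pos.le, integral_Ioc_eq_integral_Ioo]
    refine setIntegral_congr_fun measurableSet_Ioo fun θ hθ => ?_
    have hs := Real.sin_pos_of_mem_Ioo hθ
    have h2 : √(1 - Real.cos θ ^ 2) = Real.sin θ := by
      rw [← Real.sin_sq, Real.sqrt_sq hs.le]
    simp only [h2, Real.arccos_cos hθ.1.le hθ.2.le, Complex.real_smul, abs_neg, abs_of_pos hs]
    have : (Real.sin θ : ℂ) ≠ 0 := by exact_mod_cast hs.ne'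
    rw [mul_sub, mul_one, Complex.ofReal_sub, sub_eq_add_neg, mul_add, Complex.exp_add,
      Complex.ofReal_neg]
    field_simp
  refine squeeze_zero_norm (a := fun l => ‖∫ s : ℝ, Complex.exp (Complex.I * ((-(l * s) : ℝ) : ℂ)) * h s‖)
    (fun l => ?_) ?_
  · rw [key, norm_mul, norm_exp_I_mul_ofReal_eq_one, one_mul]
  · simpa using (tendsto_integral_exp_mul_atTop h).norm

theorem continuous_exp_phase {f : ℝ → ℝ} (hf : Continuous f) :
    Continuous (fun θ => Complex.exp (Complex.I * (f θ : ℂ))) := by fun_prop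

/-- Integration by parts in the polar angle on `S²`. -/
theorem integral_exp_one_sub_cos_sin {F : ℝ → ℂ} (hF : ContDiff ℝ 1 F) (hpi : F Real.pi = 0) (l : ℝ) :
    (l : ℂ) * ∫ θ in (0)..Real.pi, Complex.exp (Complex.I * ((l * (1 - Real.cos θ) : ℝ) : ℂ)) *
      (Real.sin θ * F θ) =
    Complex.I * (F 0 + ∫ θ in (0)..Real.pi,
      Complex.exp (Complex.I * ((l * (1 - Real.cos θ) : ℝ) : ℂ)) * deriv F θ) := by
  have hd : ∀ θ : ℝ, HasDerivAt (fun θ : ℝ => Complex.exp (Complex.I * ((l * (1 - Real.cos θ) : ℝ) : ℂ)))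
      (Complex.exp (Complex.I * ((l * (1 - Real.cos θ) : ℝ) : ℂ)) * (Complex.I * ((l * Real.sin θ : ℝ) : ℂ))) θ := by
    intro θ
    have h1 : HasDerivAt (fun θ : ℝ => l * (1 - Real.cos θ)) (l * Real.sin θ) θ := by
      simpa using ((Real.hasDerivAt_cos θ).const_sub 1).const_mul l
    exact (h1.ofReal_comp.const_mul Complex.I).cexp
  have hF' : Continuous (deriv F) := hF.continuous_deriv le_rfl
  -- The derivative of the exponential produces `i l sin θ`, so the sine weight makes the
  -- oscillating factor exact; since `F` vanishes at `π`, only the boundary term at `0` survives.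
  have hparts := intervalIntegral.integral_deriv_mul_eq_sub (a := 0) (b := Real.pi)
    (fun θ _ => hd θ) (fun θ _ => (hF.differentiable one_ne_zero θ).hasDerivAt)
    (Continuous.intervalIntegrable (by fun_prop) _ _) (hF'.intervalIntegrable _ _)
  rw [intervalIntegral.integral_add] at hparts
  · rw [hpi, Real.cos_zero] at hparts
    have e : ∫ θ in (0)..Real.pi, Complex.exp (Complex.I * ((l * (1 - Real.cos θ) : ℝ) : ℂ)) *
        (Complex.I * ((l * Real.sin θ : ℝ) : ℂ)) * F θ =
        Complex.I * ((l : ℂ) * ∫ θ in (0)..Real.pi,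
          Complex.exp (Complex.I * ((l * (1 - Real.cos θ) : ℝ) : ℂ)) * (Real.sin θ * F θ)) := by
      rw [← intervalIntegral.integral_const_mul, ← intervalIntegral.integral_const_mul]
      refine intervalIntegral.integral_congr fun θ _ => ?_
      simp only [Complex.ofReal_mul l (Real.sin θ)]
      ring
    rw [e] at hparts
    simp only [sub_self, mul_zero, Complex.ofReal_zero, Complex.exp_zero, one_mul, zero_sub] at hparts
    have hI := Complex.I_mul_I
    linear_combination (-Complex.I) * hparts + ((l : ℂ) * ∫ θ in (0)..Real.pi,
          Complex.exp (Complex.I * ((l * (1 - Real.cos θ) : ℝ) : ℂ)) * (Real.sin θ * F θ)) * hI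
  · exact Continuous.intervalIntegrable (by have := hF.continuous; fun_prop) _ _
  · exact Continuous.intervalIntegrable (by fun_prop) _ _

/-! ### The Fresnel integral and one-sided stationary phase. -/

/-- The (complex) Fresnel integral `∫₀^v e^{iw²} dw`. -/
def fresnel (v : ℝ) : ℂ := ∫ w in (0)..v, Complex.exp (Complex.I * ((w ^ 2 : ℝ) : ℂ))

theorem hasDerivAt_fresnel (v : ℝ) :
    HasDerivAt fresnel (Complex.exp (Complex.I * ((v ^ 2 : ℝ) : ℂ))) v :=
  (continuous_exp_phase (f := fun w => w ^ 2) (by fun_prop)).integral_hasStrictDerivAt 0 v |>.hasDerivAt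

theorem continuous_fresnel : Continuous fresnel :=
  continuous_iff_continuousAt.2 fun v => (hasDerivAt_fresnel v).continuousAt

/-- Up to an error of size `w⁻²`, integrable at infinity, `e^{iw²}` is the derivative of
`e^{iw²}/(2iw)`, which tends to zero. -/
theorem exists_tendsto_fresnel : ∃ L, Tendsto fresnel atTop (𝓝 L) := by
  have hd : ∀ w : ℝ, w ≠ 0 → HasDerivAt
      (fun w : ℝ => Complex.exp (Complex.I * ((w ^ 2 : ℝ) : ℂ)) * (2 * Complex.I * w)⁻¹)
      (Complex.exp (Complex.I * ((w ^ 2 : ℝ) : ℂ)) -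
        Complex.exp (Complex.I * ((w ^ 2 : ℝ) : ℂ)) * ((2 * Complex.I)⁻¹ * ((w : ℂ) ^ 2)⁻¹)) w := by
    intro w hw
    have hw' : (w : ℂ) ≠ 0 := by exact_mod_cast hw
    have h1 : HasDerivAt (fun w : ℝ => Complex.exp (Complex.I * ((w ^ 2 : ℝ) : ℂ)))
        (Complex.exp (Complex.I * ((w ^ 2 : ℝ) : ℂ)) * (Complex.I * ((2 * w : ℝ) : ℂ))) w := by
      have := ((hasDerivAt_pow 2 w).ofReal_comp.const_mul Complex.I).cexp
      simpa using this
    have h2 : HasDerivAt (fun w : ℝ => (2 * Complex.I * (w : ℂ))⁻¹)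
        (-(2 * Complex.I * 1) / (2 * Complex.I * w) ^ 2) w :=
      ((hasDerivAt_id w).ofReal_comp.const_mul (2 * Complex.I)).inv (by simp [hw])
    refine (h1.mul h2).congr_deriv ?_
    push_cast
    field_simp
    ring
  have hcont : ContinuousOn (fun w : ℝ => Complex.exp (Complex.I * ((w ^ 2 : ℝ) : ℂ)) *
      ((2 * Complex.I)⁻¹ * ((w : ℂ) ^ 2)⁻¹)) (Set.Ici 1) := by
    refine ContinuousOn.mul (by fun_prop) (continuousOn_const.mul (ContinuousOn.inv₀ (by fun_prop) ?_))
    intro w hw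
    have : (0 : ℝ) < w := lt_of_lt_of_le one_pos hw
    exact pow_ne_zero 2 (by exact_mod_cast this.ne')
  have hint : IntegrableOn (fun w : ℝ => Complex.exp (Complex.I * ((w ^ 2 : ℝ) : ℂ)) *
      ((2 * Complex.I)⁻¹ * ((w : ℂ) ^ 2)⁻¹)) (Set.Ioi 1) := by
    have h0 : IntegrableOn (fun w : ℝ => 1 / 2 * w ^ (-2 : ℝ)) (Set.Ioi 1) :=
      (integrableOn_Ioi_rpow_of_lt (by norm_num) one_pos).const_mul _
    refine Integrable.mono' h0
      ((hcont.mono Set.Ioi_subset_Ici_self).aestronglyMeasurable measurableSet_Ioi) ?_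
    filter_upwards [ae_restrict_mem measurableSet_Ioi] with w hw
    have hw' : (0 : ℝ) < w := lt_trans one_pos hw
    rw [norm_mul, norm_exp_I_mul_ofReal_eq_one, one_mul, Real.rpow_neg hw'.le]
    simp
  have hlim := intervalIntegral_tendsto_integral_Ioi 1 hint tendsto_id
  set J := ∫ x in Set.Ioi (1 : ℝ), Complex.exp (Complex.I * ((x ^ 2 : ℝ) : ℂ)) *
      ((2 * Complex.I)⁻¹ * ((x : ℂ) ^ 2)⁻¹)
  have hb : Tendsto (fun w : ℝ => Complex.exp (Complex.I * ((w ^ 2 : ℝ) : ℂ)) * (2 * Complex.I * w)⁻¹)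
      atTop (𝓝 0) := by
    refine squeeze_zero_norm' (a := fun w : ℝ => 1 / 2 * w⁻¹) ?_ ?_
    · filter_upwards [eventually_gt_atTop 0] with w hw
      rw [norm_mul, norm_exp_I_mul_ofReal_eq_one, one_mul]
      simp [abs_of_pos hw, mul_comm]
    · simpa using tendsto_inv_atTop_zero.const_mul (1 / 2 : ℝ)
  refine ⟨fresnel 1 + (0 - Complex.exp (Complex.I * ((1 ^ 2 : ℝ) : ℂ)) * (2 * Complex.I * (1 : ℝ))⁻¹) + J, ?_⟩
  refine ((tendsto_const_nhds.add (hb.sub_const _)).add hlim).congr' ?_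
  filter_upwards [eventually_ge_atTop 1] with v hv
  have hcont' : ContinuousOn (fun w : ℝ => Complex.exp (Complex.I * ((w ^ 2 : ℝ) : ℂ)) *
      ((2 * Complex.I)⁻¹ * ((w : ℂ) ^ 2)⁻¹)) (Set.uIcc 1 v) :=
    hcont.mono (by rw [Set.uIcc_of_le hv]; exact Set.Icc_subset_Ici_self)
  have hi1 : IntervalIntegrable (fun w : ℝ => Complex.exp (Complex.I * ((w ^ 2 : ℝ) : ℂ))) volume 1 v :=
    Continuous.intervalIntegrable (by fun_prop) _ _
  have hftc := intervalIntegral.integral_eq_sub_of_hasDerivAt (a := 1) (b := v)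
    (fun w hw => hd w (by
      rw [Set.uIcc_of_le hv] at hw
      exact (lt_of_lt_of_le one_pos hw.1).ne')) (hi1.sub hcont'.intervalIntegrable)
  rw [intervalIntegral.integral_sub hi1 hcont'.intervalIntegrable] at hftc
  have hadd := intervalIntegral.integral_add_adjacent_intervals
    (Continuous.intervalIntegrable (μ := volume) (u := fun w : ℝ => Complex.exp (Complex.I * ((w ^ 2 : ℝ) : ℂ))) (by fun_prop) 0 1) hi1
  simp only [id]
  unfold fresnel
  rw [← hadd]
  linear_combination -hftc

/-- Convergence at infinity and continuity on compact intervals give a bound that serves as the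
dominating constant in the limits below. -/
theorem exists_norm_fresnel_le : ∃ C, ∀ v, 0 ≤ v → ‖fresnel v‖ ≤ C := by
  obtain ⟨L, hL⟩ := exists_tendsto_fresnel
  obtain ⟨A, hA⟩ := (hL.norm.isBoundedUnder_le).eventually_le
  obtain ⟨B, hB⟩ := eventually_atTop.1 hA
  obtain ⟨C, hC⟩ := isCompact_Icc.exists_bound_of_continuousOn (s := Set.Icc 0 B)
    continuous_fresnel.continuousOn
  refine ⟨max A C, fun v hv => ?_⟩
  rcases le_total v B with h | h
  · exact le_max_of_le_right (hC v ⟨hv, h⟩)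
  · exact le_max_of_le_left (hB v h)

theorem hasDerivAt_fresnel_comp (l : ℝ) (hl : 0 ≤ l) (u : ℝ) :
    HasDerivAt (fun u => fresnel (√l * u))
      ((√l : ℂ) * Complex.exp (Complex.I * ((l * u ^ 2 : ℝ) : ℂ))) u := by
  have h := (hasDerivAt_fresnel (√l * u)).scomp u ((hasDerivAt_id u).const_mul √l)
  refine h.congr_deriv ?_
  rw [mul_pow, Real.sq_sqrt hl, mul_one, Complex.real_smul]

/-- A positive factor leaves the argument unchanged, so the principal branch is multiplicative here.
-/
theorem mul_cpow_of_pos {a : ℝ} (ha : 0 < a) (z : ℂ) (hz : z ≠ 0) (s : ℂ) :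
    ((a : ℂ) * z) ^ s = (a : ℂ) ^ s * z ^ s := by
  have ha' : (a : ℂ) ≠ 0 := by exact_mod_cast ha.ne'
  rw [Complex.cpow_def_of_ne_zero (mul_ne_zero ha' hz), Complex.cpow_def_of_ne_zero ha',
    Complex.cpow_def_of_ne_zero hz, Complex.log_ofReal_mul ha hz, Complex.ofReal_log ha.le, add_mul,
    Complex.exp_add]

theorem sqrt_eq_cpow {a : ℝ} (ha : 0 ≤ a) : ((√a : ℝ) : ℂ) = (a : ℂ) ^ (1 / 2 : ℂ) := by
  rw [Real.sqrt_eq_rpow, Complex.ofReal_cpow ha]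
  norm_num

/-- The value of the Fresnel integral. -/
theorem tendsto_fresnel :
    Tendsto fresnel atTop (𝓝 ((Real.pi * Complex.I) ^ (1 / 2 : ℂ) / 2)) := by
  obtain ⟨L, hL⟩ := exists_tendsto_fresnel
  obtain ⟨C, hC⟩ := exists_norm_fresnel_le
  have hC0 : 0 ≤ C := (norm_nonneg _).trans (hC 0 le_rfl)
  -- Abel means of the Fresnel integral
  have hgauss : ∀ l : ℝ, 0 < l → ∫ u in Set.Ioi (0 : ℝ), fresnel (√l * u) *
      (2 * ((u : ℂ) * Complex.exp (-1 * (u : ℂ) ^ 2))) = (√l : ℂ) * ((Real.pi / (1 - Complex.I * l)) ^ (1 / 2 : ℂ) / 2) := by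
    intro l hl
    have hre : 0 < (1 - Complex.I * l : ℂ).re := by simp
    have hv : ∀ u ∈ Set.Ioi (0 : ℝ), HasDerivAt (fun u : ℝ => -Complex.exp (-1 * (u : ℂ) ^ 2))
        (2 * ((u : ℂ) * Complex.exp (-1 * (u : ℂ) ^ 2))) u := by
      intro u _
      have h1 : HasDerivAt (fun u : ℝ => (u : ℂ)) 1 u := (hasDerivAt_id u).ofReal_comp
      have := (((h1.pow 2).const_mul (-1)).cexp).neg
      refine this.congr_deriv ?_
      simp
      ring
    have hint1 : Integrable (fun u : ℝ => 2 * ((u : ℂ) * Complex.exp (-1 * (u : ℂ) ^ 2))) :=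
      (integrable_mul_cexp_neg_mul_sq (b := 1) (by simp)).const_mul 2
    have hint2 := (integrable_cexp_neg_mul_sq hre).const_mul (√l : ℂ)
    have e2 : ∀ u : ℝ, (√l : ℂ) * Complex.exp (Complex.I * ((l * u ^ 2 : ℝ) : ℂ)) *
        (-Complex.exp (-1 * (u : ℂ) ^ 2)) = -((√l : ℂ) * Complex.exp (-(1 - Complex.I * l) * (u : ℂ) ^ 2)) := by
      intro u
      rw [mul_neg, mul_assoc, ← Complex.exp_add]
      congr 3
      push_cast; ring
    have hbd : ∀ u : ℝ, ‖Complex.exp (-1 * (u : ℂ) ^ 2)‖ = Real.exp (-u ^ 2) := by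
      intro u
      rw [Complex.norm_exp]
      congr 1
      have : (-1 * (u : ℂ) ^ 2) = ((-u ^ 2 : ℝ) : ℂ) := by push_cast; ring
      rw [this, Complex.ofReal_re]
    have hinf : Tendsto (fun u : ℝ => Real.exp (-u ^ 2)) atTop (𝓝 0) :=
      Real.tendsto_exp_neg_atTop_nhds_zero.comp (tendsto_pow_atTop two_ne_zero)
    have hm1 : Continuous (fun u : ℝ => fresnel (√l * u)) := continuous_fresnel.comp (by fun_prop)
    have := integral_Ioi_mul_deriv_eq_deriv_mul (a := 0) (a' := 0) (b' := 0)
      (fun u _ => hasDerivAt_fresnel_comp l hl.le u) hv ?_ ?_ ?_ ?_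
    · rw [this]
      simp_rw [e2]
      rw [integral_neg, integral_const_mul, integral_gaussian_complex_Ioi hre]
      ring
    · refine Integrable.mono' (hint1.norm.const_mul C).integrableOn
        (Continuous.aestronglyMeasurable (by unfold Pi.instMul; fun_prop)) ?_
      filter_upwards [ae_restrict_mem measurableSet_Ioi] with u hu
      rw [Pi.mul_apply, norm_mul]
      exact mul_le_mul_of_nonneg_right (hC _ (mul_nonneg (Real.sqrt_nonneg _) (le_of_lt hu))) (norm_nonneg _)
    · refine (hint2.neg.integrableOn).congr (Eventually.of_forall fun u => ?_)
      exact (e2 u).symm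
    · have : Tendsto (fun u : ℝ => fresnel (√l * u) * -Complex.exp (-1 * (u : ℂ) ^ 2)) (𝓝 0)
          (𝓝 (fresnel (√l * 0) * -Complex.exp (-1 * ((0 : ℝ) : ℂ) ^ 2))) :=
        Continuous.tendsto (by fun_prop) 0
      simp only [mul_zero, fresnel, intervalIntegral.integral_same, zero_mul] at this
      exact this.mono_left nhdsWithin_le_nhds
    · refine squeeze_zero_norm' (a := fun u => C * Real.exp (-u ^ 2)) ?_ (by simpa using hinf.const_mul C)
      filter_upwards [eventually_ge_atTop 0] with u hu
      rw [Pi.mul_apply, norm_mul, norm_neg, hbd]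
      exact mul_le_mul_of_nonneg_right (hC _ (mul_nonneg (Real.sqrt_nonneg _) hu)) (Real.exp_nonneg _)
  -- The weight `2u e^{-u²}` has mass one on the half-line and `fresnel (√l u) → L` for each `u >
  -- 0`, so the means have the same limit.
  have hlim1 : Tendsto (fun l : ℝ => ∫ u in Set.Ioi (0 : ℝ), fresnel (√l * u) *
      (2 * ((u : ℂ) * Complex.exp (-1 * (u : ℂ) ^ 2)))) atTop (𝓝 L) := by
    have hint1 : Integrable (fun u : ℝ => 2 * ((u : ℂ) * Complex.exp (-1 * (u : ℂ) ^ 2))) :=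
      (integrable_mul_cexp_neg_mul_sq (b := 1) (by simp)).const_mul 2
    have hval : ∫ u in Set.Ioi (0 : ℝ), L * (2 * ((u : ℂ) * Complex.exp (-1 * (u : ℂ) ^ 2))) = L := by
      rw [integral_const_mul, integral_const_mul, integral_mul_cexp_neg_mul_sq (by simp)]
      simp
    rw [← hval]
    refine tendsto_integral_filter_of_dominated_convergence
      (fun u => C * ‖2 * ((u : ℂ) * Complex.exp (-1 * (u : ℂ) ^ 2))‖) ?_ ?_
      (hint1.norm.const_mul C).integrableOn ?_
    · refine Eventually.of_forall fun l => Continuous.aestronglyMeasurable ?_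
      have hm1 : Continuous (fun u : ℝ => fresnel (√l * u)) := continuous_fresnel.comp (by fun_prop)
      fun_prop
    · refine Eventually.of_forall fun l => ?_
      filter_upwards [ae_restrict_mem measurableSet_Ioi] with u hu
      rw [norm_mul]
      exact mul_le_mul_of_nonneg_right (hC _ (mul_nonneg (Real.sqrt_nonneg _) (le_of_lt hu))) (norm_nonneg _)
    · filter_upwards [ae_restrict_mem measurableSet_Ioi] with u hu
      exact (hL.comp (Real.tendsto_sqrt_atTop.atTop_mul_const hu)).mul_const _
  -- Absorbing `√l` into the power leaves the square root of `π / (l⁻¹ - i)`; its argument tends to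
  -- `πi`, where the principal branch is continuous.
  have hlim2 : Tendsto (fun l : ℝ => (√l : ℂ) * ((Real.pi / (1 - Complex.I * l)) ^ (1 / 2 : ℂ) / 2)) atTop
      (𝓝 ((Real.pi * Complex.I) ^ (1 / 2 : ℂ) / 2)) := by
    have h1 : Tendsto (fun l : ℝ => (Real.pi : ℂ) * ((l⁻¹ : ℝ) - Complex.I)⁻¹) atTop (𝓝 (Real.pi * Complex.I)) := by
      have : Tendsto (fun l : ℝ => (Real.pi : ℂ) * (((l⁻¹ : ℝ) : ℂ) - Complex.I)⁻¹) atTop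
          (𝓝 (Real.pi * (((0 : ℝ) : ℂ) - Complex.I)⁻¹)) := by
        refine Tendsto.const_mul _ (Tendsto.inv₀ (Tendsto.sub_const ?_ _) (by simp))
        exact (Complex.continuous_ofReal.tendsto 0).comp tendsto_inv_atTop_zero
      simpa using this
    have h2 : Tendsto (fun l : ℝ => ((Real.pi : ℂ) * ((l⁻¹ : ℝ) - Complex.I)⁻¹) ^ (1 / 2 : ℂ) / 2) atTop
        (𝓝 ((Real.pi * Complex.I) ^ (1 / 2 : ℂ) / 2)) := by
      refine Tendsto.div_const ?_ _
      refine ((continuousAt_cpow_const ?_).tendsto).comp h1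
      right
      simp [Real.pi_ne_zero]
    refine h2.congr' ?_
    filter_upwards [eventually_gt_atTop 0] with l hl
    have hl' : (l : ℂ) ≠ 0 := by exact_mod_cast hl.ne'
    have hne : (1 - Complex.I * l : ℂ) ≠ 0 := fun h => by
      have := congrArg Complex.re h; simp at this
    have hpi : (Real.pi : ℂ) ≠ 0 := by exact_mod_cast Real.pi_ne_zero
    rw [sqrt_eq_cpow hl.le, ← mul_div_assoc, ← mul_cpow_of_pos hl _ (div_ne_zero hpi hne)]
    congr 2
    have h3 : ((l⁻¹ : ℝ) : ℂ) - Complex.I = (1 - Complex.I * l) / l := by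
      push_cast; field_simp
    rw [h3, inv_div]
    field_simp
  have hL2 : L = (Real.pi * Complex.I) ^ (1 / 2 : ℂ) / 2 := by
    refine tendsto_nhds_unique (hlim1.congr' ?_) hlim2
    filter_upwards [eventually_gt_atTop 0] with l hl using hgauss l hl
  rwa [hL2] at hL

/-- One-sided stationary phase at the endpoint `0` for a quadratic phase and a `C¹` amplitude. -/
theorem tendsto_sqrt_mul_integral_exp_sq {G : ℝ → ℂ}
    (hG : ∀ u ∈ Set.Icc (0 : ℝ) 1, ContDiffAt ℝ 1 G u) :
    Tendsto (fun l : ℝ => (√l : ℂ) * ∫ u in (0)..1, Complex.exp (Complex.I * ((l * u ^ 2 : ℝ) : ℂ)) * G u)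
      atTop (𝓝 ((Real.pi * Complex.I) ^ (1 / 2 : ℂ) / 2 * G 0)) := by
  set L : ℂ := (Real.pi * Complex.I) ^ (1 / 2 : ℂ) / 2
  have hL : Tendsto fresnel atTop (𝓝 L) := tendsto_fresnel
  obtain ⟨C, hC⟩ := exists_norm_fresnel_le
  have hu : Set.uIcc (0 : ℝ) 1 = Set.Icc 0 1 := Set.uIcc_of_le zero_le_one
  have hder : ∀ u ∈ Set.uIcc (0 : ℝ) 1, HasDerivAt G (deriv G u) u := fun u h =>
    ((hG u (hu ▸ h)).differentiableAt one_ne_zero).hasDerivAt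
  have hGc : ContinuousOn G (Set.uIcc (0 : ℝ) 1) := fun u h =>
    (hG u (hu ▸ h)).continuousAt.continuousWithinAt
  have hdc : ContinuousOn (deriv G) (Set.uIcc (0 : ℝ) 1) := fun u h => by
    have h1 := ((hG u (hu ▸ h)).continuousAt_fderiv one_ne_zero)
    have h2 : ContinuousAt (fun x => fderiv ℝ G x 1) u := h1.clm_apply continuousAt_const
    exact h2.continuousWithinAt
  have hdi : IntervalIntegrable (deriv G) volume 0 1 := hdc.intervalIntegrable
  -- Since `fresnel (√l u)` is an antiderivative of `√l e^{ilu²}`, integration by parts absorbs the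
  -- growing factor and leaves bounded quantities.
  have hparts : ∀ l : ℝ, 0 < l →
      (√l : ℂ) * ∫ u in (0)..1, Complex.exp (Complex.I * ((l * u ^ 2 : ℝ) : ℂ)) * G u =
      fresnel √l * G 1 - ∫ u in (0)..1, fresnel (√l * u) * deriv G u := by
    intro l hl
    have := intervalIntegral.integral_deriv_mul_eq_sub (a := 0) (b := 1)
      (fun u _ => hasDerivAt_fresnel_comp l hl.le u) hder
      (Continuous.intervalIntegrable (by fun_prop) _ _) hdi
    rw [intervalIntegral.integral_add] at this
    · have h0 : fresnel 0 = 0 := by simp [fresnel]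
      rw [mul_one, mul_zero, h0, zero_mul, sub_zero] at this
      rw [← this, add_sub_cancel_right, ← intervalIntegral.integral_const_mul]
      simp_rw [mul_assoc]
    · exact (ContinuousOn.mul (Continuous.continuousOn (by fun_prop)) hGc).intervalIntegrable
    · exact (ContinuousOn.mul (continuous_fresnel.comp (by fun_prop)).continuousOn hdc).intervalIntegrable
  have hlim : Tendsto (fun l : ℝ => ∫ u in (0)..1, fresnel (√l * u) * deriv G u) atTop
      (𝓝 (∫ u in (0)..1, L * deriv G u)) := by
    refine intervalIntegral.tendsto_integral_filter_of_dominated_convergence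
      (fun u => C * ‖deriv G u‖) ?_ ?_ (hdi.norm.const_mul C) ?_
    · refine Eventually.of_forall fun l => ?_
      refine ContinuousOn.aestronglyMeasurable ?_ measurableSet_uIoc
      exact (ContinuousOn.mul (continuous_fresnel.comp (by fun_prop)).continuousOn hdc).mono
        Set.uIoc_subset_uIcc
    · refine Eventually.of_forall fun l => Eventually.of_forall fun u hu' => ?_
      rw [Set.uIoc_of_le zero_le_one] at hu'
      rw [norm_mul]
      exact mul_le_mul_of_nonneg_right (hC _ (mul_nonneg (Real.sqrt_nonneg _) hu'.1.le)) (norm_nonneg _)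
    · refine Eventually.of_forall fun u hu' => ?_
      rw [Set.uIoc_of_le zero_le_one] at hu'
      exact (hL.comp (Real.tendsto_sqrt_atTop.atTop_mul_const hu'.1)).mul_const _
  -- The value at `1` cancels against the limit of the boundary term, so only the stationary
  -- endpoint contributes.
  have hval : ∫ u in (0)..1, L * deriv G u = L * G 1 - L * G 0 := by
    rw [intervalIntegral.integral_const_mul, intervalIntegral.integral_eq_sub_of_hasDerivAt hder hdi, mul_sub]
  have hfin := ((hL.comp Real.tendsto_sqrt_atTop).mul_const (G 1)).sub hlim
  rw [hval, sub_sub_cancel] at hfin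
  refine hfin.congr' ?_
  filter_upwards [eventually_gt_atTop 0] with l hl using (hparts l hl).symm

/-- One-sided stationary phase at the endpoint `0` for the phase `1 - cos`. -/
theorem tendsto_sqrt_mul_integral_exp_one_sub_cos {F : ℝ → ℂ} (hF : ContDiff ℝ 1 F) :
    Tendsto (fun l : ℝ => (√l : ℂ) * ∫ θ in (0)..(Real.pi / 2),
      Complex.exp (Complex.I * ((l * (1 - Real.cos θ) : ℝ) : ℂ)) * F θ)
      atTop (𝓝 ((2 * Real.pi * Complex.I) ^ (1 / 2 : ℂ) / 2 * F 0)) := by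
  have h2 : (0 : ℝ) < √2 := by positivity
  have hs2 : √2 * √2 = 2 := Real.mul_self_sqrt (by norm_num)
  have hlt : ∀ u ∈ Set.Icc (0 : ℝ) 1, -1 < u / √2 ∧ u / √2 < 1 := by
    intro u hu
    have : (1 : ℝ) < √2 := by nlinarith
    constructor
    · have : 0 ≤ u / √2 := div_nonneg hu.1 h2.le
      linarith
    · rw [div_lt_one h2]; linarith [hu.2]
  -- The substitution `θ = ψ u` solves `1 - cos θ = u²` by the half-angle formula, with `m` its
  -- derivative. The range `0 ≤ u ≤ 1` matches `0 ≤ θ ≤ π/2` and keeps `u/√2` away from the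
  -- singularity of `arcsin` at `1`.
  set m : ℝ → ℝ := fun u => 2 * (1 / √(1 - (u / √2) ^ 2) * (1 / √2))
  set ψ : ℝ → ℝ := fun u => 2 * Real.arcsin (u / √2)
  have hψ : ∀ u ∈ Set.Icc (0 : ℝ) 1, HasDerivAt ψ (m u) u := by
    intro u hu
    obtain ⟨h3, h4⟩ := hlt u hu
    have := (Real.hasDerivAt_arcsin h3.ne' h4.ne).comp u ((hasDerivAt_id u).div_const √2)
    exact this.const_mul 2
  have hpos : ∀ u ∈ Set.Icc (0 : ℝ) 1, 1 - (u / √2) ^ 2 ≠ 0 := by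
    intro u hu
    obtain ⟨h3, h4⟩ := hlt u hu
    nlinarith
  have hm : ∀ u ∈ Set.Icc (0 : ℝ) 1, ContDiffAt ℝ 1 m u := by
    intro u hu
    have h5 : ContDiffAt ℝ 1 (fun u : ℝ => 1 - (u / √2) ^ 2) u := by fun_prop
    have h6 := h5.sqrt (hpos u hu)
    have h7 : √(1 - (u / √2) ^ 2) ≠ 0 := by
      obtain ⟨h3, h4⟩ := hlt u hu
      exact (Real.sqrt_pos.2 (by nlinarith)).ne'
    exact contDiffAt_const.mul ((contDiffAt_const.div h6 h7).mul contDiffAt_const)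
  have hψc : ∀ u ∈ Set.Icc (0 : ℝ) 1, ContDiffAt ℝ 1 ψ u := by
    intro u hu
    obtain ⟨h3, h4⟩ := hlt u hu
    exact contDiffAt_const.mul (ContDiffAt.comp (g := Real.arcsin) (f := fun u : ℝ => u / √2) u
      (Real.contDiffAt_arcsin h3.ne' h4.ne) (by fun_prop))
  have hG : ∀ u ∈ Set.Icc (0 : ℝ) 1, ContDiffAt ℝ 1 (fun u => (m u : ℂ) * F (ψ u)) u := by
    intro u hu
    exact (Complex.ofRealCLM.contDiff.contDiffAt.comp u (hm u hu)).mul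
      (hF.contDiffAt.comp u (hψc u hu))
  have hψ0 : ψ 0 = 0 := by simp [ψ]
  have hψ1 : ψ 1 = Real.pi / 2 := by
    have : Real.arcsin (1 / √2) = Real.pi / 4 := by
      rw [← Real.arcsin_sin (x := Real.pi / 4) (by linarith [Real.pi_pos]) (by linarith [Real.pi_pos]),
        Real.sin_pi_div_four]
      congr 1
      rw [div_eq_div_iff h2.ne' two_ne_zero]; linarith
    simp only [ψ, this]; ring
  have hm0 : m 0 = √2 := by
    simp only [m]
    rw [zero_div]
    norm_num
    rw [← div_eq_mul_inv, div_eq_iff h2.ne', hs2]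
  have hcos : ∀ u ∈ Set.Icc (0 : ℝ) 1, 1 - Real.cos (ψ u) = u ^ 2 := by
    intro u hu
    obtain ⟨h3, h4⟩ := hlt u hu
    simp only [ψ]
    rw [Real.cos_two_mul', Real.cos_sq', Real.sin_arcsin h3.le h4.le, div_pow, Real.sq_sqrt (by norm_num)]
    ring
  have hcv : ∀ l : ℝ, ∫ θ in (0)..(Real.pi / 2),
      Complex.exp (Complex.I * ((l * (1 - Real.cos θ) : ℝ) : ℂ)) * F θ =
      ∫ u in (0)..1, Complex.exp (Complex.I * ((l * u ^ 2 : ℝ) : ℂ)) * ((m u : ℂ) * F (ψ u)) := by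
    intro l
    have huI : Set.uIcc (0 : ℝ) 1 = Set.Icc 0 1 := Set.uIcc_of_le zero_le_one
    have := intervalIntegral.integral_deriv_smul_comp (a := 0) (b := 1) (f := ψ) (f' := m)
      (g := fun θ => Complex.exp (Complex.I * ((l * (1 - Real.cos θ) : ℝ) : ℂ)) * F θ)
      (fun u hu => hψ u (huI ▸ hu))
      (fun u hu => (hm u (huI ▸ hu)).continuousAt.continuousWithinAt)
      (by have := hF.continuous; fun_prop)
    rw [hψ0, hψ1] at this
    rw [← this]
    refine intervalIntegral.integral_congr fun u hu => ?_
    simp only [Function.comp_apply, Complex.real_smul]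
    rw [hcos u (huI ▸ hu)]
    ring
  have := tendsto_sqrt_mul_integral_exp_sq hG
  rw [hψ0, hm0] at this
  have hpi : (Real.pi * Complex.I : ℂ) ≠ 0 := by simp [Real.pi_ne_zero]
  -- The Jacobian `m 0 = √2` is what turns `(πi)^{1/2}` into `(2πi)^{1/2}`.
  have hc : (2 * Real.pi * Complex.I : ℂ) ^ (1 / 2 : ℂ) = (√2 : ℝ) * (Real.pi * Complex.I : ℂ) ^ (1 / 2 : ℂ) := by
    rw [sqrt_eq_cpow (by norm_num), ← mul_cpow_of_pos (by norm_num) _ hpi]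
    push_cast; ring_nf
  rw [hc]
  simp_rw [hcv]
  convert this using 2
  ring

/-! ### Stationary phase on spheres of dimension at most two. -/

theorem contMDiff_circlePoint (b : OrthonormalBasis (Fin 2) ℝ (Space 2)) :
    ContMDiff 𝓘(ℝ, ℝ) (𝓡 (2 - 1)) ((2 - 1 : ℕ) : WithTop ℕ∞) (circlePoint b) := by
  have h : ContDiff ℝ ((2 - 1 : ℕ) : WithTop ℕ∞) (fun θ : ℝ => Real.cos θ • b 0 + Real.sin θ • b 1) := by
    have h1 := Real.contDiff_cos (n := ((2 - 1 : ℕ) : WithTop ℕ∞))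
    have h2 := Real.contDiff_sin (n := ((2 - 1 : ℕ) : WithTop ℕ∞))
    fun_prop
  exact h.contMDiff.codRestrict_sphere (fun θ => (circlePoint b θ).2)

theorem contMDiff_spherePoint (b : OrthonormalBasis (Fin 3) ℝ (Space 3)) :
    ContMDiff 𝓘(ℝ, ℝ × ℝ) (𝓡 (3 - 1)) ((3 - 1 : ℕ) : WithTop ℕ∞)
      (fun p : ℝ × ℝ => spherePoint b p.1 p.2) := by
  have h : ContDiff ℝ ((3 - 1 : ℕ) : WithTop ℕ∞) (fun p : ℝ × ℝ => Real.cos p.1 • b 0 +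
      Real.sin p.1 • (Real.cos p.2 • b 1 + Real.sin p.2 • b 2)) := by
    have h1 := Real.contDiff_cos (n := ((3 - 1 : ℕ) : WithTop ℕ∞))
    have h2 := Real.contDiff_sin (n := ((3 - 1 : ℕ) : WithTop ℕ∞))
    fun_prop
  exact h.contMDiff.codRestrict_sphere (fun p => (spherePoint b p.1 p.2).2)

theorem inner_circlePoint (b : OrthonormalBasis (Fin 2) ℝ (Space 2)) (θ : ℝ) :
    ⟪b 0, (circlePoint b θ : Space 2)⟫ = Real.cos θ := by
  simp [circlePoint, inner_add_right, inner_smul_right,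
    b.inner_eq_zero (show (0 : Fin 2) ≠ 1 by decide)]

theorem inner_spherePoint (b : OrthonormalBasis (Fin 3) ℝ (Space 3)) (θ φ : ℝ) :
    ⟪b 0, (spherePoint b θ φ : Space 3)⟫ = Real.cos θ := by
  simp [spherePoint, inner_add_right, inner_smul_right,
    b.inner_eq_zero (show (0 : Fin 3) ≠ 1 by decide), b.inner_eq_zero (show (0 : Fin 3) ≠ 2 by decide)]

/-- The phase `e^{iλ(1 - e·q)}` on the sphere. -/
def spherePhase {d : ℕ} (e : Sphere d) (l : ℝ) (q : Sphere d) : ℂ :=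
  Complex.exp (Complex.I * ((l * (1 - ⟪(e : Space d), (q : Space d)⟫) : ℝ) : ℂ))

theorem continuous_spherePhase {d : ℕ} (e : Sphere d) (l : ℝ) : Continuous (spherePhase e l) := by
  unfold spherePhase; fun_prop

theorem continuous_spherePhase_mul {d : ℕ} {f : Sphere d → ℂ} (hf : Continuous f) (e : Sphere d)
    (l : ℝ) : Continuous (fun q => spherePhase e l q * f q) :=
  (continuous_spherePhase e l).mul hf

theorem norm_spherePhase {d : ℕ} (e : Sphere d) (l : ℝ) (q : Sphere d) : ‖spherePhase e l q‖ = 1 :=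
  norm_exp_I_mul_ofReal_eq_one _

theorem inner_self_sphere {d : ℕ} (e : Sphere d) : ⟪(e : Space d), (e : Space d)⟫ = 1 := by
  rw [real_inner_self_eq_norm_sq, norm_eq_of_mem_sphere, one_pow]

/-- On two points nothing has to be expanded: the phase equals `1` at `e`, and the antipode is
silent. -/
theorem stationaryPhase_one {f : Sphere 1 → ℂ} (hf : Continuous f) (e : Sphere 1)
    (h0 : f (-e) = 0) (l : ℝ) : ∫ q, spherePhase e l q * f q ∂(surface 1) = f e := by
  rw [integral_surface_one (continuous_spherePhase_mul hf e l) e, h0, mul_zero, add_zero, spherePhase,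
    inner_self_sphere]
  simp

/-- Only the front semicircle contributes. It splits at `e` into two arcs, each a one-sided endpoint
integral carrying half of the constant. -/
theorem stationaryPhase_two {f : Sphere 2 → ℂ}
    (hf : ContMDiff (𝓡 (2 - 1)) 𝓘(ℝ, ℂ) ((2 - 1 : ℕ) : WithTop ℕ∞) f) (e : Sphere 2)
    (h0 : ∀ q : Sphere 2, ⟪(e : Space 2), (q : Space 2)⟫ ≤ 0 → f q = 0) :
    Tendsto (fun l : ℝ => (√l : ℂ) * ∫ q, spherePhase e l q * f q ∂(surface 2)) atTop
      (𝓝 ((2 * Real.pi * Complex.I) ^ (1 / 2 : ℂ) * f e)) := by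
  obtain ⟨b, hb⟩ := exists_orthonormalBasis_zero e
  set F : ℝ → ℂ := fun θ => f (circlePoint b θ)
  have hF : ContDiff ℝ 1 F := (hf.comp (contMDiff_circlePoint b)).contDiff
  have hF0 : F 0 = f e := by
    have : circlePoint b 0 = e := Subtype.ext (by simp [circlePoint, hb])
    simp only [F, this]
  have hz : ∀ θ, Real.cos θ ≤ 0 → F θ = 0 := fun θ hθ => h0 _ (by
    rw [← hb, inner_circlePoint]; exact hθ)
  have hFm : ContDiff ℝ 1 (fun θ => F (-θ)) := hF.comp contDiff_neg
  have hpi := Real.pi_pos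
  have key : ∀ l : ℝ, ∫ q, spherePhase e l q * f q ∂(surface 2) =
      (∫ θ in (0)..(Real.pi / 2), Complex.exp (Complex.I * ((l * (1 - Real.cos θ) : ℝ) : ℂ)) * F θ) +
      ∫ θ in (0)..(Real.pi / 2), Complex.exp (Complex.I * ((l * (1 - Real.cos θ) : ℝ) : ℂ)) * F (-θ) := by
    intro l
    rw [integral_surface_two (continuous_spherePhase_mul hf.continuous e l) b]
    have e1 : ∀ θ, spherePhase e l (circlePoint b θ) * f (circlePoint b θ) =
        Complex.exp (Complex.I * ((l * (1 - Real.cos θ) : ℝ) : ℂ)) * F θ := by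
      intro θ
      rw [spherePhase, ← hb, inner_circlePoint]
    simp_rw [e1]
    set H : ℝ → ℂ := fun θ => Complex.exp (Complex.I * ((l * (1 - Real.cos θ) : ℝ) : ℂ)) * F θ
    have hHc : Continuous H := by have := hF.continuous; fun_prop
    have hi : ∀ a c, IntervalIntegrable H volume a c := fun a c => hHc.intervalIntegrable _ _
    have e2 : ∫ θ in (0)..(Real.pi / 2), Complex.exp (Complex.I * ((l * (1 - Real.cos θ) : ℝ) : ℂ)) * F (-θ) =
        ∫ θ in (-(Real.pi / 2))..0, H θ := by
      have := intervalIntegral.integral_comp_neg (a := 0) (b := Real.pi / 2) H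
      rw [neg_zero] at this
      rw [← this]
      simp only [H, Real.cos_neg]
    have e3 : ∫ θ in (-Real.pi)..(-(Real.pi / 2)), H θ = 0 := by
      rw [intervalIntegral.integral_congr (g := fun _ => 0), intervalIntegral.integral_zero]
      intro θ hθ
      rw [Set.uIcc_of_le (by linarith)] at hθ
      have : Real.cos θ ≤ 0 := by
        rw [← Real.cos_neg]
        exact Real.cos_nonpos_of_pi_div_two_le_of_le (by linarith [hθ.2]) (by linarith [hθ.1])
      simp only [H, hz θ this, mul_zero]
    have e4 : ∫ θ in (Real.pi / 2)..Real.pi, H θ = 0 := by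
      rw [intervalIntegral.integral_congr (g := fun _ => 0), intervalIntegral.integral_zero]
      intro θ hθ
      rw [Set.uIcc_of_le (by linarith)] at hθ
      have : Real.cos θ ≤ 0 :=
        Real.cos_nonpos_of_pi_div_two_le_of_le hθ.1 (by linarith [hθ.2])
      simp only [H, hz θ this, mul_zero]
    rw [e2, ← intervalIntegral.integral_add_adjacent_intervals (hi (-Real.pi) 0) (hi 0 Real.pi),
      ← intervalIntegral.integral_add_adjacent_intervals (hi (-Real.pi) (-(Real.pi / 2))) (hi _ 0),
      ← intervalIntegral.integral_add_adjacent_intervals (hi 0 (Real.pi / 2)) (hi _ Real.pi), e3, e4]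
    ring
  have h1 := tendsto_sqrt_mul_integral_exp_one_sub_cos hF
  have h2 := tendsto_sqrt_mul_integral_exp_one_sub_cos hFm
  have h3 := h1.add h2
  simp only [neg_zero, hF0] at h3
  convert h3 using 2
  · rw [key, mul_add]
  · ring

/-- The surface density `sin θ` makes the phase an exact derivative, so one integration by parts
gains the factor `1/l`. The endpoint `θ = 0` gives `i f(e)` for each azimuth, hence `2πi f(e)` in
total; the endpoint `π` drops out by `h0`, and the rest tends to zero by Riemann–Lebesgue. -/
theorem stationaryPhase_three {f : Sphere 3 → ℂ}
    (hf : ContMDiff (𝓡 (3 - 1)) 𝓘(ℝ, ℂ) ((3 - 1 : ℕ) : WithTop ℕ∞) f) (e : Sphere 3)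
    (h0 : f (-e) = 0) :
    Tendsto (fun l : ℝ => (l : ℂ) * ∫ q, spherePhase e l q * f q ∂(surface 3)) atTop
      (𝓝 (2 * Real.pi * Complex.I * f e)) := by
  obtain ⟨b, hb⟩ := exists_orthonormalBasis_zero e
  set F : ℝ × ℝ → ℂ := fun p => f (spherePoint b p.1 p.2)
  have hF2 : ContDiff ℝ ((3 - 1 : ℕ) : WithTop ℕ∞) F := (hf.comp (contMDiff_spherePoint b)).contDiff
  have hF : ContDiff ℝ 1 F := hF2.of_le (by norm_num)
  have hFs : ∀ φ, ContDiff ℝ 1 (fun θ => F (θ, φ)) := fun φ => hF.comp (contDiff_id.prodMk contDiff_const)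
  have hF0 : ∀ φ, F (0, φ) = f e := fun φ => by
    have : spherePoint b 0 φ = e := Subtype.ext (by simp [spherePoint, hb])
    simp only [F, this]
  have hFpi : ∀ φ, F (Real.pi, φ) = 0 := fun φ => by
    have : spherePoint b Real.pi φ = -e := Subtype.ext (by simp [spherePoint, hb])
    simp only [F, this, h0]
  have hder : ∀ θ φ, deriv (fun θ => F (θ, φ)) θ = fderiv ℝ F (θ, φ) (1, 0) := by
    intro θ φ
    have h1 : HasFDerivAt F (fderiv ℝ F (θ, φ)) (θ, φ) := (hF.differentiable one_ne_zero _).hasFDerivAt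
    have h2 : HasDerivAt (fun θ : ℝ => (θ, φ)) ((1 : ℝ), (0 : ℝ)) θ :=
      (hasDerivAt_id θ).prodMk (hasDerivAt_const θ φ)
    exact (h1.comp_hasDerivAt θ h2).deriv
  have hdc : Continuous (fun p : ℝ × ℝ => fderiv ℝ F p (1, 0)) :=
    (hF.continuous_fderiv one_ne_zero).clm_apply continuous_const
  -- This bound on the polar derivative dominates the inner integrals uniformly in the azimuth and
  -- in `l`.
  obtain ⟨M, hM⟩ := (isCompact_Icc.prod isCompact_Icc).exists_bound_of_continuousOn
    (s := Set.Icc (0 : ℝ) Real.pi ×ˢ Set.Icc (-Real.pi) Real.pi) hdc.continuousOn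
  have hpi := Real.pi_pos
  have key : ∀ l : ℝ, (l : ℂ) * ∫ q, spherePhase e l q * f q ∂(surface 3) =
      ∫ φ in (-Real.pi)..Real.pi, Complex.I * (f e + ∫ θ in (0)..Real.pi,
        Complex.exp (Complex.I * ((l * (1 - Real.cos θ) : ℝ) : ℂ)) * fderiv ℝ F (θ, φ) (1, 0)) := by
    intro l
    rw [integral_surface_three (continuous_spherePhase_mul hf.continuous e l) b,
      ← intervalIntegral.integral_const_mul]
    refine intervalIntegral.integral_congr fun φ _ => ?_
    have h1 := integral_exp_one_sub_cos_sin (hFs φ) (hFpi φ) l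
    simp_rw [hder] at h1
    rw [hF0] at h1
    rw [← h1]
    congr 1
    refine intervalIntegral.integral_congr fun θ _ => ?_
    simp only [spherePhase, F]
    rw [← hb, inner_spherePoint]
    ring
  have hlim : Tendsto (fun l : ℝ => ∫ φ in (-Real.pi)..Real.pi, Complex.I * (f e + ∫ θ in (0)..Real.pi,
        Complex.exp (Complex.I * ((l * (1 - Real.cos θ) : ℝ) : ℂ)) * fderiv ℝ F (θ, φ) (1, 0))) atTop
      (𝓝 (∫ φ in (-Real.pi)..Real.pi, Complex.I * (f e + 0))) := by
    refine intervalIntegral.tendsto_integral_filter_of_dominated_convergence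
      (fun _ => ‖f e‖ + M * |Real.pi - 0|) ?_ ?_ intervalIntegrable_const ?_
    · refine Eventually.of_forall fun l => Continuous.aestronglyMeasurable ?_
      refine continuous_const.mul (continuous_const.add ?_)
      refine intervalIntegral.continuous_parametric_intervalIntegral_of_continuous' ?_ _ _
      have : Continuous (fun p : ℝ × ℝ => fderiv ℝ F (p.2, p.1) (1, 0)) := hdc.comp continuous_swap
      simp only [Function.uncurry_def]
      fun_prop
    · refine Eventually.of_forall fun l => Eventually.of_forall fun φ hφ => ?_
      rw [Set.uIoc_of_le (by linarith)] at hφ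
      rw [norm_mul, Complex.norm_I, one_mul]
      refine (norm_add_le _ _).trans (add_le_add_right ?_ _)
      refine intervalIntegral.norm_integral_le_of_norm_le_const fun θ hθ => ?_
      rw [Set.uIoc_of_le hpi.le] at hθ
      rw [norm_mul, norm_exp_I_mul_ofReal_eq_one, one_mul]
      exact hM (θ, φ) ⟨⟨hθ.1.le, hθ.2⟩, hφ.1.le, hφ.2⟩
    · refine Eventually.of_forall fun φ _ => ?_
      exact (tendsto_const_nhds.add tendsto_integral_exp_one_sub_cos).const_mul _
  simp_rw [key]
  convert hlim using 2
  rw [intervalIntegral.integral_const, add_zero, Complex.real_smul]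
  push_cast; ring

/-- The Riemann–Lebesgue lemma on `S²` for a linear phase. -/
theorem tendsto_integral_spherePhase_three {g : Sphere 3 → ℂ} (hg : Continuous g) (e : Sphere 3) :
    Tendsto (fun l : ℝ => ∫ q, spherePhase e l q * g q ∂(surface 3)) atTop (𝓝 0) := by
  obtain ⟨b, hb⟩ := exists_orthonormalBasis_zero e
  obtain ⟨M, hM0, hM⟩ := exists_norm_le_of_continuous hg
  have hgc : Continuous (fun p : ℝ × ℝ => g (spherePoint b p.1 p.2)) := hg.comp (continuous_spherePoint b)
  have hpi := Real.pi_pos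
  have key : ∀ l : ℝ, ∫ q, spherePhase e l q * g q ∂(surface 3) =
      ∫ φ in (-Real.pi)..Real.pi, ∫ θ in (0)..Real.pi,
        Complex.exp (Complex.I * ((l * (1 - Real.cos θ) : ℝ) : ℂ)) *
          (Real.sin θ * g (spherePoint b θ φ)) := by
    intro l
    rw [integral_surface_three (continuous_spherePhase_mul hg e l) b]
    refine intervalIntegral.integral_congr fun φ _ => intervalIntegral.integral_congr fun θ _ => ?_
    simp only [spherePhase]
    rw [← hb, inner_spherePoint]
    ring
  simp_rw [key]
  -- Here `sin θ` stays in the amplitude: no rate is needed, only that each inner integral tends to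
  -- zero.
  set G : ℝ × ℝ → ℂ := fun p => Real.sin p.1 * g (spherePoint b p.1 p.2)
  have hG : Continuous G :=
    (Complex.continuous_ofReal.comp (Real.continuous_sin.comp continuous_fst)).mul hgc
  have hGb : ∀ p, ‖G p‖ ≤ M := by
    intro p
    rw [norm_mul, Complex.norm_real, Real.norm_eq_abs]
    calc |Real.sin p.1| * ‖g (spherePoint b p.1 p.2)‖ ≤ 1 * M :=
          mul_le_mul (Real.abs_sin_le_one _) (hM _) (norm_nonneg _) zero_le_one
      _ = M := one_mul M
  have hlim : Tendsto (fun l : ℝ => ∫ φ in (-Real.pi)..Real.pi, ∫ θ in (0)..Real.pi,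
        Complex.exp (Complex.I * ((l * (1 - Real.cos θ) : ℝ) : ℂ)) * G (θ, φ)) atTop
        (𝓝 (∫ φ in (-Real.pi)..Real.pi, (0 : ℂ))) := by
    refine intervalIntegral.tendsto_integral_filter_of_dominated_convergence
      (fun _ => M * |Real.pi - 0|) ?_ ?_ intervalIntegrable_const ?_
    · refine Eventually.of_forall fun l => Continuous.aestronglyMeasurable ?_
      refine intervalIntegral.continuous_parametric_intervalIntegral_of_continuous' ?_ _ _
      have : Continuous (fun p : ℝ × ℝ => G (p.2, p.1)) := hG.comp continuous_swap
      simp only [Function.uncurry_def]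
      fun_prop
    · refine Eventually.of_forall fun l => Eventually.of_forall fun φ hφ => ?_
      refine intervalIntegral.norm_integral_le_of_norm_le_const fun θ hθ => ?_
      rw [norm_mul, norm_exp_I_mul_ofReal_eq_one, one_mul]
      exact hGb _
    · exact Eventually.of_forall fun φ _ => tendsto_integral_exp_one_sub_cos
  rw [intervalIntegral.integral_zero] at hlim
  exact hlim

/-- Leading-order stationary phase on `S^{d-1}`, `d ≤ 3`, for amplitudes supported in the half
sphere around the stationary point `e`. -/
theorem stationaryPhase {d : ℕ} [NeZero d] (hd : d ∈ ({1, 2, 3} : Set ℕ)) {f : Sphere d → ℂ}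
    (hf : ContMDiff (𝓡 (d - 1)) 𝓘(ℝ, ℂ) ((d - 1 : ℕ) : WithTop ℕ∞) f) (e : Sphere d)
    (h0 : ∀ q : Sphere d, ⟪(e : Space d), (q : Space d)⟫ ≤ 0 → f q = 0) :
    Tendsto (fun l : ℝ => ((l ^ (((d : ℝ) - 1) / 2) : ℝ) : ℂ) *
      ∫ q, spherePhase e l q * f q ∂(surface d)) atTop
      (𝓝 ((2 * Real.pi * Complex.I) ^ (((d : ℂ) - 1) / 2) * f e)) := by
  have hneg : f (-e) = 0 := h0 _ (by
    rw [show ((-e : Sphere d) : Space d) = -(e : Space d) from rfl, inner_neg_right, inner_self_sphere]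
    norm_num)
  rcases hd with rfl | rfl | rfl
  · simp_rw [stationaryPhase_one hf.continuous e hneg]
    simp
  · have := stationaryPhase_two hf e h0
    convert this using 2 with l
    · rw [Real.sqrt_eq_rpow]; norm_num
    · norm_num
  · have := stationaryPhase_three hf e hneg
    convert this using 2 with l
    · norm_num
    · norm_num

/-! ### Expanding shells and the expansion of their Jacobian weight. -/

/-- The shell of radius and half-width `N` carrying the profile `V`. -/
def shellProfile {d : ℕ} (N : ℝ) (V : ℝ → Sphere d → ℂ) (x : Space d) : ℂ :=
  (1 / (N ^ (((d : ℝ) - 1) / 2) : ℝ) : ℂ) * (if ‖x‖ < 2 * N then 1 else 0)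
    * radialExtension (V (‖x‖ - N)) x

/-- At `t = τ/ε²` the slow time is exactly `τ`, so `ε` survives only in the radius and the profile
stays fixed as the shell expands. -/
theorem shell_eq_shellProfile {d : ℕ} {c ε τ : ℝ} (hε : ε ≠ 0) (V : ℝ → Sphere d → ℝ → ℂ)
    (x : Space d) :
    shell c ε V x (τ / ε ^ 2) = shellProfile (c * τ / ε ^ 2) (fun z q => V z q τ) x := by
  have h1 : ε ^ 2 * (τ / ε ^ 2) = τ := by field_simp
  have h2 : 2 * c * (τ / ε ^ 2) = 2 * (c * τ / ε ^ 2) := by ring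
  have h3 : c * (τ / ε ^ 2) = c * τ / ε ^ 2 := by ring
  unfold shell shellProfile radialExtension
  rw [h1, h2, h3]
  split_ifs <;> simp

theorem measurable_shellProfile {d : ℕ} (N : ℝ) {V : ℝ → Sphere d → ℂ}
    (hV : Measurable (Function.uncurry V)) : Measurable (shellProfile N V) := by
  unfold shellProfile
  refine Measurable.mul (measurable_const.mul (Measurable.ite ?_ measurable_const measurable_const)) ?_
  · exact measurableSet_lt measurable_norm measurable_const
  · exact (measurable_radialExtension_prod hV).comp
      ((measurable_norm.sub_const N).prodMk measurable_id)

theorem shellProfile_eq_indicator {d : ℕ} (N : ℝ) (V : ℝ → Sphere d → ℂ) :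
    shellProfile N V = (Metric.ball (0 : Space d) (2 * N)).indicator (shellProfile N V) := by
  funext x
  by_cases hx : x ∈ Metric.ball (0 : Space d) (2 * N)
  · rw [Set.indicator_of_mem hx]
  · rw [Set.indicator_of_notMem hx]
    rw [mem_ball_zero_iff] at hx
    simp [shellProfile, hx]

theorem norm_shellProfile_le {d : ℕ} (N : ℝ) {V : ℝ → Sphere d → ℂ} {K : ℝ}
    (hV : ∀ z q, ‖V z q‖ ≤ K) (hK : 0 ≤ K) (x : Space d) :
    ‖shellProfile N V x‖ ≤ ‖(1 / (N ^ (((d : ℝ) - 1) / 2) : ℝ) : ℂ)‖ * K := by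
  unfold shellProfile
  rw [norm_mul, norm_mul]
  have h1 : ‖(if ‖x‖ < 2 * N then 1 else 0 : ℂ)‖ ≤ 1 := by split_ifs <;> simp
  have h2 := norm_radialExtension_le hK (hV (‖x‖ - N)) x
  calc _ ≤ ‖(1 / (N ^ (((d : ℝ) - 1) / 2) : ℝ) : ℂ)‖ * 1 * K := by gcongr
    _ = _ := by ring

theorem memLp_shellProfile {d : ℕ} (N : ℝ) {V : ℝ → Sphere d → ℂ}
    (hVm : Measurable (Function.uncurry V)) {K : ℝ} (hV : ∀ z q, ‖V z q‖ ≤ K) (hK : 0 ≤ K)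
    (p : ENNReal) : MemLp (shellProfile N V) p := by
  rw [shellProfile_eq_indicator, memLp_indicator_iff_restrict measurableSet_ball]
  have : IsFiniteMeasure (volume.restrict (Metric.ball (0 : Space d) (2 * N))) :=
    ⟨by rw [Measure.restrict_apply_univ]; exact measure_ball_lt_top⟩
  exact MemLp.of_bound (measurable_shellProfile N hVm).aestronglyMeasurable _
    (Eventually.of_forall fun x => norm_shellProfile_le N hV hK x)

theorem integrable_shellProfile {d : ℕ} (N : ℝ) {V : ℝ → Sphere d → ℂ}
    (hVm : Measurable (Function.uncurry V)) {K : ℝ} (hV : ∀ z q, ‖V z q‖ ≤ K) (hK : 0 ≤ K) :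
    Integrable (shellProfile N V) :=
  memLp_one_iff_integrable.1 (memLp_shellProfile N hVm hV hK 1)

theorem shellProfile_smul {d : ℕ} (N : ℝ) (V : ℝ → Sphere d → ℂ) {r : ℝ} (hr : 0 < r) (q : Sphere d) :
    shellProfile N V (r • (q : Space d)) =
      (1 / (N ^ (((d : ℝ) - 1) / 2) : ℝ) : ℂ) * (if r < 2 * N then 1 else 0) * V (r - N) q := by
  have hn : ‖r • (q : Space d)‖ = r := by
    rw [norm_smul, norm_eq_of_mem_sphere, mul_one, Real.norm_eq_abs, abs_of_pos hr]
  unfold shellProfile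
  rw [hn, radialExtension_smul _ hr]

/-- The Jacobian weight of the shell in the variable `z = |x| - N`. -/
def shellWeight (d : ℕ) (N z : ℝ) : ℝ :=
  N ^ (((d : ℝ) - 1) / 2) * (1 + z / N) ^ (d - 1) * (if |z| < N then 1 else 0)

theorem measurable_shellWeight (d : ℕ) (N : ℝ) : Measurable (shellWeight d N) := by
  unfold shellWeight
  refine Measurable.mul (by fun_prop) (Measurable.ite ?_ measurable_const measurable_const)
  exact measurableSet_lt (by fun_prop) measurable_const

/-- The next-to-leading term of the weight, which does not vanish in dimension three. -/
def weightCorrection (d : ℕ) (z : ℝ) : ℝ := if d = 3 then 2 * z else 0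

/-- For `|z| < N` the remainder is `0`, `z/√N` or `z²/N` according to the dimension. For `|z| ≥ N`
the weight is cut off, and the subtracted terms are controlled through `N ≤ |z|`. The bound is
uniform in `N ≥ 1`, as dominated convergence requires. -/
theorem abs_shellWeight_sub_le {d : ℕ} (hd : d ∈ ({1, 2, 3} : Set ℕ)) {N : ℝ} (hN : 1 ≤ N) (z : ℝ) :
    |shellWeight d N z - N ^ (((d : ℝ) - 1) / 2) - weightCorrection d z| ≤ 3 * (1 + |z|) ^ (d - 1) := by
  have hN0 : 0 < N := by linarith
  have hz := abs_nonneg z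
  unfold shellWeight weightCorrection
  rcases hd with rfl | rfl | rfl
  · split_ifs <;> simp_all
  · have e : N ^ ((((2 : ℕ) : ℝ) - 1) / 2) = √N := by rw [Real.sqrt_eq_rpow]; norm_num
    rw [e]
    have h1 : 1 ≤ √N := Real.one_le_sqrt.2 hN
    have h2 : √N * √N = N := Real.mul_self_sqrt hN0.le
    simp only [Nat.add_one_sub_one, pow_one, show (2 : ℕ) ≠ 3 by norm_num, if_false, sub_zero]
    by_cases h : |z| < N
    · rw [if_pos h]
      have : √N * (1 + z / N) * 1 - √N = z / √N := by
        have : √N ≠ 0 := by positivity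
        field_simp
        rw [Real.sq_sqrt hN0.le]
        ring
      rw [this, abs_div, abs_of_pos (by positivity : 0 < √N)]
      have : |z| / √N ≤ |z| := div_le_self hz h1
      linarith
    · rw [if_neg h, mul_zero, zero_sub, abs_neg, abs_of_pos (by positivity)]
      have : √N ≤ N := by nlinarith
      linarith [not_lt.1 h]
  · have e : N ^ ((((3 : ℕ) : ℝ) - 1) / 2) = N := by norm_num
    rw [e]
    simp only [if_true, show 3 - 1 = 2 by norm_num]
    by_cases h : |z| < N
    · rw [if_pos h]
      have : N * (1 + z / N) ^ 2 * 1 - N - 2 * z = z ^ 2 / N := by field_simp; ring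
      rw [this, abs_div, abs_of_pos hN0, abs_pow]
      have : |z| ^ 2 / N ≤ |z| ^ 2 := div_le_self (by positivity) hN
      nlinarith
    · rw [if_neg h, mul_zero, zero_sub]
      have h1 : |(-N - 2 * z)| ≤ N + 2 * |z| := by
        refine (abs_sub _ _).trans ?_
        rw [abs_neg, abs_of_pos hN0, abs_mul, abs_two]
      nlinarith [not_lt.1 h]

theorem tendsto_shellWeight_sub {d : ℕ} (hd : d ∈ ({1, 2, 3} : Set ℕ)) (z : ℝ) :
    Tendsto (fun N : ℝ => shellWeight d N z - N ^ (((d : ℝ) - 1) / 2) - weightCorrection d z)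
      atTop (𝓝 0) := by
  unfold shellWeight weightCorrection
  rcases hd with rfl | rfl | rfl
  · refine tendsto_const_nhds.congr' ?_
    filter_upwards [eventually_gt_atTop |z|] with N hN
    simp [hN]
  · have h := (Real.tendsto_sqrt_atTop.inv_tendsto_atTop).const_mul z
    rw [mul_zero] at h
    refine h.congr' ?_
    filter_upwards [eventually_gt_atTop |z|, eventually_gt_atTop 0] with N hN hN0
    have e : N ^ ((((2 : ℕ) : ℝ) - 1) / 2) = √N := by rw [Real.sqrt_eq_rpow]; norm_num
    rw [e, if_pos hN]
    have : √N ≠ 0 := by positivity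
    simp
    field_simp
    rw [Real.sq_sqrt hN0.le]
    ring
  · have h := tendsto_inv_atTop_zero.const_mul (z ^ 2)
    rw [mul_zero] at h
    refine h.congr' ?_
    filter_upwards [eventually_gt_atTop |z|, eventually_gt_atTop 0] with N hN hN0
    have e : N ^ ((((3 : ℕ) : ℝ) - 1) / 2) = N := by norm_num
    rw [e, if_pos hN]
    simp only [if_true, show 3 - 1 = 2 by norm_num]
    field_simp
    ring

/-! ### Decaying profiles, their moments, and the shell transform in polar form. -/

/-- A continuous family of profiles with integrable weighted decay. -/
structure IsDecayingProfile {d : ℕ} (V : ℝ → Sphere d → ℂ) (C α : ℝ) : Prop where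
  continuous : Continuous (Function.uncurry V)
  pos : 0 < α
  nonneg : 0 ≤ C
  decay : ∀ z q, ‖V z q‖ ≤ C * (1 + |z|) ^ (-(d : ℝ) - α)

theorem IsDecayingProfile.norm_le {d : ℕ} {V : ℝ → Sphere d → ℂ} {C α : ℝ}
    (h : IsDecayingProfile V C α) (z : ℝ) (q : Sphere d) : ‖V z q‖ ≤ C := by
  refine (h.decay z q).trans ?_
  have h1 : (1 + |z|) ^ (-(d : ℝ) - α) ≤ 1 :=
    Real.rpow_le_one_of_one_le_of_nonpos (by linarith [abs_nonneg z])
      (by have := h.pos; have : (0 : ℝ) ≤ d := Nat.cast_nonneg d; linarith)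
  calc _ ≤ C * 1 := mul_le_mul_of_nonneg_left h1 h.nonneg
    _ = C := mul_one C

/-- The decay exponent `d + α` exceeds the growth `d - 1` of the weights by `1 + α`, just enough for
integrability on the line. -/
theorem one_add_pow_mul_rpow {d : ℕ} [NeZero d] (α z : ℝ) :
    (1 + |z|) ^ (d - 1) * (1 + |z|) ^ (-(d : ℝ) - α) = (1 + ‖z‖) ^ (-(1 + α)) := by
  have hpos : 0 < 1 + |z| := by linarith [abs_nonneg z]
  have hd : 1 ≤ d := Nat.one_le_iff_ne_zero.2 (NeZero.ne d)
  rw [← Real.rpow_natCast, ← Real.rpow_add hpos, Real.norm_eq_abs]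
  congr 1
  push_cast [hd]; ring

theorem integrable_decay {α : ℝ} (hα : 0 < α) :
    Integrable (fun z : ℝ => (1 + ‖z‖) ^ (-(1 + α))) :=
  integrable_one_add_norm (by simp; linarith)

/-- The weighted partial Fourier integral `∫ A(z) V(z,q) e^{-iz k·q} dz`. -/
def moment {d : ℕ} (V : ℝ → Sphere d → ℂ) (k : Space d) (A : ℝ → ℝ) (q : Sphere d) : ℂ :=
  ∫ z : ℝ, (A z : ℂ) * (V z q * Complex.exp (-Complex.I * (z * (⟪k, (q : Space d)⟫ : ℝ))))

theorem norm_exp_phase (z s : ℝ) : ‖Complex.exp (-Complex.I * ((z : ℂ) * (s : ℂ)))‖ = 1 := by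
  have : -Complex.I * ((z : ℂ) * (s : ℂ)) = Complex.I * ((-(z * s) : ℝ) : ℂ) := by push_cast; ring
  rw [this, norm_exp_I_mul_ofReal_eq_one]

theorem IsDecayingProfile.norm_moment_integrand_le {d : ℕ} {V : ℝ → Sphere d → ℂ} {C α : ℝ}
    (h : IsDecayingProfile V C α) (k : Space d) (A : ℝ → ℝ) (z : ℝ) (q : Sphere d) :
    ‖(A z : ℂ) * (V z q * Complex.exp (-Complex.I * (z * (⟪k, (q : Space d)⟫ : ℝ))))‖ ≤
      |A z| * (C * (1 + |z|) ^ (-(d : ℝ) - α)) := by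
  rw [norm_mul, norm_mul, norm_exp_phase, mul_one, Complex.norm_real, Real.norm_eq_abs]
  exact mul_le_mul_of_nonneg_left (h.decay z q) (abs_nonneg _)

theorem IsDecayingProfile.integrable_weight {d : ℕ} [NeZero d] {V : ℝ → Sphere d → ℂ} {C α : ℝ}
    (h : IsDecayingProfile V C α) {A : ℝ → ℝ} (hA : Measurable A) {K : ℝ}
    (hK : ∀ z, |A z| ≤ K * (1 + |z|) ^ (d - 1)) :
    Integrable (fun z => |A z| * (C * (1 + |z|) ^ (-(d : ℝ) - α))) := by
  refine Integrable.mono' ((integrable_decay h.pos).const_mul (K * C)) ?_ (Eventually.of_forall fun z => ?_)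
  · exact (hA.norm.mul (measurable_const.mul ((measurable_const.add measurable_norm).pow_const _))).aestronglyMeasurable
  · have hp : 0 ≤ (1 + |z|) ^ (-(d : ℝ) - α) := Real.rpow_nonneg (by linarith [abs_nonneg z]) _
    rw [Real.norm_eq_abs, abs_of_nonneg (mul_nonneg (abs_nonneg _) (mul_nonneg h.nonneg hp)),
      ← one_add_pow_mul_rpow (d := d)]
    calc _ ≤ (K * (1 + |z|) ^ (d - 1)) * (C * (1 + |z|) ^ (-(d : ℝ) - α)) :=
          mul_le_mul_of_nonneg_right (hK z) (mul_nonneg h.nonneg hp)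
      _ = _ := by ring

theorem IsDecayingProfile.integrable_moment {d : ℕ} [NeZero d] {V : ℝ → Sphere d → ℂ} {C α : ℝ}
    (h : IsDecayingProfile V C α) (k : Space d) {A : ℝ → ℝ} (hA : Measurable A) {K : ℝ}
    (hK : ∀ z, |A z| ≤ K * (1 + |z|) ^ (d - 1)) (q : Sphere d) :
    Integrable (fun z : ℝ => (A z : ℂ) *
      (V z q * Complex.exp (-Complex.I * (z * (⟪k, (q : Space d)⟫ : ℝ))))) := by
  refine Integrable.mono' (h.integrable_weight hA hK) ?_
    (Eventually.of_forall fun z => h.norm_moment_integrand_le k A z q)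
  have : Continuous (fun z => V z q) := h.continuous.comp (by fun_prop : Continuous fun z : ℝ => (z, q))
  exact (hA.complex_ofReal.mul (Measurable.mul this.measurable (by fun_prop))).aestronglyMeasurable

theorem IsDecayingProfile.continuous_moment {d : ℕ} [NeZero d] {V : ℝ → Sphere d → ℂ} {C α : ℝ}
    (h : IsDecayingProfile V C α) (k : Space d) {A : ℝ → ℝ} (hA : Measurable A) {K : ℝ}
    (hK : ∀ z, |A z| ≤ K * (1 + |z|) ^ (d - 1)) : Continuous (moment V k A) := by
  refine continuous_of_dominated (fun q => (h.integrable_moment k hA hK q).aestronglyMeasurable)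
    (fun q => Eventually.of_forall fun z => h.norm_moment_integrand_le k A z q)
    (h.integrable_weight hA hK) (Eventually.of_forall fun z => ?_)
  have : Continuous (fun q => V z q) := h.continuous.comp (by fun_prop : Continuous fun q : Sphere d => (z, q))
  fun_prop

theorem IsDecayingProfile.norm_moment_le {d : ℕ} [NeZero d] {V : ℝ → Sphere d → ℂ} {C α : ℝ}
    (h : IsDecayingProfile V C α) (k : Space d) {A : ℝ → ℝ} (hA : Measurable A) {K : ℝ}
    (hK : ∀ z, |A z| ≤ K * (1 + |z|) ^ (d - 1)) (q : Sphere d) :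
    ‖moment V k A q‖ ≤ ∫ z : ℝ, |A z| * (C * (1 + |z|) ^ (-(d : ℝ) - α)) :=
  norm_integral_le_of_norm_le (h.integrable_weight hA hK)
    (Eventually.of_forall fun z => h.norm_moment_integrand_le k A z q)

theorem rpow_half_mul_self {d : ℕ} [NeZero d] {N : ℝ} (hN : 0 < N) :
    N ^ (((d : ℝ) - 1) / 2) * N ^ (((d : ℝ) - 1) / 2) = N ^ (d - 1) := by
  have hd : 1 ≤ d := Nat.one_le_iff_ne_zero.2 (NeZero.ne d)
  rw [← Real.rpow_add hN, add_halves, ← Real.rpow_natCast]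
  congr 1
  push_cast [hd]; ring

/-- The Fourier transform of a shell in polar coordinates centred at the shell radius. -/
theorem fourierSpace_shellProfile {d : ℕ} [NeZero d] {V : ℝ → Sphere d → ℂ} {K : ℝ}
    (hV : Measurable (Function.uncurry V)) (hK0 : 0 ≤ K) (hK : ∀ z q, ‖V z q‖ ≤ K)
    {N : ℝ} (hN : 0 < N) (k : Space d) :
    fourierSpace (shellProfile N V) k = ∫ q : Sphere d,
      Complex.exp (-Complex.I * (N * (⟪k, (q : Space d)⟫ : ℝ))) * moment V k (shellWeight d N) q
        ∂(surface d) := by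
  have hint : Integrable (fun x : Space d =>
      shellProfile N V x * Complex.exp (-Complex.I * (⟪k, x⟫ : ℝ))) := by
    refine (integrable_shellProfile N hV hK hK0).mul_bdd (c := 1)
      (Continuous.aestronglyMeasurable (by fun_prop)) (Eventually.of_forall fun x => ?_)
    have := norm_exp_phase 1 ⟪k, x⟫
    rw [Complex.ofReal_one, one_mul] at this
    exact this.le
  rw [fourierSpace, integral_polar hint]
  refine integral_congr_ae (Eventually.of_forall fun q => ?_)
  have hNa : (0 : ℝ) < N ^ (((d : ℝ) - 1) / 2) := Real.rpow_pos_of_pos hN _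
  set s : ℝ := ⟪k, (q : Space d)⟫
  set H : ℝ → ℂ := fun z => (shellWeight d N z : ℂ) * (V z q * Complex.exp (-Complex.I * (z * (s : ℝ))))
  -- With `r = N + z`, Jacobian and amplitude combine to `N^{(d-1)/2} (1 + z/N)^{d-1}`; as `r > 0`,
  -- the cutoff `r < 2N` is the symmetric condition `|z| < N`.
  have e1 : ∀ r ∈ Set.Ioi (0 : ℝ), ((r ^ (d - 1) : ℝ) : ℂ) * (shellProfile N V (r • (q : Space d)) *
      Complex.exp (-Complex.I * (⟪k, r • (q : Space d)⟫ : ℝ))) =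
      Complex.exp (-Complex.I * (N * s)) * H (r - N) := by
    intro r hr
    have hr' : 0 < r := hr
    rw [shellProfile_smul N V hr', real_inner_smul_right]
    simp only [H, shellWeight]
    have h1 : |r - N| < N ↔ r < 2 * N := by
      rw [abs_lt]; constructor
      · rintro ⟨_, h⟩; linarith
      · intro h; constructor <;> linarith
    by_cases h : r < 2 * N
    · rw [if_pos h, if_pos (h1.2 h)]
      have h2 : (1 + (r - N) / N) = r / N := by field_simp; ring
      have h3 : Complex.exp (-Complex.I * ((r * s : ℝ) : ℂ)) =
          Complex.exp (-Complex.I * (N * s)) * Complex.exp (-Complex.I * (((r - N : ℝ) : ℂ) * s)) := by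
        rw [← Complex.exp_add]; congr 1; push_cast; ring
      rw [h2, h3, div_pow, ← rpow_half_mul_self hN]
      have h4 : ((N ^ (((d : ℝ) - 1) / 2) : ℝ) : ℂ) ≠ 0 := by exact_mod_cast hNa.ne'
      push_cast
      field_simp
    · rw [if_neg h, if_neg (fun hh => h (h1.1 hh))]
      simp
  -- The weight vanishes to the left of `-N`, so the half-line integral extends to the whole line.
  have hH : ∀ z, z ≤ -N → H z = 0 := by
    intro z hz
    have : ¬ |z| < N := by rw [abs_of_nonpos (by linarith)]; linarith
    simp [H, shellWeight, this]
  have e2 : ∫ r in Set.Ioi (0 : ℝ), H (r - N) = ∫ z, H z := by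
    rw [← integral_indicator measurableSet_Ioi]
    have : ∀ r : ℝ, (Set.Ioi (0 : ℝ)).indicator (fun r => H (r - N)) r = H (r - N) := by
      intro r
      by_cases hr : r ∈ Set.Ioi (0 : ℝ)
      · rw [Set.indicator_of_mem hr]
      · rw [Set.indicator_of_notMem hr, hH]
        have : r ≤ 0 := not_lt.1 hr
        linarith
    simp_rw [this]
    exact integral_sub_right_eq_self H N
  simp only []
  rw [setIntegral_congr_fun measurableSet_Ioi e1, integral_const_mul, e2]
  rfl

/-! ### Spectral profiles and the pointwise limit of shell transforms. -/

/-- A `C^{d-1}` spectral profile, supported in `0 < ξ < M`. -/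
structure IsSpectralProfile {d : ℕ} [NeZero d] (v : ℝ → Sphere d → ℂ) (M : ℝ) : Prop where
  contMDiff : ContMDiff (𝓘(ℝ, ℝ).prod (𝓡 (d - 1))) 𝓘(ℝ, ℂ) ((d - 1 : ℕ) : WithTop ℕ∞)
    (fun p : ℝ × Sphere d => v p.1 p.2)
  eq_zero_of_nonpos : ∀ ξ q, ξ ≤ 0 → v ξ q = 0
  eq_zero_of_ge : ∀ ξ q, M ≤ ξ → v ξ q = 0

namespace IsSpectralProfile

variable {d : ℕ} [NeZero d] {v : ℝ → Sphere d → ℂ} {M : ℝ}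

theorem continuous (h : IsSpectralProfile v M) : Continuous (fun p : ℝ × Sphere d => v p.1 p.2) :=
  h.contMDiff.continuous

theorem continuous_left (h : IsSpectralProfile v M) (q : Sphere d) : Continuous (fun ξ => v ξ q) :=
  h.continuous.comp (by fun_prop : Continuous fun ξ : ℝ => (ξ, q))

theorem hasCompactSupport (h : IsSpectralProfile v M) (q : Sphere d) :
    HasCompactSupport (fun ξ => v ξ q) := by
  refine HasCompactSupport.intro (isCompact_Icc (a := 0) (b := M)) fun ξ hξ => ?_
  by_contra hne
  refine hξ ⟨?_, ?_⟩
  · by_contra hlt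
    exact hne (h.eq_zero_of_nonpos ξ q (not_le.1 hlt).le)
  · by_contra hlt
    exact hne (h.eq_zero_of_ge ξ q (not_le.1 hlt).le)

theorem integrable (h : IsSpectralProfile v M) (q : Sphere d) : Integrable (fun ξ => v ξ q) :=
  (h.continuous_left q).integrable_of_hasCompactSupport (h.hasCompactSupport q)

/-- The support in `ξ` is uniformly bounded, so this is a parametric integral over a fixed interval;
`max M 0` covers negative `M`. -/
theorem continuous_fourierInv (h : IsSpectralProfile v M) :
    Continuous (fun p : ℝ × Sphere d => fourierInvLine (fun ξ => v ξ p.2) p.1) := by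
  have e : (fun p : ℝ × Sphere d => fourierInvLine (fun ξ => v ξ p.2) p.1) = fun p =>
      (1 / (2 * Real.pi) : ℂ) * ∫ ξ in (0)..(max M 0), Complex.exp (Complex.I * (p.1 * ξ)) * v ξ p.2 := by
    funext p
    rw [fourierInvLine, intervalIntegral.integral_of_le (le_max_right _ _), setIntegral_eq_integral_of_forall_compl_eq_zero]
    intro ξ hξ
    have : v ξ p.2 = 0 := by
      by_contra hne
      refine hξ ⟨?_, ?_⟩
      · by_contra hlt
        exact hne (h.eq_zero_of_nonpos ξ _ (not_lt.1 hlt))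
      · by_contra hlt
        exact hne (h.eq_zero_of_ge ξ _ ((le_max_left _ _).trans (not_le.1 hlt).le))
    rw [this, mul_zero]
  rw [e]
  refine continuous_const.mul (intervalIntegral.continuous_parametric_intervalIntegral_of_continuous' ?_ _ _)
  have : Continuous (fun p : (ℝ × Sphere d) × ℝ => v p.2 p.1.2) :=
    h.continuous.comp (by fun_prop : Continuous fun p : (ℝ × Sphere d) × ℝ => (p.2, p.1.2))
  simp only [Function.uncurry_def]
  exact Continuous.mul (by fun_prop) this

end IsSpectralProfile

/-- Pointwise convergence of the Fourier transform of an expanding shell. -/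
theorem tendsto_fourierSpace_shellProfile {d : ℕ} [NeZero d] (hd : d ∈ ({1, 2, 3} : Set ℕ))
    {v : ℝ → Sphere d → ℂ} {M : ℝ} (hv : IsSpectralProfile v M) {C α : ℝ} (hC : 0 ≤ C) (hα : 0 < α)
    (hdecay : ∀ z q, ‖fourierInvLine (fun ξ => v ξ q) z‖ ≤ C * (1 + |z|) ^ (-(d : ℝ) - α))
    (k : Space d) (hk : k ≠ 0) :
    Tendsto (fun N : ℝ => fourierSpace (shellProfile N fun z q => fourierInvLine (fun ξ => v ξ q) z) k *
      Complex.exp (Complex.I * ((N * ‖k‖ : ℝ) : ℂ))) atTop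
      (𝓝 (((‖k‖ ^ (((d : ℝ) - 1) / 2) : ℝ) : ℂ)⁻¹ *
        ((2 * Real.pi * Complex.I) ^ (((d : ℂ) - 1) / 2) * v ‖k‖ (direction k hk)))) := by
  set V : ℝ → Sphere d → ℂ := fun z q => fourierInvLine (fun ξ => v ξ q) z with hVdef
  have hV : IsDecayingProfile V C α := ⟨hv.continuous_fourierInv, hα, hC, hdecay⟩
  have hk0 : 0 < ‖k‖ := norm_pos_iff.2 hk
  set e : Sphere d := direction k hk
  have hke : k = ‖k‖ • (e : Space d) := by
    simp only [e, direction, smul_smul, mul_inv_cancel₀ hk0.ne', one_smul]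
  have hinner : ∀ q : Sphere d, ⟪k, (q : Space d)⟫ = ‖k‖ * ⟪(e : Space d), (q : Space d)⟫ := by
    intro q
    conv_lhs => rw [hke]
    rw [real_inner_smul_left]
  have h1z : ∀ z : ℝ, 1 ≤ (1 + |z|) ^ (d - 1) := fun z => one_le_pow₀ (by linarith [abs_nonneg z])
  -- the amplitude of the leading term
  set f : Sphere d → ℂ := fun q => v ⟪k, (q : Space d)⟫ q
  have hone : ∀ z : ℝ, |(fun _ : ℝ => (1 : ℝ)) z| ≤ 1 * (1 + |z|) ^ (d - 1) := fun z => by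
    simpa using h1z z
  -- Fourier inversion in `z` at the frequency `k·q`; the decay supplies the integrability it needs.
  have hf1 : ∀ q, moment V k (fun _ => 1) q = f q := by
    intro q
    have hVi : Integrable (fourierInvLine fun ξ => v ξ q) := by
      refine Integrable.mono' (hV.integrable_weight measurable_const hone) ?_
        (Eventually.of_forall fun z => ?_)
      · exact (hV.continuous.comp (by fun_prop : Continuous fun z : ℝ => (z, q))).aestronglyMeasurable
      · simpa using hdecay z q
    have := integral_fourierInvLine_mul_exp (hv.continuous_left q) (hv.integrable q) hVi
      ⟪k, (q : Space d)⟫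
    simp only [moment, Complex.ofReal_one, one_mul]
    exact this
  have hf : ContMDiff (𝓡 (d - 1)) 𝓘(ℝ, ℂ) ((d - 1 : ℕ) : WithTop ℕ∞) f := by
    have h2 : ContMDiff (𝓡 (d - 1)) 𝓘(ℝ, ℝ) ((d - 1 : ℕ) : WithTop ℕ∞)
        (fun q : Sphere d => ⟪k, (q : Space d)⟫) :=
      ((innerSL ℝ k).contDiff.contMDiff).comp (contMDiff_coe_sphere (m := ((d - 1 : ℕ) : WithTop ℕ∞)))
    exact hv.contMDiff.comp (h2.prodMk contMDiff_id)
  -- The restriction to `ξ > 0` acts here: the back hemisphere, and with it the stationary point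
  -- `-e`, is removed.
  have hf0 : ∀ q : Sphere d, ⟪(e : Space d), (q : Space d)⟫ ≤ 0 → f q = 0 := by
    intro q hq
    refine hv.eq_zero_of_nonpos _ _ ?_
    rw [hinner]
    exact mul_nonpos_of_nonneg_of_nonpos hk0.le hq
  have hfe : f e = v ‖k‖ e := by
    simp only [f, hinner, inner_self_sphere, mul_one]
  -- leading term
  have hlin : Tendsto (fun N : ℝ => N * ‖k‖) atTop atTop := tendsto_id.atTop_mul_const hk0
  have hlead : Tendsto (fun N : ℝ => ((N ^ (((d : ℝ) - 1) / 2) : ℝ) : ℂ) *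
      ∫ q, spherePhase e (N * ‖k‖) q * f q ∂(surface d)) atTop
      (𝓝 (((‖k‖ ^ (((d : ℝ) - 1) / 2) : ℝ) : ℂ)⁻¹ *
        ((2 * Real.pi * Complex.I) ^ (((d : ℂ) - 1) / 2) * v ‖k‖ e))) := by
    have h2 := ((stationaryPhase hd hf e hf0).comp hlin).const_mul
      (((‖k‖ ^ (((d : ℝ) - 1) / 2) : ℝ) : ℂ)⁻¹)
    rw [hfe] at h2
    refine h2.congr' ?_
    filter_upwards [eventually_gt_atTop 0] with N hN
    have h3 : ((‖k‖ ^ (((d : ℝ) - 1) / 2) : ℝ) : ℂ) ≠ 0 := by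
      exact_mod_cast (Real.rpow_pos_of_pos hk0 _).ne'
    simp only [Function.comp_apply]
    rw [Real.mul_rpow hN.le hk0.le]
    push_cast
    field_simp
  -- correction term
  have hcorrm : Measurable (weightCorrection d) := by
    unfold weightCorrection; split_ifs <;> fun_prop
  have hcorrb : ∀ z, |weightCorrection d z| ≤ 2 * (1 + |z|) ^ (d - 1) := by
    intro z
    unfold weightCorrection
    split_ifs with h3
    · subst h3
      rw [abs_mul, abs_two, show 3 - 1 = 2 by norm_num]
      nlinarith [abs_nonneg z]
    · rw [abs_zero]; linarith [h1z z]
  have hcorr : Tendsto (fun N : ℝ => ∫ q, spherePhase e (N * ‖k‖) q *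
      moment V k (weightCorrection d) q ∂(surface d)) atTop (𝓝 0) := by
    have hc := hV.continuous_moment k hcorrm hcorrb
    -- Only `d = 3` has a correction. It carries no power of `N`, so continuity of the moment is
    -- enough, although multiplication by `z` costs smoothness in frequency.
    by_cases h3 : d = 3
    · subst h3
      exact (tendsto_integral_spherePhase_three hc e).comp hlin
    · have : ∀ q, moment V k (weightCorrection d) q = 0 := fun q => by
        simp [moment, weightCorrection, h3]
      simp [this]
  -- remainder
  set A : ℝ → ℝ → ℝ := fun N z => shellWeight d N z - N ^ (((d : ℝ) - 1) / 2) - weightCorrection d z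
  have hAm : ∀ N, Measurable (A N) := fun N =>
    ((measurable_shellWeight d N).sub_const _).sub hcorrm
  have hAb : ∀ N, 1 ≤ N → ∀ z, |A N z| ≤ 3 * (1 + |z|) ^ (d - 1) := fun N hN z =>
    abs_shellWeight_sub_le hd hN z
  have hrem0 : Tendsto (fun N => ∫ z : ℝ, |A N z| * (C * (1 + |z|) ^ (-(d : ℝ) - α))) atTop (𝓝 0) := by
    have : (0 : ℝ) = ∫ z : ℝ, 0 := by simp
    rw [this]
    refine tendsto_integral_filter_of_dominated_convergence
      (fun z => 3 * C * (1 + ‖z‖) ^ (-(1 + α))) ?_ ?_ ((integrable_decay hα).const_mul _) ?_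
    · refine Eventually.of_forall fun N => ?_
      exact ((hAm N).norm.mul (measurable_const.mul
        ((measurable_const.add measurable_norm).pow_const _))).aestronglyMeasurable
    · filter_upwards [eventually_ge_atTop 1] with N hN
      refine Eventually.of_forall fun z => ?_
      have hp : 0 ≤ (1 + |z|) ^ (-(d : ℝ) - α) := Real.rpow_nonneg (by linarith [abs_nonneg z]) _
      rw [Real.norm_eq_abs, abs_of_nonneg (mul_nonneg (abs_nonneg _) (mul_nonneg hC hp)),
        ← one_add_pow_mul_rpow (d := d)]
      calc _ ≤ (3 * (1 + |z|) ^ (d - 1)) * (C * (1 + |z|) ^ (-(d : ℝ) - α)) :=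
            mul_le_mul_of_nonneg_right (hAb N hN z) (mul_nonneg hC hp)
        _ = _ := by ring
    · refine Eventually.of_forall fun z => ?_
      have := ((tendsto_shellWeight_sub hd z).abs).mul_const (C * (1 + |z|) ^ (-(d : ℝ) - α))
      simpa using this
  have hrem : Tendsto (fun N : ℝ => ∫ q, spherePhase e (N * ‖k‖) q * moment V k (A N) q ∂(surface d))
      atTop (𝓝 0) := by
    refine squeeze_zero_norm' (a := fun N => (∫ z : ℝ, |A N z| * (C * (1 + |z|) ^ (-(d : ℝ) - α))) *
      (surface d).real Set.univ) ?_ (by simpa using hrem0.mul_const _)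
    filter_upwards [eventually_ge_atTop 1] with N hN
    refine norm_integral_le_of_norm_le_const (Eventually.of_forall fun q => ?_)
    rw [norm_mul, norm_spherePhase, one_mul]
    exact hV.norm_moment_le k (hAm N) (hAb N hN) q
  have htot := (hlead.add hcorr).add hrem
  rw [add_zero, add_zero] at htot
  refine htot.congr' ?_
  filter_upwards [eventually_ge_atTop 1] with N hN
  have hN0 : 0 < N := by linarith
  have hdec : ∀ q, moment V k (shellWeight d N) q =
      ((N ^ (((d : ℝ) - 1) / 2) : ℝ) : ℂ) * f q + moment V k (weightCorrection d) q + moment V k (A N) q := by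
    intro q
    rw [← hf1 q]
    simp only [moment]
    rw [← integral_const_mul, ← integral_add, ← integral_add]
    · refine integral_congr_ae (Eventually.of_forall fun z => ?_)
      simp only [A]
      push_cast; ring
    · exact ((hV.integrable_moment k measurable_const hone q).const_mul _).add
        (hV.integrable_moment k hcorrm hcorrb q)
    · exact hV.integrable_moment k (hAm N) (hAb N hN) q
    · exact (hV.integrable_moment k measurable_const hone q).const_mul _
    · exact hV.integrable_moment k hcorrm hcorrb q
  have hint : ∀ {g : Sphere d → ℂ}, Continuous g →
      Integrable (fun q => spherePhase e (N * ‖k‖) q * g q) (surface d) := by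
    intro g hg
    obtain ⟨B, -, hB⟩ := exists_norm_le_of_continuous (continuous_spherePhase_mul hg e (N * ‖k‖))
    exact Integrable.of_bound (continuous_spherePhase_mul hg e (N * ‖k‖)).measurable.aestronglyMeasurable
      B (Eventually.of_forall hB)
  rw [fourierSpace_shellProfile hV.continuous.measurable hC hV.norm_le hN0 k, ← integral_mul_const]
  have hpt : ∀ q : Sphere d, Complex.exp (-Complex.I * (N * (⟪k, (q : Space d)⟫ : ℝ))) *
      moment V k (shellWeight d N) q * Complex.exp (Complex.I * ((N * ‖k‖ : ℝ) : ℂ)) =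
      ((N ^ (((d : ℝ) - 1) / 2) : ℝ) : ℂ) * (spherePhase e (N * ‖k‖) q * f q) +
        spherePhase e (N * ‖k‖) q * moment V k (weightCorrection d) q +
        spherePhase e (N * ‖k‖) q * moment V k (A N) q := by
    intro q
    have : spherePhase e (N * ‖k‖) q = Complex.exp (-Complex.I * (N * (⟪k, (q : Space d)⟫ : ℝ))) *
        Complex.exp (Complex.I * ((N * ‖k‖ : ℝ) : ℂ)) := by
      rw [spherePhase, ← Complex.exp_add, hinner]
      congr 1
      push_cast; ring
    rw [hdec, this]
    ring
  simp_rw [hpt]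
  rw [integral_add, integral_add, integral_const_mul]
  · exact (hint hf.continuous).const_mul _
  · exact hint (hV.continuous_moment k hcorrm hcorrb)
  · exact ((hint hf.continuous).const_mul _).add (hint (hV.continuous_moment k hcorrm hcorrb))
  · exact hint (hV.continuous_moment k (hAm N) (hAb N hN))

/-! ### Normalisation constants and the regularized reconstruction. -/

/-- The constant `(1 / (2πi))^{(d-1)/2}`. -/
def dimConst (d : ℕ) : ℂ := (1 / (2 * Real.pi * Complex.I) : ℂ) ^ (((d : ℂ) - 1) / 2)

theorem two_pi_I_ne_zero : (2 * Real.pi * Complex.I : ℂ) ≠ 0 := by simp [Real.pi_ne_zero]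

/-- The argument of `2πi` is `π/2`, off the branch cut, so the principal power commutes with
inversion. This is the cancellation between stationary phase and the restriction operators. -/
theorem cpow_mul_dimConst (d : ℕ) :
    (2 * Real.pi * Complex.I : ℂ) ^ (((d : ℂ) - 1) / 2) * dimConst d = 1 := by
  have harg : (2 * Real.pi * Complex.I : ℂ).arg ≠ Real.pi := by
    have : (2 * Real.pi * Complex.I : ℂ) = ((2 * Real.pi : ℝ) : ℂ) * Complex.I := by push_cast; ring
    rw [this, Complex.arg_real_mul _ (by positivity), Complex.arg_I]
    linarith [Real.pi_pos]
  rw [dimConst, one_div, Complex.inv_cpow _ _ harg, mul_inv_cancel₀]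
  rw [Complex.cpow_def_of_ne_zero two_pi_I_ne_zero]
  exact Complex.exp_ne_zero _

theorem ofReal_rpow_half {d : ℕ} {x : ℝ} (hx : 0 ≤ x) :
    ((x ^ (((d : ℝ) - 1) / 2) : ℝ) : ℂ) = (x : ℂ) ^ (((d : ℂ) - 1) / 2) := by
  rw [Complex.ofReal_cpow hx]; push_cast; rfl

/-- Pulling the positive factor `ξ` out of the principal power separates the complex constant from a
real weight. -/
theorem restriction_eq {d : ℕ} (u : Space d → ℂ) (ξ : ℝ) (q : Sphere d) :
    restriction u ξ q = if 0 < ξ then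
      dimConst d * ((ξ ^ (((d : ℝ) - 1) / 2) : ℝ) : ℂ) * u (ξ • (q : Space d)) else 0 := by
  unfold restriction
  split_ifs with h
  · rw [abs_of_pos h, mul_one, ofReal_rpow_half h.le, dimConst, div_eq_mul_one_div,
      mul_cpow_of_pos h _ (one_div_ne_zero two_pi_I_ne_zero), mul_comm ((ξ : ℂ) ^ _)]
  · simp

theorem exists_eq_zero_of_norm_ge {d : ℕ} {u : Space d → ℂ} (h : HasCompactSupport u) :
    ∃ R, 0 < R ∧ ∀ x, R ≤ ‖x‖ → u x = 0 := by
  obtain ⟨R, hR⟩ := h.isCompact.isBounded.subset_ball 0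
  refine ⟨max R 1, lt_max_of_lt_right one_pos, fun x hx => ?_⟩
  by_contra hne
  have := hR (subset_tsupport _ hne)
  rw [mem_ball_zero_iff] at this
  exact absurd (le_max_left R 1) (by linarith)

theorem tendsto_div_sq_nhdsGT {a : ℝ} (ha : 0 < a) :
    Tendsto (fun ε : ℝ => a / ε ^ 2) (𝓝[>] 0) atTop := by
  have h1 : Tendsto (fun ε : ℝ => (ε ^ 2)⁻¹) (𝓝[>] 0) atTop := by
    refine Tendsto.inv_tendsto_nhdsGT_zero ?_
    refine tendsto_nhdsWithin_iff.2 ⟨?_, ?_⟩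
    · have : Tendsto (fun ε : ℝ => ε ^ 2) (𝓝 0) (𝓝 (0 ^ 2)) := (continuous_pow 2).tendsto 0
      rw [zero_pow two_ne_zero] at this
      exact this.mono_left nhdsWithin_le_nhds
    · filter_upwards [self_mem_nhdsWithin] with ε hε
      exact pow_pos (Set.mem_Ioi.1 hε) 2
  simp_rw [div_eq_mul_inv]
  exact h1.const_mul_atTop ha

/-- Pointwise convergence of the regularized reconstruction. -/
theorem tendsto_reconstructionRegHat {d : ℕ} [NeZero d] (hd : d ∈ ({1, 2, 3} : Set ℕ))
    {c : ℝ} (hc : 0 < c) {u : Space d → ℂ} (hsupp : HasCompactSupport u) {b : ℝ → ℝ} {ρ : ℝ}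
    (hρ : 0 < ρ) {W : ℝ → ℝ} (hW : IsRegularizedWeight d ρ W)
    (hV : DecayAndSmoothness (evolution b (restrictionReg W u))) {τ : ℝ} (hτ : 0 < τ)
    {k : Space d} (hk : ρ < ‖k‖) :
    Tendsto (fun ε : ℝ => reconstructionRegHat c ε b W u k (τ / ε ^ 2)
        * Complex.exp (Complex.I * ((c * ‖k‖ * τ / ε ^ 2 : ℝ) : ℂ))) (𝓝[>] 0)
      (𝓝 (Complex.exp (-Complex.I * b ‖k‖ * τ) * u k)) := by
  have hk0 : 0 < ‖k‖ := hρ.trans hk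
  have hkne : k ≠ 0 := norm_pos_iff.1 hk0
  obtain ⟨R, -, hR⟩ := exists_eq_zero_of_norm_ge hsupp
  obtain ⟨C, α, hC, hα, hdecay⟩ := hV.decay
  set v : ℝ → Sphere d → ℂ := fun ξ q => evolution b (restrictionReg W u) ξ q τ
  have hv : IsSpectralProfile v R := by
    refine ⟨hV.smooth τ hτ, fun ξ q hξ => ?_, fun ξ q hξ => ?_⟩
    · simp [v, evolution, restrictionReg, hW.eq_zero ξ hξ]
    · have : u (|ξ| • (q : Space d)) = 0 := hR _ (by
        rw [norm_smul, norm_eq_of_mem_sphere, mul_one, Real.norm_eq_abs, abs_abs]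
        exact hξ.trans (le_abs_self ξ))
      simp [v, evolution, restrictionReg, this]
  have key := (tendsto_fourierSpace_shellProfile hd hv hC.le hα (fun z q => hdecay τ hτ q z) k hkne).comp
    (tendsto_div_sq_nhdsGT (mul_pos hc hτ))
  -- For `|k| > ρ` the regularized weight is the exact power of `|k|`, which cancels the one from
  -- stationary phase.
  have hval : ((‖k‖ ^ (((d : ℝ) - 1) / 2) : ℝ) : ℂ)⁻¹ *
      ((2 * Real.pi * Complex.I) ^ (((d : ℂ) - 1) / 2) * v ‖k‖ (direction k hkne)) =
      Complex.exp (-Complex.I * b ‖k‖ * τ) * u k := by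
    have h1 : ((‖k‖ ^ (((d : ℝ) - 1) / 2) : ℝ) : ℂ) ≠ 0 := by
      exact_mod_cast (Real.rpow_pos_of_pos hk0 _).ne'
    have h2 : ‖k‖ • (direction k hkne : Space d) = k := by
      simp only [direction, smul_smul, mul_inv_cancel₀ hk0.ne', one_smul]
    have h3 := cpow_mul_dimConst d
    simp only [v, evolution, restrictionReg, hW.eq_weight _ hk.le, abs_norm, h2]
    rw [← dimConst]
    field_simp
    linear_combination u k * h3
  rw [hval] at key
  refine key.congr' ?_
  filter_upwards [self_mem_nhdsWithin] with ε hε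
  have hε0 : ε ≠ 0 := ne_of_gt hε
  simp only [Function.comp_apply, reconstructionRegHat, reconstructionReg, shell_eq_shellProfile hε0]
  have h5 : c * τ / ε ^ 2 * ‖k‖ = c * ‖k‖ * τ / ε ^ 2 := by ring
  rw [h5]
  rfl

/-! ### Reconstruction of bounded data and the uniform `L²` bound. -/

/-- Bounded measurable functions vanishing outside a ball. -/
structure IsBoundedDatum {d : ℕ} (u : Space d → ℂ) (B R : ℝ) : Prop where
  measurable : Measurable u
  norm_le : ∀ x, ‖u x‖ ≤ B
  eq_zero_of_ge : ∀ x, R ≤ ‖x‖ → u x = 0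

/-- The profile `F_1^{-1} R u`. -/
def profile {d : ℕ} (u : Space d → ℂ) (z : ℝ) (q : Sphere d) : ℂ :=
  fourierInvLine (fun ξ => restriction u ξ q) z

/-- The reconstruction operator `F_d S F_1^{-1} R` with shell radius `N`. -/
def profileHat {d : ℕ} (N : ℝ) (u : Space d → ℂ) (k : Space d) : ℂ :=
  fourierSpace (shellProfile N (profile u)) k

theorem measurable_restriction {d : ℕ} {u : Space d → ℂ} (hu : Measurable u) :
    Measurable (Function.uncurry (restriction u)) := by
  have : Function.uncurry (restriction u) = fun p : ℝ × Sphere d => if 0 < p.1 then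
      dimConst d * ((p.1 ^ (((d : ℝ) - 1) / 2) : ℝ) : ℂ) * u (p.1 • (p.2 : Space d)) else 0 := by
    funext p
    exact restriction_eq u p.1 p.2
  rw [this]
  refine Measurable.ite (measurableSet_lt measurable_const measurable_fst) ?_ measurable_const
  refine Measurable.mul ?_ (hu.comp (measurable_fst.smul (measurable_subtype_coe.comp measurable_snd)))
  exact measurable_const.mul (Complex.measurable_ofReal.comp (measurable_fst.pow_const _))

theorem measurable_restriction_comp {d : ℕ} {u : Space d → ℂ} (hu : Measurable u) {β : Type*}
    [MeasurableSpace β] {f : β → ℝ} {g : β → Sphere d} (hf : Measurable f) (hg : Measurable g) :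
    Measurable (fun a => restriction u (f a) (g a)) := by
  have h := Measurable.comp (measurable_restriction hu) (Measurable.prodMk hf hg)
  exact h

theorem norm_exp_I_mul_mul (z ξ : ℝ) : ‖Complex.exp (Complex.I * ((z : ℂ) * (ξ : ℂ)))‖ = 1 := by
  rw [← Complex.ofReal_mul, norm_exp_I_mul_ofReal_eq_one]

namespace IsBoundedDatum

variable {d : ℕ} {u u' : Space d → ℂ} {B B' R R' : ℝ}

theorem sub (h : IsBoundedDatum u B R) (h' : IsBoundedDatum u' B' R') :
    IsBoundedDatum (fun x => u x - u' x) (B + B') (max R R') where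
  measurable := h.measurable.sub h'.measurable
  norm_le x := (norm_sub_le _ _).trans (add_le_add (h.norm_le x) (h'.norm_le x))
  eq_zero_of_ge x hx := by
    rw [h.eq_zero_of_ge x ((le_max_left _ _).trans hx),
      h'.eq_zero_of_ge x ((le_max_right _ _).trans hx), sub_zero]

theorem memLp (h : IsBoundedDatum u B R) (p : ENNReal) : MemLp u p := by
  have e : u = (Metric.ball (0 : Space d) R).indicator u := by
    funext x
    by_cases hx : x ∈ Metric.ball (0 : Space d) R
    · rw [Set.indicator_of_mem hx]
    · rw [Set.indicator_of_notMem hx, h.eq_zero_of_ge x (by simpa using hx)]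
  rw [e, memLp_indicator_iff_restrict measurableSet_ball]
  have : IsFiniteMeasure (volume.restrict (Metric.ball (0 : Space d) R)) :=
    ⟨by rw [Measure.restrict_apply_univ]; exact measure_ball_lt_top⟩
  exact MemLp.of_bound h.measurable.aestronglyMeasurable _ (Eventually.of_forall h.norm_le)

theorem restriction_eq_indicator (h : IsBoundedDatum u B R) (q : Sphere d) :
    (fun ξ => restriction u ξ q) = (Set.Ioo 0 R).indicator (fun ξ => restriction u ξ q) := by
  funext ξ
  by_cases hξ : ξ ∈ Set.Ioo 0 R
  · rw [Set.indicator_of_mem hξ]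
  · rw [Set.indicator_of_notMem hξ, restriction_eq]
    split_ifs with h0
    · rw [h.eq_zero_of_ge, mul_zero]
      rw [norm_smul, norm_eq_of_mem_sphere, mul_one, Real.norm_eq_abs, abs_of_pos h0]
      by_contra hlt
      exact hξ ⟨h0, not_le.1 hlt⟩
    · rfl

theorem norm_restriction_le [NeZero d] (h : IsBoundedDatum u B R) (ξ : ℝ) (q : Sphere d) :
    ‖restriction u ξ q‖ ≤
      (Set.Ioo 0 R).indicator (fun _ => ‖dimConst d‖ * R ^ (((d : ℝ) - 1) / 2) * B) ξ := by
  by_cases hξ : ξ ∈ Set.Ioo 0 R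
  · rw [Set.indicator_of_mem hξ, restriction_eq, if_pos hξ.1, norm_mul, norm_mul, Complex.norm_real,
      Real.norm_of_nonneg (Real.rpow_nonneg hξ.1.le _)]
    have hd : (1 : ℝ) ≤ d := by exact_mod_cast NeZero.one_le
    have := h.norm_le (ξ • (q : Space d))
    have h2 : ξ ^ (((d : ℝ) - 1) / 2) ≤ R ^ (((d : ℝ) - 1) / 2) :=
      Real.rpow_le_rpow hξ.1.le hξ.2.le (by linarith)
    have h3 := (Real.rpow_nonneg hξ.1.le (((d : ℝ) - 1) / 2)).trans h2
    gcongr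
  · have e := congrFun (h.restriction_eq_indicator q) ξ
    rw [Set.indicator_of_notMem hξ] at e ⊢
    rw [e, norm_zero]

theorem integrable_bound (K : ℝ) (R : ℝ) :
    Integrable ((Set.Ioo 0 R).indicator (fun _ : ℝ => K)) :=
  (integrable_indicator_iff measurableSet_Ioo).2 (integrableOn_const (by simp))

theorem memLp_restriction [NeZero d] (h : IsBoundedDatum u B R) (q : Sphere d) (p : ENNReal) :
    MemLp (fun ξ => restriction u ξ q) p := by
  have hm : Measurable (fun ξ => restriction u ξ q) :=
    measurable_restriction_comp h.measurable measurable_id measurable_const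
  rw [h.restriction_eq_indicator q, memLp_indicator_iff_restrict measurableSet_Ioo]
  have : IsFiniteMeasure (volume.restrict (Set.Ioo (0 : ℝ) R)) :=
    ⟨by rw [Measure.restrict_apply_univ]; exact measure_Ioo_lt_top⟩
  refine MemLp.of_bound hm.aestronglyMeasurable (‖dimConst d‖ * R ^ (((d : ℝ) - 1) / 2) * B) ?_
  filter_upwards [ae_restrict_mem measurableSet_Ioo] with ξ hξ
  have := h.norm_restriction_le ξ q
  rwa [Set.indicator_of_mem hξ] at this

theorem integrable_restriction [NeZero d] (h : IsBoundedDatum u B R) (q : Sphere d) :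
    Integrable (fun ξ => restriction u ξ q) := memLp_one_iff_integrable.1 (h.memLp_restriction q 1)

theorem measurable_profile (h : IsBoundedDatum u B R) :
    Measurable (Function.uncurry (profile u)) := by
  have hm : Measurable (fun p : (ℝ × Sphere d) × ℝ =>
      Complex.exp (Complex.I * (p.1.1 * p.2)) * restriction u p.2 p.1.2) := by
    refine Measurable.mul (Complex.measurable_exp.comp (measurable_const.mul
      ((Complex.measurable_ofReal.comp (measurable_fst.comp measurable_fst)).mul
        (Complex.measurable_ofReal.comp measurable_snd)))) ?_
    exact measurable_restriction_comp h.measurable measurable_snd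
      (measurable_snd.comp measurable_fst)
  exact (hm.stronglyMeasurable.integral_prod_right (ν := volume)).measurable.const_mul _

theorem norm_profile_le [NeZero d] (h : IsBoundedDatum u B R) :
    ∃ K, 0 ≤ K ∧ ∀ z q, ‖profile u z q‖ ≤ K := by
  set c := ‖dimConst d‖ * R ^ (((d : ℝ) - 1) / 2) * B
  refine ⟨‖(1 / (2 * Real.pi) : ℂ)‖ * |∫ ξ, (Set.Ioo 0 R).indicator (fun _ : ℝ => c) ξ|, by positivity,
    fun z q => ?_⟩
  rw [profile, fourierInvLine, norm_mul]
  gcongr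
  refine (norm_integral_le_of_norm_le (integrable_bound c R)
    (Eventually.of_forall fun ξ => ?_)).trans (le_abs_self _)
  rw [norm_mul, norm_exp_I_mul_mul, one_mul]
  exact h.norm_restriction_le ξ q

theorem memLp_shellProfile [NeZero d] (h : IsBoundedDatum u B R) (N : ℝ) (p : ENNReal) :
    MemLp (shellProfile N (profile u)) p := by
  obtain ⟨K, hK, hle⟩ := h.norm_profile_le
  exact ShellReconstruction.memLp_shellProfile N h.measurable_profile hle hK p

theorem integrable_shellProfile [NeZero d] (h : IsBoundedDatum u B R) (N : ℝ) :
    Integrable (shellProfile N (profile u)) := memLp_one_iff_integrable.1 (h.memLp_shellProfile N 1)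

/-- Linearity of the reconstruction, for use in the density argument, starts from this step. -/
theorem profile_sub [NeZero d] (h : IsBoundedDatum u B R) (h' : IsBoundedDatum u' B' R') (z : ℝ)
    (q : Sphere d) : profile (fun x => u x - u' x) z q = profile u z q - profile u' z q := by
  have hint : ∀ {u : Space d → ℂ} {B R : ℝ}, IsBoundedDatum u B R →
      Integrable (fun ξ : ℝ => Complex.exp (Complex.I * (z * ξ)) * restriction u ξ q) := by
    intro u B R h
    refine (h.integrable_restriction q).bdd_mul (c := 1) ?_ ?_
    · exact (by fun_prop : Continuous _).aestronglyMeasurable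
    · exact Eventually.of_forall fun ξ => (norm_exp_I_mul_mul z ξ).le
  simp only [profile, fourierInvLine]
  rw [← mul_sub, ← integral_sub (hint h) (hint h')]
  congr 1
  refine integral_congr_ae (Eventually.of_forall fun ξ => ?_)
  simp only [restriction]
  ring

theorem profileHat_sub [NeZero d] (h : IsBoundedDatum u B R) (h' : IsBoundedDatum u' B' R') (N : ℝ)
    (k : Space d) :
    profileHat N (fun x => u x - u' x) k = profileHat N u k - profileHat N u' k := by
  have hint : ∀ {u : Space d → ℂ} {B R : ℝ}, IsBoundedDatum u B R → Integrable (fun x : Space d =>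
      shellProfile N (profile u) x * Complex.exp (-Complex.I * (⟪k, x⟫ : ℝ))) := by
    intro u B R h
    refine (h.integrable_shellProfile N).mul_bdd (c := 1) ?_ ?_
    · exact (by fun_prop : Continuous _).aestronglyMeasurable
    · refine Eventually.of_forall fun x => le_of_eq ?_
      rw [neg_mul, ← mul_neg, ← Complex.ofReal_neg, norm_exp_I_mul_ofReal_eq_one]
  simp only [profileHat, fourierSpace]
  rw [← integral_sub (hint h) (hint h')]
  refine integral_congr_ae (Eventually.of_forall fun x => ?_)
  have : shellProfile N (profile fun x => u x - u' x) x =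
      shellProfile N (profile u) x - shellProfile N (profile u') x := by
    simp only [shellProfile, radialExtension]
    split_ifs <;> simp [h.profile_sub h', mul_sub]
  simp only [this]
  ring

end IsBoundedDatum

/-- The squared amplitude `N^{-(d-1)}` meets the Jacobian `r^{d-1}`, and the cutoff `r < 2N` bounds
their product by `2^{d-1}`, independently of `N`. Enlarging the range of `z` to the whole line only
increases the integral. -/
theorem lintegral_shellProfile_sq_le {d : ℕ} [NeZero d] (N : ℝ) {V : ℝ → Sphere d → ℂ}
    (hV : Measurable (Function.uncurry V)) :
    ∫⁻ x, ‖shellProfile N V x‖ₑ ^ 2 ≤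
      ENNReal.ofReal (2 ^ (d - 1)) * ∫⁻ q, (∫⁻ z, ‖V z q‖ₑ ^ 2) ∂(surface d) := by
  rw [lintegral_polar ((measurable_shellProfile N hV).enorm.pow_const 2),
    ← lintegral_const_mul' _ _ ENNReal.ofReal_ne_top]
  refine lintegral_mono fun q => ?_
  rw [← lintegral_sub_right_eq_self (fun z => ‖V z q‖ₑ ^ 2) N,
    ← lintegral_const_mul' _ _ ENNReal.ofReal_ne_top]
  refine (setLIntegral_mono' measurableSet_Ioi fun r hr => ?_).trans (setLIntegral_le_lintegral _ _)
  have hr0 : 0 < r := hr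
  rw [shellProfile_smul N V hr0 q]
  split_ifs with h
  · have hN : 0 < N := by linarith
    rw [mul_one, enorm_mul, mul_pow, ← mul_assoc]
    gcongr
    rw [← ofReal_norm, ← ENNReal.ofReal_pow (norm_nonneg _), ← ENNReal.ofReal_mul (by positivity)]
    refine ENNReal.ofReal_le_ofReal ?_
    have hs := Real.rpow_pos_of_pos hN (((d : ℝ) - 1) / 2)
    have e : ‖(1 / (N ^ (((d : ℝ) - 1) / 2) : ℝ) : ℂ)‖ = 1 / N ^ (((d : ℝ) - 1) / 2) := by
      rw [norm_div, norm_one, Complex.norm_real, Real.norm_of_nonneg hs.le]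
    rw [e, div_pow, one_pow, sq, rpow_half_mul_self hN, mul_one_div, ← div_pow]
    refine pow_le_pow_left₀ (by positivity) ?_ _
    rw [div_le_iff₀ hN]
    exact h.le
  · simp

/-- The square of `ξ^{(d-1)/2}` is the polar Jacobian, so restriction is a multiple of an isometry.
-/
theorem lintegral_restriction_sq {d : ℕ} [NeZero d] {u : Space d → ℂ} (hu : Measurable u) :
    ∫⁻ q, (∫⁻ ξ, ‖restriction u ξ q‖ₑ ^ 2) ∂(surface d) = ‖dimConst d‖ₑ ^ 2 * ∫⁻ x, ‖u x‖ₑ ^ 2 := by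
  rw [lintegral_polar (hu.enorm.pow_const 2), ← lintegral_const_mul' _ _ (by simp)]
  refine lintegral_congr fun q => ?_
  rw [← lintegral_const_mul' _ _ (by simp), ← lintegral_indicator measurableSet_Ioi]
  refine lintegral_congr fun ξ => ?_
  rw [restriction_eq]
  by_cases h : 0 < ξ
  · rw [if_pos h, Set.indicator_of_mem (Set.mem_Ioi.2 h), enorm_mul, enorm_mul, mul_pow, mul_pow, mul_assoc,
      ← ofReal_norm ((ξ ^ _ : ℝ) : ℂ), Complex.norm_real, Real.norm_of_nonneg (Real.rpow_nonneg h.le _),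
      ← ENNReal.ofReal_pow (Real.rpow_nonneg h.le _), sq (ξ ^ _), rpow_half_mul_self h]
  · rw [if_neg h, Set.indicator_of_notMem (by simpa using h)]
    simp

/-- The square of the bound for the norm of the reconstruction operators on `L²`. -/
def reconstructionBound (d : ℕ) : ENNReal :=
  ENNReal.ofReal ((2 * Real.pi) ^ d) * (ENNReal.ofReal (2 ^ (d - 1)) *
    (ENNReal.ofReal (1 / (2 * Real.pi)) * ‖dimConst d‖ₑ ^ 2))

theorem reconstructionBound_ne_top (d : ℕ) : reconstructionBound d ≠ ⊤ := by
  unfold reconstructionBound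
  finiteness

namespace IsBoundedDatum

variable {d : ℕ} [NeZero d] {u u' : Space d → ℂ} {B B' R R' : ℝ}

/-- Plancherel in `x`, the shell estimate, Plancherel in `z` and polar coordinates are chained; none
of the four constants depends on `N`. -/
theorem lintegral_profileHat_sq_le (h : IsBoundedDatum u B R) (N : ℝ) :
    ∫⁻ k, ‖profileHat N u k‖ₑ ^ 2 ≤ reconstructionBound d * ∫⁻ x, ‖u x‖ₑ ^ 2 := by
  have e : ∀ q : Sphere d, ∫⁻ z, ‖profile u z q‖ₑ ^ 2 =
      ENNReal.ofReal (1 / (2 * Real.pi)) * ∫⁻ ξ, ‖restriction u ξ q‖ₑ ^ 2 := fun q =>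
    lintegral_fourierInvLine_sq (h.integrable_restriction q) (h.memLp_restriction q 2)
  calc ∫⁻ k, ‖profileHat N u k‖ₑ ^ 2
      = ENNReal.ofReal ((2 * Real.pi) ^ d) * ∫⁻ x, ‖shellProfile N (profile u) x‖ₑ ^ 2 :=
        lintegral_fourierSpace_sq (h.integrable_shellProfile N) (h.memLp_shellProfile N 2)
    _ ≤ ENNReal.ofReal ((2 * Real.pi) ^ d) * (ENNReal.ofReal (2 ^ (d - 1)) *
          ∫⁻ q, (∫⁻ z, ‖profile u z q‖ₑ ^ 2) ∂(surface d)) := by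
        gcongr
        exact lintegral_shellProfile_sq_le N h.measurable_profile
    _ = reconstructionBound d * ∫⁻ x, ‖u x‖ₑ ^ 2 := by
        simp_rw [e]
        rw [lintegral_const_mul' _ _ ENNReal.ofReal_ne_top, lintegral_restriction_sq h.measurable,
          reconstructionBound]
        ring

theorem continuous_profileHat (h : IsBoundedDatum u B R) (N : ℝ) : Continuous (profileHat N u) :=
  continuous_fourierSpace (h.integrable_shellProfile N)

theorem eLpNorm_profileHat_sq_le (h : IsBoundedDatum u B R) (N : ℝ) :
    eLpNorm (profileHat N u) 2 volume ^ 2 ≤ reconstructionBound d * eLpNorm u 2 volume ^ 2 := by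
  rw [eLpNorm_two_sq, eLpNorm_two_sq]
  exact h.lintegral_profileHat_sq_le N

theorem memLp_profileHat (h : IsBoundedDatum u B R) (N : ℝ) : MemLp (profileHat N u) 2 := by
  refine ⟨(h.continuous_profileHat N).aestronglyMeasurable, ?_⟩
  have h1 : eLpNorm (profileHat N u) 2 volume ^ 2 < ⊤ :=
    (h.eLpNorm_profileHat_sq_le N).trans_lt (ENNReal.mul_lt_top
      (reconstructionBound_ne_top d).lt_top (ENNReal.pow_lt_top (h.memLp 2).2))
  by_contra hne
  rw [not_lt_top_iff.1 hne] at h1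
  simp at h1

end IsBoundedDatum

/-! ### Weak convergence from an `L²` bound and almost everywhere convergence. -/

/-- Cauchy–Schwarz for the pairing of `L²`. -/
theorem norm_integral_mul_conj_le {α : Type*} [MeasurableSpace α] {μ : Measure α} {f g : α → ℂ}
    (hf : MemLp f 2 μ) (hg : MemLp g 2 μ) :
    ‖∫ x, f x * (starRingEnd ℂ) (g x) ∂μ‖ ≤ (eLpNorm f 2 μ).toReal * (eLpNorm g 2 μ).toReal := by
  have h := norm_inner_le_norm (𝕜 := ℂ) (hg.toLp g) (hf.toLp f)
  rw [L2.inner_def, Lp.norm_toLp, Lp.norm_toLp, mul_comm] at h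
  refine le_of_eq_of_le (congrArg norm (integral_congr_ae ?_)) h
  filter_upwards [hf.coeFn_toLp, hg.coeFn_toLp] with x hx hy
  rw [hx, hy, RCLike.inner_apply]

theorem integrable_mul_conj {α : Type*} [MeasurableSpace α] {μ : Measure α} {f g : α → ℂ}
    (hf : MemLp f 2 μ) (hg : MemLp g 2 μ) : Integrable (fun x => f x * (starRingEnd ℂ) (g x)) μ := by
  refine (L2.integrable_inner (𝕜 := ℂ) (hg.toLp g) (hf.toLp f)).congr ?_
  filter_upwards [hf.coeFn_toLp, hg.coeFn_toLp] with x hx hy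
  rw [hx, hy, RCLike.inner_apply]

/-- Split according to `a ≤ M b`. The minimum has a majorant independent of `a`, and for large `M`
the other term is small under a bound on the square integral of `a`. -/
theorem mul_le_min_add_inv_mul_sq {a b M : ENNReal} (hM : M ≠ 0) (hM' : M ≠ ⊤) :
    a * b ≤ min (a * b) (M * b ^ 2) + M⁻¹ * a ^ 2 := by
  rcases le_total a (M * b) with h | h
  · have : a * b ≤ M * b ^ 2 := by
      calc a * b ≤ M * b * b := by gcongr
        _ = M * b ^ 2 := by ring
    rw [min_eq_left this]
    exact le_self_add
  · refine le_add_left ?_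
    calc a * b = M⁻¹ * (a * (M * b)) := by
          rw [mul_left_comm, ← mul_assoc M⁻¹, ENNReal.inv_mul_cancel hM hM', one_mul]
      _ ≤ M⁻¹ * (a * a) := by gcongr
      _ = M⁻¹ * a ^ 2 := by ring

/-- A bounded family of `L²` converging to zero almost everywhere converges weakly to zero. -/
theorem tendsto_integral_mul_conj_zero {α ι : Type*} [MeasurableSpace α] {μ : Measure α}
    {l : Filter ι} [l.IsCountablyGenerated] {h : ι → α → ℂ} {B : ENNReal} (hB : B ≠ ⊤)
    (hm : ∀ i, Measurable (h i)) (hb : ∀ i, ∫⁻ x, ‖h i x‖ₑ ^ 2 ∂μ ≤ B)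
    (h0 : ∀ᵐ x ∂μ, Tendsto (fun i => h i x) l (𝓝 0)) {g : α → ℂ} (hg : MemLp g 2 μ) :
    Tendsto (fun i => ∫ x, h i x * (starRingEnd ℂ) (g x) ∂μ) l (𝓝 0) := by
  set g' := hg.1.mk g
  have hg'm : Measurable g' := hg.1.stronglyMeasurable_mk.measurable
  have hgg' : g =ᵐ[μ] g' := hg.1.ae_eq_mk
  have hg'2 : ∫⁻ x, ‖g' x‖ₑ ^ 2 ∂μ ≠ ⊤ := by
    rw [← eLpNorm_two_sq, ← eLpNorm_congr_ae hgg']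
    exact ENNReal.pow_ne_top hg.2.ne
  rw [tendsto_zero_iff_enorm_tendsto_zero, ENNReal.tendsto_nhds_zero]
  intro δ hδ
  -- The truncation level is fixed first, so that the uniform bound accounts for half of `δ`.
  have hM : ∃ n : ℕ, n ≠ 0 ∧ (n : ENNReal)⁻¹ * B ≤ δ / 2 := by
    have h1 := ENNReal.Tendsto.mul_const ENNReal.tendsto_inv_nat_nhds_zero (Or.inr hB)
    rw [zero_mul] at h1
    have h2 := (ENNReal.tendsto_nhds_zero.1 h1 (δ / 2) (ENNReal.half_pos hδ.ne')).and
      (eventually_ne_atTop 0)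
    obtain ⟨n, hn⟩ := h2.exists
    exact ⟨n, hn.2, hn.1⟩
  obtain ⟨n, hn, hnB⟩ := hM
  have hn0 : (n : ENNReal) ≠ 0 := by exact_mod_cast hn
  -- The truncated product is dominated by `n ‖g'‖²`, integrable because `g ∈ L²`; no common
  -- majorant of the family is needed.
  have hlim : Tendsto (fun i => ∫⁻ x, min (‖h i x‖ₑ * ‖g' x‖ₑ) (n * ‖g' x‖ₑ ^ 2) ∂μ) l (𝓝 0) := by
    have := tendsto_lintegral_filter_of_dominated_convergence (μ := μ) (l := l)
      (F := fun i x => min (‖h i x‖ₑ * ‖g' x‖ₑ) (n * ‖g' x‖ₑ ^ 2)) (f := fun _ => 0)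
      (fun x => n * ‖g' x‖ₑ ^ 2)
      (Eventually.of_forall fun i => ((hm i).enorm.mul hg'm.enorm).min
        ((hg'm.enorm.pow_const 2).const_mul _))
      (Eventually.of_forall fun i => Eventually.of_forall fun x => min_le_right _ _) ?_ ?_
    · simpa using this
    · rw [lintegral_const_mul' _ _ (by simp)]
      exact ENNReal.mul_ne_top (by simp) hg'2
    · filter_upwards [h0] with x hx
      have h1 := ENNReal.Tendsto.mul_const (b := ‖g' x‖ₑ)
        (tendsto_zero_iff_enorm_tendsto_zero.1 hx) (Or.inr enorm_ne_top)
      rw [zero_mul] at h1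
      exact tendsto_of_tendsto_of_tendsto_of_le_of_le tendsto_const_nhds h1
        (fun _ => bot_le) (fun _ => min_le_left _ _)
  filter_upwards [ENNReal.tendsto_nhds_zero.1 hlim (δ / 2) (ENNReal.half_pos hδ.ne')] with i hi
  calc ‖∫ x, h i x * (starRingEnd ℂ) (g x) ∂μ‖ₑ
      ≤ ∫⁻ x, ‖h i x * (starRingEnd ℂ) (g x)‖ₑ ∂μ := enorm_integral_le_lintegral_enorm _
    _ = ∫⁻ x, ‖h i x‖ₑ * ‖g' x‖ₑ ∂μ := by
        refine lintegral_congr_ae ?_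
        filter_upwards [hgg'] with x hx
        rw [enorm_mul, RCLike.enorm_conj, hx]
    _ ≤ ∫⁻ x, (min (‖h i x‖ₑ * ‖g' x‖ₑ) (n * ‖g' x‖ₑ ^ 2) + (n : ENNReal)⁻¹ * ‖h i x‖ₑ ^ 2) ∂μ :=
        lintegral_mono fun x => mul_le_min_add_inv_mul_sq hn0 (by simp)
    _ = (∫⁻ x, min (‖h i x‖ₑ * ‖g' x‖ₑ) (n * ‖g' x‖ₑ ^ 2) ∂μ) +
          (n : ENNReal)⁻¹ * ∫⁻ x, ‖h i x‖ₑ ^ 2 ∂μ := by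
        rw [lintegral_add_right _ (((hm i).enorm.pow_const 2).const_mul _),
          lintegral_const_mul _ ((hm i).enorm.pow_const 2)]
    _ ≤ δ / 2 + δ / 2 := by
        gcongr
        exact (mul_le_mul_right (hb i) _).trans hnB
    _ = δ := ENNReal.add_halves δ

/-! ### Decay of the inverse transform for smooth spectral families. -/

/-- Smooth functions of a radial frequency and a point whose restrictions to the directions of the
unit sphere are supported in `0 ≤ ξ ≤ R`. -/
structure IsSmoothFamily {d : ℕ} (Ψ : ℝ × Space d → ℂ) (R : ℝ) : Prop where
  contDiff : ContDiff ℝ ∞ Ψ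
  eq_zero : ∀ ξ (q : Sphere d), ξ ∉ Set.Icc 0 R → Ψ (ξ, q) = 0

namespace IsSmoothFamily

variable {d : ℕ} {Ψ : ℝ × Space d → ℂ} {R : ℝ}

theorem contDiff_left (h : IsSmoothFamily Ψ R) (y : Space d) : ContDiff ℝ ∞ (fun ξ => Ψ (ξ, y)) :=
  h.contDiff.comp (contDiff_prodMk_left y)

theorem hasCompactSupport (h : IsSmoothFamily Ψ R) (q : Sphere d) :
    HasCompactSupport (fun ξ => Ψ (ξ, q)) :=
  HasCompactSupport.intro isCompact_Icc fun ξ hξ => h.eq_zero ξ q hξ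

theorem deriv_eq (h : IsSmoothFamily Ψ R) (y : Space d) :
    deriv (fun ξ => Ψ (ξ, y)) = fun ξ => fderiv ℝ Ψ (ξ, y) (1, 0) := by
  funext ξ
  have h1 : HasFDerivAt Ψ (fderiv ℝ Ψ (ξ, y)) (ξ, y) :=
    (h.contDiff.differentiable (by simp) _).hasFDerivAt
  have h2 : HasDerivAt (fun ξ : ℝ => (ξ, y)) ((1 : ℝ), (0 : Space d)) ξ :=
    (hasDerivAt_id ξ).prodMk (hasDerivAt_const ξ y)
  exact (h1.comp_hasDerivAt ξ h2).deriv

/-- Off the closed interval the function vanishes on a neighbourhood, hence so does its radial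
derivative; the class is stable and the estimates can be iterated. -/
theorem fderiv (h : IsSmoothFamily Ψ R) : IsSmoothFamily (fun p => fderiv ℝ Ψ p (1, 0)) R where
  contDiff := (h.contDiff.fderiv_right (m := ∞) le_rfl).clm_apply contDiff_const
  eq_zero ξ q hξ := by
    have h1 : (fun ξ => Ψ (ξ, (q : Space d))) =ᶠ[𝓝 ξ] fun _ => 0 := by
      filter_upwards [isClosed_Icc.isOpen_compl.mem_nhds hξ] with ζ hζ
      exact h.eq_zero ζ q hζ
    have h2 := congrFun (h.deriv_eq q) ξ
    rw [← h2, h1.deriv_eq, deriv_const]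

theorem exists_norm_fourierInvLine_le (h : IsSmoothFamily Ψ R) :
    ∃ C, 0 ≤ C ∧ ∀ z (q : Sphere d), ‖fourierInvLine (fun ξ => Ψ (ξ, q)) z‖ ≤ C := by
  obtain ⟨K, hK⟩ := ((isCompact_Icc (a := (0 : ℝ)) (b := R)).prod
    (isCompact_sphere (0 : Space d) 1)).exists_bound_of_continuousOn h.contDiff.continuous.continuousOn
  refine ⟨‖(1 / (2 * Real.pi) : ℂ)‖ * |∫ ξ, (Set.Icc 0 R).indicator (fun _ : ℝ => K) ξ|,
    by positivity, fun z q => ?_⟩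
  rw [fourierInvLine, norm_mul]
  gcongr
  refine (norm_integral_le_of_norm_le ((integrable_indicator_iff measurableSet_Icc).2
    (integrableOn_const (by simp))) (Eventually.of_forall fun ξ => ?_)).trans (le_abs_self _)
  rw [norm_mul, norm_exp_I_mul_mul, one_mul]
  by_cases hξ : ξ ∈ Set.Icc 0 R
  · rw [Set.indicator_of_mem hξ]
    exact hK (ξ, q) ⟨hξ, q.2⟩
  · rw [Set.indicator_of_notMem hξ, h.eq_zero ξ q hξ, norm_zero]

/-- A derivative in frequency becomes multiplication by `z`, up to a factor of modulus one. -/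
theorem norm_fourierInvLine_fderiv (h : IsSmoothFamily Ψ R) (z : ℝ) (q : Sphere d) :
    ‖fourierInvLine (fun ξ => _root_.fderiv ℝ Ψ (ξ, (q : Space d)) (1, 0)) z‖ =
      |z| * ‖fourierInvLine (fun ξ => Ψ (ξ, q)) z‖ := by
  have hint : Integrable (fun ξ => Ψ (ξ, (q : Space d))) :=
    (h.contDiff_left q).continuous.integrable_of_hasCompactSupport (h.hasCompactSupport q)
  have hint' : Integrable (deriv fun ξ => Ψ (ξ, (q : Space d))) := by
    rw [h.deriv_eq]
    exact (h.fderiv.contDiff_left q).continuous.integrable_of_hasCompactSupport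
      (h.fderiv.hasCompactSupport q)
  have hp := Real.pi_pos
  rw [← h.deriv_eq, fourierInvLine_eq, fourierInvLine_eq,
    Real.fourier_deriv hint ((h.contDiff_left q).differentiable (by simp)) hint']
  simp only [norm_mul, norm_smul, Complex.norm_real, Real.norm_eq_abs, Complex.norm_I, abs_mul,
    abs_neg, abs_inv, abs_of_pos hp, Complex.norm_ofNat, abs_two]
  field_simp

/-- Each radial derivative buys one power of `z`; uniformity in `q` comes from compactness of the
sphere in the base case. -/
theorem exists_pow_mul_norm_fourierInvLine_le (h : IsSmoothFamily Ψ R) (m : ℕ) :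
    ∃ C, 0 ≤ C ∧ ∀ z (q : Sphere d), |z| ^ m * ‖fourierInvLine (fun ξ => Ψ (ξ, q)) z‖ ≤ C := by
  induction m generalizing Ψ with
  | zero => simpa using h.exists_norm_fourierInvLine_le
  | succ m ih =>
    obtain ⟨C, hC, hle⟩ := ih h.fderiv
    refine ⟨C, hC, fun z q => ?_⟩
    have := hle z q
    rwa [h.norm_fourierInvLine_fderiv, ← mul_assoc, ← pow_succ] at this

/-- The powers `0` and `d + 1`, with `(1 + |z|)^{d+1} ≤ 2^d (1 + |z|^{d+1})`, give the decay
condition for `α = 1`. -/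
theorem exists_decay (h : IsSmoothFamily Ψ R) :
    ∃ C, 0 ≤ C ∧ ∀ z (q : Sphere d),
      ‖fourierInvLine (fun ξ => Ψ (ξ, q)) z‖ ≤ C * (1 + |z|) ^ (-(d : ℝ) - 1) := by
  obtain ⟨C₀, hC₀, h₀⟩ := h.exists_pow_mul_norm_fourierInvLine_le 0
  obtain ⟨C₁, hC₁, h₁⟩ := h.exists_pow_mul_norm_fourierInvLine_le (d + 1)
  refine ⟨2 ^ d * (C₀ + C₁), by positivity, fun z q => ?_⟩
  have hz : 0 < 1 + |z| := by positivity
  have e : (1 + |z|) ^ (-(d : ℝ) - 1) = ((1 + |z|) ^ (d + 1))⁻¹ := by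
    rw [← Real.rpow_natCast, ← Real.rpow_neg hz.le]
    congr 1
    push_cast; ring
  rw [e, ← div_eq_mul_inv, le_div_iff₀ (by positivity), mul_comm]
  have h2 := add_pow_le zero_le_one (abs_nonneg z) (d + 1)
  rw [one_pow, Nat.add_sub_cancel] at h2
  have h3 := h₀ z q
  rw [pow_zero, one_mul] at h3
  calc _ ≤ 2 ^ d * (1 + |z| ^ (d + 1)) * ‖fourierInvLine (fun ξ => Ψ (ξ, q)) z‖ := by gcongr
    _ = 2 ^ d * (‖fourierInvLine (fun ξ => Ψ (ξ, q)) z‖ +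
        |z| ^ (d + 1) * ‖fourierInvLine (fun ξ => Ψ (ξ, q)) z‖) := by ring
    _ ≤ 2 ^ d * (C₀ + C₁) := by gcongr; exact h₁ z q

theorem isSpectralProfile [NeZero d] (h : IsSmoothFamily Ψ R) {v : ℝ → Sphere d → ℂ} {M : ℝ}
    (hv : ∀ ξ q, v ξ q = Ψ (ξ, q)) (h0 : ∀ ξ q, ξ ≤ 0 → v ξ q = 0) (hM : ∀ ξ q, M ≤ ξ → v ξ q = 0) :
    IsSpectralProfile v M where
  contMDiff := by
    have h1 : ContMDiff (𝓘(ℝ, ℝ).prod (𝓡 (d - 1))) 𝓘(ℝ, ℝ × Space d) ((d - 1 : ℕ) : WithTop ℕ∞)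
        (fun p : ℝ × Sphere d => (p.1, (p.2 : Space d))) :=
      contMDiff_fst.prodMk_space (contMDiff_coe_sphere.comp contMDiff_snd)
    have h2 : ContMDiff 𝓘(ℝ, ℝ × Space d) 𝓘(ℝ, ℂ) ((d - 1 : ℕ) : WithTop ℕ∞) Ψ :=
      (contDiff_infty.1 h.contDiff (d - 1)).contMDiff
    have h3 := h2.comp h1
    convert h3 using 1
    funext p
    exact hv p.1 p.2
  eq_zero_of_nonpos := h0
  eq_zero_of_ge := hM

end IsSmoothFamily

/-! ### Test functions cut off near the origin and their density in `L²`. -/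

/-- A smooth cutoff removing the interval `r ≤ ρ`. -/
def radialCutoff (ρ r : ℝ) : ℝ := Real.smoothTransition (r / ρ - 1)

theorem radialCutoff_eq_zero {ρ r : ℝ} (hρ : 0 < ρ) (h : r ≤ ρ) : radialCutoff ρ r = 0 :=
  Real.smoothTransition.zero_of_nonpos (by rw [sub_nonpos, div_le_one hρ]; exact h)

theorem radialCutoff_eq_one {ρ r : ℝ} (hρ : 0 < ρ) (h : 2 * ρ ≤ r) : radialCutoff ρ r = 1 :=
  Real.smoothTransition.one_of_one_le (by rw [le_sub_iff_add_le, le_div_iff₀ hρ]; linarith)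

theorem radialCutoff_nonneg (ρ r : ℝ) : 0 ≤ radialCutoff ρ r := Real.smoothTransition.nonneg _

theorem radialCutoff_le_one (ρ r : ℝ) : radialCutoff ρ r ≤ 1 := Real.smoothTransition.le_one _

theorem contDiff_radialCutoff (ρ : ℝ) : ContDiff ℝ ∞ (radialCutoff ρ) :=
  Real.smoothTransition.contDiff.comp ((contDiff_id.div_const ρ).sub contDiff_const)

/-- A real power can fail to be smooth only at the origin, near which the cutoff vanishes. -/
theorem contDiff_rpow_mul_radialCutoff {ρ : ℝ} (hρ : 0 < ρ) (a : ℝ) :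
    ContDiff ℝ ∞ (fun ξ : ℝ => ξ ^ a * radialCutoff ρ ξ) := by
  rw [contDiff_iff_contDiffAt]
  intro ξ
  rcases lt_or_ge ξ ρ with h | h
  · refine (contDiffAt_const (c := (0 : ℝ))).congr_of_eventuallyEq ?_
    filter_upwards [gt_mem_nhds h] with ζ hζ
    rw [radialCutoff_eq_zero hρ (le_of_lt hζ), mul_zero]
  · exact (Real.contDiffAt_rpow_const_of_ne (hρ.trans_le h).ne').mul (contDiff_radialCutoff ρ).contDiffAt

/-- A test function multiplied by the radial cutoff. -/
def cutoffDatum {d : ℕ} (ρ : ℝ) (Φ : Space d → ℂ) (k : Space d) : ℂ := radialCutoff ρ ‖k‖ * Φ k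

/-- The spectral profile of a cut off test function as a smooth family. -/
def cutoffFamily {d : ℕ} (ρ : ℝ) (Φ : Space d → ℂ) (p : ℝ × Space d) : ℂ :=
  dimConst d * ((p.1 ^ (((d : ℝ) - 1) / 2) * radialCutoff ρ p.1 : ℝ) : ℂ) * Φ (p.1 • p.2)

theorem restriction_cutoffDatum {d : ℕ} {ρ : ℝ} (hρ : 0 < ρ) (Φ : Space d → ℂ) (ξ : ℝ)
    (q : Sphere d) : restriction (cutoffDatum ρ Φ) ξ q = cutoffFamily ρ Φ (ξ, q) := by
  rw [restriction_eq, cutoffFamily]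
  split_ifs with h
  · rw [cutoffDatum, norm_smul, norm_eq_of_mem_sphere, mul_one, Real.norm_eq_abs, abs_of_pos h]
    push_cast; ring
  · simp [radialCutoff_eq_zero hρ ((not_lt.1 h).trans hρ.le)]

theorem isSmoothFamily_cutoffFamily {d : ℕ} {ρ R : ℝ} (hρ : 0 < ρ) {Φ : Space d → ℂ}
    (hΦ : ContDiff ℝ ∞ Φ) (hR : ∀ x, R ≤ ‖x‖ → Φ x = 0) : IsSmoothFamily (cutoffFamily ρ Φ) R where
  contDiff := by
    refine (contDiff_const.mul ?_).mul (hΦ.comp (contDiff_fst.smul contDiff_snd))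
    exact Complex.ofRealCLM.contDiff.comp ((contDiff_rpow_mul_radialCutoff hρ _).comp contDiff_fst)
  eq_zero ξ q hξ := by
    rw [cutoffFamily]
    rcases lt_or_ge ξ 0 with h | h
    · simp [radialCutoff_eq_zero hρ (h.le.trans hρ.le)]
    · rw [hR, mul_zero]
      rw [norm_smul, norm_eq_of_mem_sphere, mul_one, Real.norm_eq_abs, abs_of_nonneg h]
      by_contra hlt
      exact hξ ⟨h, (not_le.1 hlt).le⟩

theorem exists_isBoundedDatum_cutoffDatum {d : ℕ} (ρ : ℝ) {R : ℝ} {Φ : Space d → ℂ}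
    (hΦ : Continuous Φ) (hΦs : HasCompactSupport Φ) (hR : ∀ x, R ≤ ‖x‖ → Φ x = 0) :
    ∃ B, IsBoundedDatum (cutoffDatum ρ Φ) B R := by
  obtain ⟨B, hB⟩ := hΦ.bounded_above_of_compact_support hΦs
  refine ⟨B, ?_, fun x => ?_, fun x hx => by rw [cutoffDatum, hR x hx, mul_zero]⟩
  · exact ((Complex.continuous_ofReal.comp ((contDiff_radialCutoff ρ).continuous.comp
      continuous_norm)).mul hΦ).measurable
  · rw [cutoffDatum, norm_mul, Complex.norm_real, Real.norm_of_nonneg (radialCutoff_nonneg _ _)]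
    exact (mul_le_of_le_one_left (norm_nonneg _) (radialCutoff_le_one _ _)).trans (hB x)

/-- Pointwise convergence of the reconstruction of cut off test functions. -/
theorem tendsto_profileHat_cutoffDatum {d : ℕ} [NeZero d] (hd : d ∈ ({1, 2, 3} : Set ℕ)) {ρ R : ℝ}
    (hρ : 0 < ρ) {Φ : Space d → ℂ} (hΦ : ContDiff ℝ ∞ Φ) (hR : ∀ x, R ≤ ‖x‖ → Φ x = 0)
    {k : Space d} (hk : k ≠ 0) :
    Tendsto (fun N : ℝ => profileHat N (cutoffDatum ρ Φ) k *
      Complex.exp (Complex.I * ((N * ‖k‖ : ℝ) : ℂ))) atTop (𝓝 (cutoffDatum ρ Φ k)) := by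
  have hfam := isSmoothFamily_cutoffFamily hρ hΦ hR
  have hv : IsSpectralProfile (restriction (cutoffDatum ρ Φ)) R := by
    refine hfam.isSpectralProfile (restriction_cutoffDatum hρ Φ) (fun ξ q hξ => ?_) (fun ξ q hξ => ?_)
    · rw [restriction_eq, if_neg (not_lt.2 hξ)]
    · rw [restriction_eq]
      split_ifs with h
      · rw [cutoffDatum, hR, mul_zero, mul_zero]
        rwa [norm_smul, norm_eq_of_mem_sphere, mul_one, Real.norm_eq_abs, abs_of_pos h]
      · rfl
  obtain ⟨C, hC, hdecay⟩ := hfam.exists_decay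
  have hk0 : 0 < ‖k‖ := norm_pos_iff.2 hk
  have key := tendsto_fourierSpace_shellProfile hd hv hC one_pos (fun z q => by
    simp_rw [restriction_cutoffDatum hρ]
    exact hdecay z q) k hk
  have hval : ((‖k‖ ^ (((d : ℝ) - 1) / 2) : ℝ) : ℂ)⁻¹ * ((2 * Real.pi * Complex.I) ^ (((d : ℂ) - 1) / 2) *
      restriction (cutoffDatum ρ Φ) ‖k‖ (direction k hk)) = cutoffDatum ρ Φ k := by
    have h1 : ((‖k‖ ^ (((d : ℝ) - 1) / 2) : ℝ) : ℂ) ≠ 0 := by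
      exact_mod_cast (Real.rpow_pos_of_pos hk0 _).ne'
    have h2 : ‖k‖ • (direction k hk : Space d) = k := by
      simp only [direction, smul_smul, mul_inv_cancel₀ hk0.ne', one_smul]
    rw [restriction_eq, if_pos hk0, h2]
    field_simp
    linear_combination (cutoffDatum ρ Φ k) * cpow_mul_dimConst d
  rw [hval] at key
  exact key

theorem exists_ball_volume_le {d : ℕ} [NeZero d] {δ : ℝ} (hδ : 0 < δ) :
    ∃ r, 0 < r ∧ volume (Metric.ball (0 : Space d) r) ≤ ENNReal.ofReal δ := by
  obtain ⟨U, hU, hUo, hUδ⟩ := Set.exists_isOpen_lt_of_lt ({0} : Set (Space d)) (ENNReal.ofReal δ)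
    (μ := volume) (by rw [measure_singleton]; exact ENNReal.ofReal_pos.2 hδ)
  obtain ⟨r, hr, hrU⟩ := Metric.isOpen_iff.1 hUo 0 (hU rfl)
  exact ⟨r, hr, (measure_mono hrU).trans hUδ.le⟩

/-- Cut off test functions are dense in `L²`. -/
theorem exists_cutoffDatum_eLpNorm_sub_le {d : ℕ} [NeZero d] {u : Space d → ℂ} (hu : MemLp u 2)
    {δ : ℝ} (hδ : 0 < δ) :
    ∃ ρ, 0 < ρ ∧ ∃ Φ : Space d → ℂ, ContDiff ℝ ∞ Φ ∧ HasCompactSupport Φ ∧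
      eLpNorm (fun x => u x - cutoffDatum ρ Φ x) 2 volume ≤ ENNReal.ofReal δ := by
  -- Half of `δ` is spent on the small ball where the cutoff acts, by absolute continuity of the
  -- `L²` norm, and half on approximation by a test function.
  obtain ⟨η, hη, hsmall⟩ := hu.eLpNorm_indicator_le (by norm_num) (by norm_num) (half_pos hδ)
  obtain ⟨r, hr, hvol⟩ := exists_ball_volume_le (d := d) hη
  obtain ⟨Φ, hΦs, hΦ, hΦu⟩ := hu.exist_eLpNorm_sub_le (by norm_num) (by norm_num) (half_pos hδ)
  -- The cutoff equals one from twice its parameter on, that is, outside the ball of radius `r`.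
  have hρ : 0 < r / 2 := half_pos hr
  refine ⟨r / 2, hρ, Φ, hΦ, hΦs, ?_⟩
  have hΦc := hΦ.continuous
  have hb : ∀ x, ‖u x - cutoffDatum (r / 2) Φ x‖ ≤
      ‖‖(Metric.ball (0 : Space d) r).indicator u x‖ + ‖(u - Φ) x‖‖ := by
    intro x
    rw [Real.norm_of_nonneg (by positivity)]
    set χ := radialCutoff (r / 2) ‖x‖ with hχ
    have h0 : 0 ≤ χ := radialCutoff_nonneg _ _
    have h1 : χ ≤ 1 := radialCutoff_le_one _ _
    have e : u x - cutoffDatum (r / 2) Φ x = ((1 - χ : ℝ) : ℂ) * u x + (χ : ℂ) * (u - Φ) x := by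
      rw [cutoffDatum, ← hχ, Pi.sub_apply]; push_cast; ring
    rw [e]
    refine (norm_add_le _ _).trans (add_le_add ?_ ?_)
    · rw [norm_mul, Complex.norm_real, Real.norm_of_nonneg (by linarith)]
      by_cases hx : x ∈ Metric.ball (0 : Space d) r
      · rw [Set.indicator_of_mem hx]
        exact mul_le_of_le_one_left (norm_nonneg _) (by linarith)
      · have : χ = 1 := radialCutoff_eq_one hρ (by
          rw [mem_ball_zero_iff, not_lt] at hx; linarith)
        rw [this, sub_self, zero_mul]
        exact norm_nonneg _
    · rw [norm_mul, Complex.norm_real, Real.norm_of_nonneg h0]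
      exact mul_le_of_le_one_left (norm_nonneg _) h1
  refine (eLpNorm_mono hb).trans ?_
  refine (eLpNorm_add_le (hu.1.indicator measurableSet_ball).norm
    (hu.1.sub hΦc.aestronglyMeasurable).norm (by norm_num)).trans ?_
  rw [eLpNorm_norm, eLpNorm_norm]
  refine (add_le_add (hsmall _ measurableSet_ball hvol) hΦu).trans ?_
  rw [← ENNReal.ofReal_add (by positivity) (by positivity), add_halves]

/-! ### Weak convergence by density, and the main theorem. -/

section

theorem add_sq_le_four_mul (a b : ENNReal) : (a + b) ^ 2 ≤ 4 * (a ^ 2 + b ^ 2) := by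
  rcases le_total a b with h | h
  · calc (a + b) ^ 2 ≤ (b + b) ^ 2 := by gcongr
      _ = 4 * b ^ 2 := by ring
      _ ≤ 4 * (a ^ 2 + b ^ 2) := by gcongr; exact le_add_self
  · calc (a + b) ^ 2 ≤ (a + a) ^ 2 := by gcongr
      _ = 4 * a ^ 2 := by ring
      _ ≤ 4 * (a ^ 2 + b ^ 2) := by gcongr; exact le_self_add

/-- The factor `e^{i N |k|}` removing the fast oscillation. -/
def radialPhase {d : ℕ} (N : ℝ) (k : Space d) : ℂ := Complex.exp (Complex.I * ((N * ‖k‖ : ℝ) : ℂ))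

theorem norm_radialPhase {d : ℕ} (N : ℝ) (k : Space d) : ‖radialPhase N k‖ = 1 :=
  norm_exp_I_mul_ofReal_eq_one _

theorem continuous_radialPhase {d : ℕ} (N : ℝ) : Continuous (radialPhase (d := d) N) := by
  unfold radialPhase
  fun_prop

theorem eLpNorm_mul_radialPhase {d : ℕ} (f : Space d → ℂ) (N : ℝ) :
    eLpNorm (fun k => f k * radialPhase N k) 2 volume = eLpNorm f 2 volume :=
  eLpNorm_congr_norm_ae (Eventually.of_forall fun k => by rw [norm_mul, norm_radialPhase, mul_one])

theorem memLp_mul_radialPhase {d : ℕ} {f : Space d → ℂ} (hf : MemLp f 2) (N : ℝ) :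
    MemLp (fun k => f k * radialPhase N k) 2 :=
  ⟨hf.1.mul (continuous_radialPhase N).aestronglyMeasurable,
    (eLpNorm_mul_radialPhase f N).trans_lt hf.2⟩

variable {d : ℕ} [NeZero d]

theorem IsBoundedDatum.toReal_eLpNorm_profileHat_le {u : Space d → ℂ} {B R δ : ℝ}
    (h : IsBoundedDatum u B R) (hδ : 0 ≤ δ) (hu : eLpNorm u 2 volume ≤ ENNReal.ofReal δ) (N : ℝ) :
    (eLpNorm (profileHat N u) 2 volume).toReal ≤ √(reconstructionBound d).toReal * δ := by
  refine le_of_sq_le_sq ?_ (by positivity)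
  rw [mul_pow, Real.sq_sqrt ENNReal.toReal_nonneg, ← ENNReal.toReal_pow]
  refine (ENNReal.toReal_mono (ENNReal.mul_ne_top (reconstructionBound_ne_top d) (by simp))
    ((h.eLpNorm_profileHat_sq_le N).trans (mul_le_mul_right (pow_le_pow_left₀ bot_le hu 2) _))).trans ?_
  rw [ENNReal.toReal_mul, ENNReal.toReal_pow, ENNReal.toReal_ofReal hδ]

/-- Weak convergence of the reconstruction for test functions away from the origin. -/
theorem tendsto_integral_profileHat_cutoffDatum (hd : d ∈ ({1, 2, 3} : Set ℕ)) {ρ B R : ℝ}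
    (hρ : 0 < ρ) {Φ : Space d → ℂ} (hΦ : ContDiff ℝ ∞ Φ) (hR : ∀ x, R ≤ ‖x‖ → Φ x = 0)
    (hw : IsBoundedDatum (cutoffDatum ρ Φ) B R) {g : Space d → ℂ} (hg : MemLp g 2) :
    Tendsto (fun N : ℝ => ∫ k, (profileHat N (cutoffDatum ρ Φ) k * radialPhase N k -
      cutoffDatum ρ Φ k) * (starRingEnd ℂ) (g k)) atTop (𝓝 0) := by
  set w := cutoffDatum ρ Φ
  refine tendsto_integral_mul_conj_zero
    (B := 4 * (reconstructionBound d * eLpNorm w 2 volume ^ 2 + eLpNorm w 2 volume ^ 2))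
    ?_ (fun N => ?_) (fun N => ?_) ?_ hg
  · have h1 := reconstructionBound_ne_top d
    have h2 := (hw.memLp 2).2.ne
    finiteness
  · exact ((hw.continuous_profileHat N).measurable.mul (continuous_radialPhase N).measurable).sub
      hw.measurable
  · calc ∫⁻ k, ‖profileHat N w k * radialPhase N k - w k‖ₑ ^ 2
        ≤ ∫⁻ k, 4 * (‖profileHat N w k‖ₑ ^ 2 + ‖w k‖ₑ ^ 2) := by
          refine lintegral_mono fun k => ?_
          refine le_trans ?_ (add_sq_le_four_mul _ _)
          gcongr
          refine enorm_sub_le.trans_eq ?_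
          rw [enorm_mul, ← ofReal_norm (radialPhase N k), norm_radialPhase, ENNReal.ofReal_one, mul_one]
      _ = 4 * (eLpNorm (profileHat N w) 2 volume ^ 2 + eLpNorm w 2 volume ^ 2) := by
          rw [lintegral_const_mul' _ _ (by simp), lintegral_add_right _ (hw.measurable.enorm.pow_const 2),
            eLpNorm_two_sq, eLpNorm_two_sq]
      _ ≤ _ := by
          gcongr
          exact hw.eLpNorm_profileHat_sq_le N
  -- The pointwise limit excludes only the origin, a null set.
  · have : ∀ᵐ k : Space d, k ≠ 0 := by
      rw [ae_iff]; simp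
    filter_upwards [this] with k hk
    have := (tendsto_profileHat_cutoffDatum hd hρ hΦ hR hk).sub_const (w k)
    rwa [sub_self] at this

/-- Weak convergence of the reconstruction of bounded data with bounded support. -/
theorem tendsto_integral_profileHat (hd : d ∈ ({1, 2, 3} : Set ℕ)) {u : Space d → ℂ} {B R : ℝ}
    (hu : IsBoundedDatum u B R) {g : Space d → ℂ} (hg : MemLp g 2) :
    Tendsto (fun N : ℝ => ∫ k, profileHat N u k * radialPhase N k * (starRingEnd ℂ) (g k)) atTop
      (𝓝 (∫ k, u k * (starRingEnd ℂ) (g k))) := by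
  rw [Metric.tendsto_nhds]
  intro ε hε
  set s := √(reconstructionBound d).toReal
  set G := (eLpNorm g 2 volume).toReal
  have hs : 0 ≤ s := Real.sqrt_nonneg _
  have hG : 0 ≤ G := ENNReal.toReal_nonneg
  -- Chosen so that the errors `s δ G`, from reconstructing `u - w`, and `δ G`, from `u - w` itself,
  -- sum to at most `ε/2`; the added ones keep the denominator positive.
  set δ := ε / (2 * ((s + 1) * (G + 1))) with hδdef
  have hδ : 0 < δ := by positivity
  have hδε : (s + 1) * (δ * (G + 1)) = ε / 2 := by rw [hδdef]; field_simp
  obtain ⟨ρ, hρ, Φ, hΦ, hΦs, hle⟩ := exists_cutoffDatum_eLpNorm_sub_le (hu.memLp 2) hδ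
  obtain ⟨R', -, hR'⟩ := exists_eq_zero_of_norm_ge hΦs
  obtain ⟨B', hw⟩ := exists_isBoundedDatum_cutoffDatum ρ hΦ.continuous hΦs hR'
  have hlim := tendsto_integral_profileHat_cutoffDatum hd hρ hΦ hR' hw hg
  set w := cutoffDatum ρ Φ
  have hdiff := hu.sub hw
  filter_upwards [Metric.tendsto_nhds.1 hlim (ε / 2) (half_pos hε)] with N hN
  rw [dist_zero_right] at hN
  have m1 := memLp_mul_radialPhase (hdiff.memLp_profileHat N) N
  have m2 : MemLp (fun k => profileHat N w k * radialPhase N k - w k) 2 volume := (memLp_mul_radialPhase (hw.memLp_profileHat N) N).sub (hw.memLp 2)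
  have m3 : MemLp (fun k => u k - w k) 2 volume := hdiff.memLp 2
  have m4 := memLp_mul_radialPhase (hu.memLp_profileHat N) N
  -- Of the three terms only the middle one needs `N` large; the outer two are small uniformly in
  -- `N`.
  have e : (∫ k, profileHat N u k * radialPhase N k * (starRingEnd ℂ) (g k)) -
      (∫ k, u k * (starRingEnd ℂ) (g k)) =
      (∫ k, profileHat N (fun x => u x - w x) k * radialPhase N k * (starRingEnd ℂ) (g k)) +
      (∫ k, (profileHat N w k * radialPhase N k - w k) * (starRingEnd ℂ) (g k)) -
      (∫ k, (u k - w k) * (starRingEnd ℂ) (g k)) := by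
    have i12 : Integrable (fun k => profileHat N (fun x => u x - w x) k * radialPhase N k *
        (starRingEnd ℂ) (g k) + (profileHat N w k * radialPhase N k - w k) * (starRingEnd ℂ) (g k)) :=
      (integrable_mul_conj m1 hg).add (integrable_mul_conj m2 hg)
    rw [← integral_sub (integrable_mul_conj m4 hg) (integrable_mul_conj (hu.memLp 2) hg),
      ← integral_add (integrable_mul_conj m1 hg) (integrable_mul_conj m2 hg),
      ← integral_sub i12 (integrable_mul_conj m3 hg)]
    refine integral_congr_ae (Eventually.of_forall fun k => ?_)
    simp only [hu.profileHat_sub hw]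
    ring
  have b1 := norm_integral_mul_conj_le m1 hg
  rw [eLpNorm_mul_radialPhase] at b1
  have b1' := hdiff.toReal_eLpNorm_profileHat_le hδ.le hle N
  have b3 := norm_integral_mul_conj_le m3 hg
  have b3' : (eLpNorm (fun x => u x - w x) 2 volume).toReal ≤ δ :=
    ENNReal.toReal_le_of_le_ofReal hδ.le hle
  rw [dist_eq_norm, e]
  refine ((norm_sub_le _ _).trans (add_le_add_left (norm_add_le _ _) _)).trans_lt ?_
  have c1 := b1.trans (mul_le_mul_of_nonneg_right b1' hG)
  have c3 := b3.trans (mul_le_mul_of_nonneg_right b3' hG)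
  have c4 : s * δ * G + δ * G ≤ ε / 2 := by
    rw [← hδε]
    nlinarith [mul_nonneg (add_nonneg hs zero_le_one) hδ.le]
  linarith

/-- As `b` depends on the radius alone, its unimodular factor passes through the restriction to rays
and joins the datum; this leaves the weak limit without any evolution. -/
theorem evolution_restriction {d : ℕ} (b : ℝ → ℝ) (u : Space d → ℂ) (ξ : ℝ) (q : Sphere d) (τ : ℝ) :
    evolution b (restriction u) ξ q τ =
      restriction (fun k => Complex.exp (-Complex.I * b ‖k‖ * τ) * u k) ξ q := by
  rw [evolution, restriction_eq, restriction_eq]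
  split_ifs with h
  · rw [norm_smul, norm_eq_of_mem_sphere, mul_one, Real.norm_eq_abs, abs_of_pos h]
    ring
  · rw [mul_zero]

/-- A property holding almost everywhere on the line holds for almost every norm. -/
theorem ae_norm_of_ae {p : ℝ → Prop} (h : ∀ᵐ r, p r) : ∀ᵐ k : Space d, p ‖k‖ := by
  -- A measurable null superset allows polar coordinates, in which every ray meets the preimage in a
  -- null set.
  obtain ⟨T, hT, hTm, hT0⟩ := exists_measurable_superset_of_null (ae_iff.1 h)
  have hms : MeasurableSet {k : Space d | ‖k‖ ∈ T} := measurable_norm hTm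
  have : volume {k : Space d | ‖k‖ ∈ T} = 0 := by
    rw [← lintegral_indicator_one hms, lintegral_polar (measurable_one.indicator hms),
      lintegral_eq_zero_of_ae_eq_zero]
    refine Eventually.of_forall fun q => ?_
    refine lintegral_eq_zero_of_ae_eq_zero ?_
    have hTc : ∀ᵐ r : ℝ ∂volume.restrict (Set.Ioi 0), r ∉ T :=
      ae_restrict_of_ae (measure_eq_zero_iff_ae_notMem.1 hT0)
    filter_upwards [hTc, ae_restrict_mem measurableSet_Ioi] with r hr hr0
    have hr0' : 0 < r := hr0
    rw [Set.indicator_of_notMem, mul_zero]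
    · rfl
    · rw [Set.mem_ofPred_eq, norm_smul, norm_eq_of_mem_sphere, mul_one, Real.norm_eq_abs, abs_of_pos hr0']
      exact hr
  refine ae_iff.2 (measure_mono_null (fun k hk => ?_) this)
  exact hT hk

theorem tendstoWeaklyL2_reconstructionHat (hd : d ∈ ({1, 2, 3} : Set ℕ)) {c : ℝ} (hc : 0 < c)
    {u : Space d → ℂ} (hcont : Continuous u) (hsupp : HasCompactSupport u) {b : ℝ → ℝ}
    (hb : AEMeasurable b volume) {τ : ℝ} (hτ : 0 < τ) :
    TendstoWeaklyL2 (fun (ε : ℝ) (k : Space d) => reconstructionHat c ε b u k (τ / ε ^ 2)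
        * Complex.exp (Complex.I * ((c * ‖k‖ * τ / ε ^ 2 : ℝ) : ℂ)))
      (fun k => Complex.exp (-Complex.I * b ‖k‖ * τ) * u k) := by
  -- A Borel representative makes the absorbed datum measurable. The change is invisible in the
  -- integrals over `ξ`, and also in the limit, because null sets of radii give null sets of `k`.
  set b' := hb.mk b
  have hb'm : Measurable b' := hb.measurable_mk
  have hbb' : ∀ᵐ ξ, b ξ = b' ξ := hb.ae_eq_mk
  set u' : Space d → ℂ := fun k => Complex.exp (-Complex.I * b' ‖k‖ * τ) * u k with hu'
  have hGae : (fun k => Complex.exp (-Complex.I * b ‖k‖ * τ) * u k) =ᵐ[volume] u' := by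
    filter_upwards [ae_norm_of_ae (d := d) hbb'] with k hk
    rw [hu', hk]
  obtain ⟨R, -, hR⟩ := exists_eq_zero_of_norm_ge hsupp
  obtain ⟨B, hB⟩ := hcont.bounded_above_of_compact_support hsupp
  have hdat : IsBoundedDatum u' B R := by
    refine ⟨?_, fun k => ?_, fun k hk => by simp only [hu', hR k hk, mul_zero]⟩
    · refine Measurable.mul (Complex.measurable_exp.comp ?_) hcont.measurable
      exact (measurable_const.mul (Complex.measurable_ofReal.comp (hb'm.comp measurable_norm))).mul_const _
    · have : -Complex.I * b' ‖k‖ * τ = Complex.I * ((-(b' ‖k‖ * τ) : ℝ) : ℂ) := by push_cast; ring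
      simp only [hu']
      rw [norm_mul, this, norm_exp_I_mul_ofReal_eq_one, one_mul]
      exact hB k
  have hF : ∀ ε : ℝ, 0 < ε → (fun k : Space d => reconstructionHat c ε b u k (τ / ε ^ 2)
        * Complex.exp (Complex.I * ((c * ‖k‖ * τ / ε ^ 2 : ℝ) : ℂ))) =
      fun k => profileHat (c * τ / ε ^ 2) u' k * radialPhase (c * τ / ε ^ 2) k := by
    intro ε hε
    funext k
    have h5 : c * τ / ε ^ 2 * ‖k‖ = c * ‖k‖ * τ / ε ^ 2 := by ring
    have hprof : (fun z q => fourierInvProfile (evolution b (restriction u)) z q τ) = profile u' := by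
      funext z q
      rw [fourierInvProfile_eq, profile, fourierInvLine, fourierInvLine]
      congr 1
      refine integral_congr_ae ?_
      filter_upwards [hbb'] with ξ hξ
      rw [hu', ← evolution_restriction, evolution, evolution, hξ]
    simp only [reconstructionHat, reconstruction, shell_eq_shellProfile hε.ne', hprof, radialPhase, h5]
    rfl
  refine ⟨fun ε hε => ?_, (memLp_congr_ae hGae).2 (hdat.memLp 2), fun g hg => ?_⟩
  · refine (memLp_congr_ae (Eventually.of_forall (congrFun (hF ε hε)))).2 ?_
    exact memLp_mul_radialPhase (hdat.memLp_profileHat _) _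
  · have hlim : ∫ k, Complex.exp (-Complex.I * b ‖k‖ * τ) * u k * (starRingEnd ℂ) (g k) =
        ∫ k, u' k * (starRingEnd ℂ) (g k) := by
      refine integral_congr_ae ?_
      filter_upwards [hGae] with k hk
      rw [hk]
    rw [hlim]
    refine ((tendsto_integral_profileHat hd hdat hg).comp
      (tendsto_div_sq_nhdsGT (mul_pos hc hτ))).congr' ?_
    filter_upwards [self_mem_nhdsWithin] with ε hε
    have := hF ε hε
    refine integral_congr_ae (Eventually.of_forall fun k => ?_)
    exact congrArg (· * (starRingEnd ℂ) (g k)) (congrFun this k).symm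

end

end ShellReconstruction

end

theorem theorem2p6 (d : ℕ) [NeZero d] (hd : d ∈ ({1, 2, 3} : Set ℕ))
    (c : ℝ) (hc : 0 < c)
    (uhat₀ : ShellReconstruction.Space d → ℂ) (hcont : Continuous uhat₀)
    (hsupp : HasCompactSupport uhat₀)
    (b : ℝ → ℝ) (hb : AEMeasurable b volume)
    (ρ : ℝ) (hρ : 0 < ρ) (W : ℝ → ℝ)
    (hW : ShellReconstruction.IsRegularizedWeight d ρ W)
    (hV : ShellReconstruction.DecayAndSmoothness
      (ShellReconstruction.evolution b (ShellReconstruction.restrictionReg W uhat₀))) :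
    (∀ τ : ℝ, 0 < τ → ∀ k : ShellReconstruction.Space d, ρ < ‖k‖ →
      Tendsto
        (fun ε : ℝ => ShellReconstruction.reconstructionRegHat c ε b W uhat₀ k (τ / ε ^ 2)
          * Complex.exp (Complex.I * ((c * ‖k‖ * τ / ε ^ 2 : ℝ) : ℂ)))
        (𝓝[>] 0)
        (𝓝 (Complex.exp (-Complex.I * b ‖k‖ * τ) * uhat₀ k))) ∧
    (∀ τ : ℝ, 0 < τ →
      ShellReconstruction.TendstoWeaklyL2
        (fun (ε : ℝ) (k : ShellReconstruction.Space d) =>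
          ShellReconstruction.reconstructionHat c ε b uhat₀ k (τ / ε ^ 2)
            * Complex.exp (Complex.I * ((c * ‖k‖ * τ / ε ^ 2 : ℝ) : ℂ)))
        (fun k => Complex.exp (-Complex.I * b ‖k‖ * τ) * uhat₀ k)) := by
  exact ⟨fun τ hτ k hk => ShellReconstruction.tendsto_reconstructionRegHat hd hc hsupp hρ hW hV hτ hk,
    fun τ hτ => ShellReconstruction.tendstoWeaklyL2_reconstructionHat hd hc hcont hsupp hb hτ⟩
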